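/- **Theorem 2.** Let $V=\{0,\dots,n-1\}$ be divided into two clusters (one of them possibly empty) by an unknown function $\sigma:V\to\{-1,+1\}$, $R=\sigma^{-1}(-1)$, $B=\sigma^{-1}(+1)$. Each pair $\{u,v\}$ of distinct items can be queried once; the answer is $\sigma(u)\sigma(v)\eta_{u,v}$, where the $\eta_{u,v}\in\{\pm1\}$ are independent and identically distributed with mean $\delta=1-2q$, that is, the answer is correct with probability $1-q=\frac{1+\delta}{2}$. For $K>0$ put $$\Delta=\Delta_K(n,\delta)=K\max\Big\{\frac{1}{\delta^4}\log n,\ \Big(\frac1\delta\Big)^{4+\frac{2+2\epsilon}{\epsilon}}\Big\},\qquad \epsilon=\epsilon(n)=\frac{1}{\sqrt{\log\log n}}.$$ There exist a randomized non-adaptive algorithm, that is, one that chooses all of its queries before it sees any answer, a polynomial $p$ and an absolute constant $K>0$ such that the following hold. 1. Given $n$ and a number $m\le\binom n2$ of queries, but not $\delta$, the algorithm queries a uniformly random set of exactly $m$ pairs, and then computes from the answers a partition of $V$. Whatever its random choices and the answers, each of these two stages takes at most $p(n)$ steps on a random-access machine with unit-cost addition, subtraction, indirect addressing and random choice of an integer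 in a given range. 2. For every fixed $\delta\in(0,1)$, $\lceil n\Delta\rceil\le\binom n2$ for all sufficiently large $n$. 3. With $m=\lceil n\Delta\rceil=\Theta(n\Delta)$ queries the algorithm recovers the clustering $\{R,B\}$ with high probability for any bias $0<\delta<1$: for every choice of $\sigma=\sigma_n$ and of $\delta=\delta_n\in(0,1)$, constant or depending on $n$, such that $\lceil n\Delta\rceil\le\binom n2$ for all sufficiently large $n$, the probability, over the noise and the random choices of the algorithm, that the computed partition is $\{R,B\}$ tends to $1$ as $n\to\infty$. -/

import Mathlib

open Filter Topology MeasureTheory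

noncomputable section

namespace NoisyClustering

/-! ### Randomized random-access machines

A machine has registers `reg 0, reg 1, …` (a program names only finitely many of them) and a memory
`mem 0, mem 1, …` that is addressed through registers; all cells hold natural numbers. Every
elementary instruction, and every evaluation of a test, costs one step. There is no multiplication,
so that `t` steps only produce numbers with `O(t)` more bits than the input: polynomially many
steps of this machine amount to polynomial time in the usual sense. -/

/-- Programs of the machine. -/
inductive Prog : Type
  /-- do nothing -/
  | skip : Prog
  /-- `reg x := k` -/
  | const (x k : ℕ) : Prog
  /-- `reg x := reg y + reg z` -/
  | add (x y z : ℕ) : Prog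
  /-- `reg x := max (reg y - reg z) 0` -/
  | sub (x y z : ℕ) : Prog
  /-- `reg x := mem (reg y)` -/
  | load (x y : ℕ) : Prog
  /-- `mem (reg x) := reg y` -/
  | store (x y : ℕ) : Prog
  /-- `reg x :=` a fresh uniformly random element of `{0, …, reg y}` -/
  | rand (x y : ℕ) : Prog
  /-- first `p`, then `q` -/
  | seq (p q : Prog) : Prog
  /-- if `reg x ≠ 0` then `p` else `q` -/
  | ite (x : ℕ) (p q : Prog) : Prog
  /-- while `reg x ≠ 0` do `p` -/
  | loop (x : ℕ) (p : Prog) : Prog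

/-- A configuration: the programs still to be executed (in this order), the registers and the
memory. The machine has halted when nothing is left to be executed. -/
@[ext] structure Config : Type where
  todo : List Prog
  reg : ℕ → ℕ
  mem : ℕ → ℕ

/-- One step of the machine; halted configurations stay as they are. -/
def Config.step : Config → PMF Config
  | ⟨[], r, M⟩ => PMF.pure ⟨[], r, M⟩
  | ⟨.skip :: K, r, M⟩ => PMF.pure ⟨K, r, M⟩
  | ⟨.const x k :: K, r, M⟩ => PMF.pure ⟨K, Function.update r x k, M⟩
  | ⟨.add x y z :: K, r, M⟩ => PMF.pure ⟨K, Function.update r x (r y + r z), M⟩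
  | ⟨.sub x y z :: K, r, M⟩ => PMF.pure ⟨K, Function.update r x (r y - r z), M⟩
  | ⟨.load x y :: K, r, M⟩ => PMF.pure ⟨K, Function.update r x (M (r y)), M⟩
  | ⟨.store x y :: K, r, M⟩ => PMF.pure ⟨K, r, Function.update M (r x) (r y)⟩
  | ⟨.rand x y :: K, r, M⟩ =>
      (PMF.uniformOfFintype (Fin (r y + 1))).map fun k => ⟨K, Function.update r x k, M⟩
  | ⟨.seq p q :: K, r, M⟩ => PMF.pure ⟨p :: q :: K, r, M⟩
  | ⟨.ite x p q :: K, r, M⟩ => PMF.pure ⟨(if r x ≠ 0 then p else q) :: K, r, M⟩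
  | ⟨.loop x p :: K, r, M⟩ => PMF.pure ⟨if r x ≠ 0 then p :: .loop x p :: K else K, r, M⟩

/-- The law of the configuration after `t` steps. -/
def Config.run : ℕ → Config → PMF Config
  | 0, c => PMF.pure c
  | t + 1, c => c.step.bind (Config.run t)

/-- Whatever the random choices, the machine started in `c` halts after at most `t` steps. -/
def Config.HaltsWithin (t : ℕ) (c : Config) : Prop :=
  ∀ c' ∈ (c.run t).support, c'.todo = []

/-- The initial configuration of the program `p`: the numbers `a`, `b` are in the registers 0, 1,
all other registers are 0, and the memory content is `M`. -/
def Prog.start (p : Prog) (a b : ℕ) (M : ℕ → ℕ) : Config where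
  todo := [p]
  reg := fun i => if i = 0 then a else if i = 1 then b else 0
  mem := M

/-- Entry `i` of the array that the machine returns; it begins at the memory address given by
register 0. -/
def Config.out (c : Config) (i : ℕ) : ℕ := c.mem (c.reg 0 + i)

/-! ### Non-adaptive algorithms with a query oracle -/

/-- A non-adaptive algorithm: all queries are chosen by a first program, which never sees an answer;
a second program receives the queries together with their answers and returns a labelling of the
items. -/
structure Algorithm : Type where
  sampler : Prog
  decoder : Prog

/-- The initial configuration of the sampler, which is told the number `n` of items and
the number `m` of queries that it may make. -/
def Algorithm.samplerStart (A : Algorithm) (n m : ℕ) : Config :=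
  A.sampler.start n m fun _ => 0

/-- Query number `i < m` chosen by the sampler that has halted in the configuration `c`. -/
def query (c : Config) (i : ℕ) : ℕ × ℕ := (c.out (2 * i), c.out (2 * i + 1))

/-- The set of the pairs that are queried. -/
def querySet (m : ℕ) (c : Config) : Finset (Sym2 ℕ) :=
  (Finset.range m).image fun i => Sym2.mk (query c i).1 (query c i).2

/-- The two-element subsets of the set `{0, …, n - 1}` of items. -/
def pairs (n : ℕ) : Finset (Sym2 ℕ) :=
  (Finset.range n).offDiag.image fun e => s(e.1, e.2)

/-- There are `n.choose 2` pairs of items. -/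
theorem card_pairs (n : ℕ) : (pairs n).card = n.choose 2 := by
  unfold pairs
  have h := Sym2.card_image_offDiag (Finset.range n)
  rwa [Finset.card_range] at h

theorem powersetCard_pairs_nonempty {n m : ℕ} (h : m ≤ n.choose 2) :
    (Finset.powersetCard m (pairs n)).Nonempty :=
  Finset.powersetCard_nonempty.2 (h.trans_eq (card_pairs n).symm)

/-- The answer of the oracle `τ` as a number: 1 for "same cluster" (the sign `1`), 0 for "different
clusters". (The value for a pair outside the range is irrelevant.) -/
def answer {n : ℕ} (τ : Sym2 (Fin n) → ℤˣ) (u v : ℕ) : ℕ :=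
  if h : u < n ∧ v < n then (if τ s(⟨u, h.1⟩, ⟨v, h.2⟩) = 1 then 1 else 0) else 0

/-- The initial configuration of the decoder: `n` and `m` are in the registers 0 and 1, the memory
cells `3 i`, `3 i + 1`, `3 i + 2` hold the two items of query number `i < m` and its answer. -/
def Algorithm.decoderStart (A : Algorithm) {n : ℕ} (m : ℕ) (q : ℕ → ℕ × ℕ)
    (τ : Sym2 (Fin n) → ℤˣ) : Config :=
  A.decoder.start n m fun a =>
    if a < 3 * m then
      if a % 3 = 0 then (q (a / 3)).1
      else if a % 3 = 1 then (q (a / 3)).2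
      else answer τ (q (a / 3)).1 (q (a / 3)).2
    else 0

/-- Whatever the random choices and the answers to the queries, each of the two programs of `A`
halts within `t` steps. -/
def Algorithm.RunsWithin (A : Algorithm) (n m t : ℕ) : Prop :=
  (A.samplerStart n m).HaltsWithin t ∧
    ∀ c ∈ ((A.samplerStart n m).run t).support, ∀ τ : Sym2 (Fin n) → ℤˣ,
      (A.decoderStart m (query c) τ).HaltsWithin t

/-- The law of the labelling of the `n` items that `A` returns if it makes `m` queries to the
oracle `τ` and each of its programs is run for `t` steps. -/
def Algorithm.output (A : Algorithm) {n : ℕ} (m t : ℕ) (τ : Sym2 (Fin n) → ℤˣ) :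
    PMF (Fin n → ℕ) :=
  ((A.samplerStart n m).run t).bind fun c =>
    ((A.decoderStart m (query c) τ).run t).map fun c' v => c'.out v

/-! ### The noisy query model -/

/-- The law on `{1, -1}` with mean `δ`. -/
def noiseLaw (δ : ℝ) : Measure ℤˣ :=
  ENNReal.ofReal ((1 + δ) / 2) • Measure.dirac 1 + ENNReal.ofReal ((1 - δ) / 2) • Measure.dirac (-1)

/-- The oracle's answers `σ(u) σ(v) η_{u,v}`. -/
def noisyOracle {n : ℕ} (σ : Fin n → ℤˣ) (η : Sym2 (Fin n) → ℤˣ) (e : Sym2 (Fin n)) : ℤˣ :=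
  (e.map σ).mul * η e

/-- The labelling `l` has the same classes as `σ`. -/
def Recovers {n : ℕ} (σ : Fin n → ℤˣ) (l : Fin n → ℕ) : Prop :=
  ∀ u v, l u = l v ↔ σ u = σ v

/-- The probability, over the independent noise and the random choices of `A`, that `A` with `m`
queries (and `t` steps for each of its programs) recovers the clustering given by `σ`. -/
def Algorithm.successProb (A : Algorithm) {n : ℕ} (m t : ℕ) (δ : ℝ) (σ : Fin n → ℤˣ) : ENNReal :=
  ∫⁻ η, (A.output m t (noisyOracle σ η)).toOuterMeasure {l | Recovers σ l}
    ∂(Measure.pi fun _ : Sym2 (Fin n) => noiseLaw δ)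

/-- `ε = 1 / √(log log n)`. -/
def eps (n : ℕ) : ℝ := 1 / √(Real.log (Real.log n))

/-- `max {log n / δ⁴, (1 / δ) ^ (4 + (2 + 2 ε) / ε)}`. -/
def degreeBound (δ : ℝ) (n : ℕ) : ℝ :=
  max (1 / δ ^ 4 * Real.log n) ((1 / δ) ^ (4 + (2 + 2 * eps n) / eps n))

/-- The number `⌈n Δ⌉` of queries, where `Δ = K max {log n / δ⁴, (1 / δ) ^ (4 + (2 + 2 ε) / ε)}`. -/
def budget (K δ : ℝ) (n : ℕ) : ℕ := ⌈n * (K * degreeBound δ n)⌉₊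

end NoisyClustering

end

open NoisyClustering

noncomputable section
namespace NoisyClustering

set_option linter.unusedSimpArgs false
set_option linter.unusedSectionVars false

/-! A uniformly random set of exactly `m` pairs has dependent edges, so the decoder first thins it:
with `N = n.choose 2` it draws a binomial number with `N` trials of success probability `p = m / (2
N)`, and keeps that many random queries, or all of them if the number exceeds `m`. On kept sets of
at most `m` pairs this law dominates the law in which every pair is kept independently with
probability `p` (`kept_lower_bound`), and the independent model keeps more than `m` pairs with
probability at most `exp (-m / 10)` (`prob_card_keptSet_le`). Hence success may be analysed with
independent entries (`successProb_ge`).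

The items are cut into disjoint layers: item `0`, then `B = (n - 1) / 5` items, then `l = ⌈log₂ n⌉`
layers of `b = B / l` items, then two layers of `B` items; for large `n` at least `B` items remain.
The value of an item is the sum of answer times value over the previous layer, that is, a signed
count of the paths from item `0` through the layers. Multiplying rows and columns by the true signs
(`walk_gauge`) reduces to entries that are `0` with probability `1 - p` and otherwise a sign of mean
`δ`. Every layer uses fresh entries, so its moments obey linear recursions (`moments_recursion`).
Let `α` be the second moment of the sum of a layer, `β` the mean of its size times its sum of
squares, both divided by the squared mean of the sum, and `Γ = 1 / (p δ²) - 1`. The first large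
layer keeps `α` near `1` although there is a single source; each small layer contracts `β` by a
factor `4` up to a constant, since `Γ ≤ b / 4`, so logarithmically many suffice; the large layers at
the end make `β - α` small (`recursion_bound`). By Chebyshev's inequality, except with probability
`O(1 / log n)`, at least three quarters of the last layer have the right sign (`prob_badLayer_le`).

Votes amplify this. Each remaining item takes a majority over the last layer, through entries
independent of it, and errs with probability at most `1 / n ^ 2`. Once all remaining items are
labelled correctly, they vote on the items of the layers; the weights of this second vote are then
known, so it needs only a union bound over row sums and no further independence (`vote_correct`,
`prob_decode_le`).

Recovery uses only the term `log n / δ⁴` of the maximum. The other term matters for admissibility at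
a fixed bias, where it is `n ^ o(1)`. -/

/-! ### A program logic for the machine -/

/-- The registers and the memory of a configuration. -/
structure State : Type where
  reg : ℕ → ℕ
  mem : ℕ → ℕ

/-- The configuration with the state `s` in which the programs `K` are still to be executed. -/
def State.conf (s : State) (K : List Prog) : Config := ⟨K, s.reg, s.mem⟩

/-- The state after the assignment of `k` to register `x`. -/
def State.set (s : State) (x k : ℕ) : State := ⟨Function.update s.reg x k, s.mem⟩

/-- The state after the assignment of `k` to the memory cell `a`. -/
def State.put (s : State) (a k : ℕ) : State := ⟨s.reg, Function.update s.mem a k⟩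

@[simp] theorem State.set_mem (s : State) (x k : ℕ) : (s.set x k).mem = s.mem := rfl

@[simp] theorem State.put_reg (s : State) (x k : ℕ) : (s.put x k).reg = s.reg := rfl

theorem State.set_reg (s : State) (x k i : ℕ) :
    (s.set x k).reg i = if i = x then k else s.reg i := by
  simp [State.set, Function.update_apply]

/-- Started in `s`, the program `p` halts within `t` steps, and its final state is described, up to
the relation `R`, by a random element with law `μ`. Formulated for an arbitrary continuation. -/
def Sim {α : Type} (p : Prog) (s : State) (t : ℕ) (μ : PMF α) (R : α → State → Prop) : Prop :=
  ∀ (β : Type) (g : Config → β) (K : List Prog) (κ : α → PMF β) (t' T : ℕ),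
    (∀ a ∈ μ.support, ∀ s', R a s' → ∀ T' ≥ t', ((s'.conf K).run T').map g = κ a) →
    t + t' ≤ T → ((s.conf (p :: K)).run T).map g = μ.bind κ

/-- `Sim` for programs whose random choices do not matter. -/
abbrev Det (p : Prog) (s : State) (t : ℕ) (Q : State → Prop) : Prop :=
  Sim p s t (PMF.pure ()) fun _ => Q

theorem PMF.bind_congr_support {α β : Type} (μ : PMF α) (f g : α → PMF β)
    (h : ∀ a ∈ μ.support, f a = g a) : μ.bind f = μ.bind g := by
  ext b
  simp only [PMF.bind_apply]
  refine tsum_congr fun a => ?_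
  by_cases ha : a ∈ μ.support
  · rw [h a ha]
  · rw [(PMF.apply_eq_zero_iff _ _).2 ha, zero_mul, zero_mul]

section rules

variable {α γ : Type} {p q : Prog} {s : State} {t t₁ t₂ : ℕ} {μ : PMF α} {R R' : α → State → Prop}

theorem run_succ (c : Config) (T : ℕ) : c.run (T + 1) = c.step.bind (Config.run T) := rfl

theorem run_nil (s : State) (T : ℕ) : (s.conf []).run T = PMF.pure (s.conf []) := by
  induction T with
  | zero => rfl
  | succ T ih => rw [run_succ]; simp only [State.conf, Config.step, PMF.pure_bind]; exact ih

theorem Sim.mono (h : Sim p s t₁ μ R) (ht : t₁ ≤ t₂) (hR : ∀ a ∈ μ.support, ∀ s', R a s' →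
    R' a s') :
    Sim p s t₂ μ R' := fun β g K κ t' T hK hT =>
  h β g K κ t' T (fun a ha s' hs => hK a ha s' (hR a ha s' hs)) (by omega)

theorem Sim.mono_time (h : Sim p s t₁ μ R) (ht : t₁ ≤ t₂) : Sim p s t₂ μ R :=
  h.mono ht fun _ _ _ h => h

theorem Sim.post (h : Sim p s t μ R) (hR : ∀ a ∈ μ.support, ∀ s', R a s' → R' a s') :
    Sim p s t μ R' := h.mono le_rfl hR

theorem Sim.map {R' : γ → State → Prop} (h : Sim p s t μ R) (f : α → γ)
    (hR : ∀ a ∈ μ.support, ∀ s', R a s' → R' (f a) s') : Sim p s t (μ.map f) R' := by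
  intro β g K κ t' T hK hT
  rw [PMF.bind_map]
  refine h β g K _ t' T (fun a ha s' hs => ?_) hT
  exact hK (f a) ((PMF.mem_support_map_iff _ _ _).2 ⟨a, ha, rfl⟩) s' (hR a ha s' hs)

theorem Det.sim {Q : State → Prop} (h : Det p s t Q) (a : α) (hR : ∀ s', Q s' → R a s') :
    Sim p s t (PMF.pure a) R := by
  have := Sim.map (R' := R) h (fun _ => a) (fun _ _ s' hs => hR s' hs)
  rwa [PMF.pure_map] at this

theorem sim_of_step (μ : PMF γ) (f : γ → State)
    (h : ∀ K, (s.conf (p :: K)).step = μ.map fun a => (f a).conf K) :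
    Sim p s 1 μ fun a s' => s' = f a := by
  intro β g K κ t' T hK hT
  obtain ⟨T, rfl⟩ : ∃ T', T = T' + 1 := ⟨T - 1, by omega⟩
  rw [run_succ, h, PMF.bind_map, PMF.map_bind]
  exact PMF.bind_congr_support _ _ _ fun a ha => hK a ha _ rfl T (by omega)

theorem Sim.of_step {p' : List Prog} (h : ∀ K, (s.conf (p :: K)).step = PMF.pure (s.conf (p' ++ K)))
    (h' : ∀ (β : Type) (g : Config → β) (K : List Prog) (κ : α → PMF β) (t' T : ℕ),
      (∀ a ∈ μ.support, ∀ s', R a s' → ∀ T' ≥ t', ((s'.conf K).run T').map g = κ a) →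
      t + t' ≤ T → ((s.conf (p' ++ K)).run T).map g = μ.bind κ) : Sim p s (t + 1) μ R := by
  intro β g K κ t' T hK hT
  obtain ⟨T, rfl⟩ : ∃ T', T = T' + 1 := ⟨T - 1, by omega⟩
  rw [run_succ, h, PMF.pure_bind]
  exact h' β g K κ t' T hK (by omega)

/-- Because `Sim` quantifies over the continuation, `p` is run with `q :: K` as its continuation.
The exact time at which `q` starts, which may depend on the random choices, never has to be
mentioned. -/
theorem Sim.seq {ν : α → PMF γ} {R' : γ → State → Prop} (hp : Sim p s t₁ μ R)
    (hq : ∀ a ∈ μ.support, ∀ s', R a s' → Sim q s' t₂ (ν a) R') :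
    Sim (.seq p q) s (t₁ + t₂ + 1) (μ.bind ν) R' := by
  refine Sim.of_step (p' := [p, q]) (fun K => rfl) ?_
  intro β g K κ t' T hK hT
  rw [PMF.bind_bind]
  refine hp β g (q :: K) _ (t₂ + t') T (fun a ha s' hs T' hT' => ?_) (by omega)
  refine hq a ha s' hs β g K κ t' T' (fun b hb => hK b ?_) (by omega)
  exact (PMF.mem_support_bind_iff _ _ _).2 ⟨a, ha, hb⟩

theorem Sim.seq_det {Q : State → Prop} (hp : Det p s t₁ Q) (hq : ∀ s', Q s' → Sim q s' t₂ μ R) :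
    Sim (.seq p q) s (t₁ + t₂ + 1) μ R := by
  have := Sim.seq (ν := fun _ => μ) hp (fun _ _ s' hs => hq s' hs)
  rwa [PMF.pure_bind] at this

theorem Sim.ite {x : ℕ} (hp : s.reg x ≠ 0 → Sim p s t μ R) (hq : s.reg x = 0 → Sim q s t μ R) :
    Sim (.ite x p q) s (t + 1) μ R := by
  by_cases hx : s.reg x = 0
  · refine Sim.of_step (p' := [q]) (fun K => ?_) (hq hx)
    simp [State.conf, Config.step, hx]
  · refine Sim.of_step (p' := [p]) (fun K => ?_) (hp hx)
    simp [State.conf, Config.step, hx]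

theorem Sim.rand (x y : ℕ) : Sim (.rand x y) s 1 (PMF.uniformOfFintype (Fin (s.reg y + 1)))
    fun k s' => s' = s.set x k :=
  sim_of_step _ _ fun K => by
    simp only [State.conf, Config.step, State.set]
    change PMF.map _ (PMF.bind _ fun a : Fin (s.reg y + 1) => PMF.pure (a : ℕ)) = _
    rw [PMF.map_bind]
    simp only [PMF.pure_map]
    rfl

/-- The law of a process that is run for `i` steps. -/
def iter (κ : ℕ → α → PMF α) : ℕ → α → PMF α
  | 0, a => PMF.pure a
  | i + 1, a => (κ i a).bind (iter κ i)

/-- The loop register itself is the induction variable and counts down; `R i` is the invariant with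
`i` passes left. Each pass pays one step for its test, and the last test costs the extra `1`. -/
theorem Sim.loop {x : ℕ} (R : ℕ → α → State → Prop) (κ : ℕ → α → PMF α)
    (hx : ∀ i a s, R i a s → s.reg x = i)
    (hb : ∀ i a s, R (i + 1) a s → Sim p s t (κ i a) (R i)) (i : ℕ) (a : α) (s : State)
    (hs : R i a s) : Sim (.loop x p) s (i * (t + 1) + 1) (iter κ i a) (R 0) := by
  induction i generalizing a s with
  | zero =>
    refine Sim.of_step (p' := []) (fun K => ?_) ?_
    · simp [State.conf, Config.step, hx _ _ _ hs]
    · intro β g K κ t' T hK hT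
      rw [iter, PMF.pure_bind]
      exact hK a (by simp [iter]) s hs T (by omega)
  | succ i ih =>
    refine Sim.of_step (p' := [p, .loop x p]) (fun K => ?_) ?_
    · simp [State.conf, Config.step, hx _ _ _ hs]
    · intro β g K κ' t' T hK hT
      rw [iter, PMF.bind_bind]
      have e : (i + 1) * (t + 1) = i * (t + 1) + t + 1 := by ring
      refine hb i a s hs β g (.loop x p :: K) _ (i * (t + 1) + 1 + t') T
        (fun b hb s' hs' T' hT' => ?_) (by omega)
      refine ih b s' hs' β g K κ' t' T' (fun c hc => hK c ?_) (by omega)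
      rw [iter]
      exact (PMF.mem_support_bind_iff _ _ _).2 ⟨b, hb, hc⟩

theorem Det.loop {x : ℕ} (R : ℕ → State → Prop) (hx : ∀ i s, R i s → s.reg x = i)
    (hb : ∀ i s, R (i + 1) s → Det p s t (R i)) (i : ℕ) (s : State) (hs : R i s) :
    Det (.loop x p) s (i * (t + 1) + 1) (R 0) := by
  have h := Sim.loop (p := p) (t := t) (α := Unit) (x := x) (fun i _ => R i) (fun _ _ => PMF.pure ())
    (fun i _ s hs => hx i s hs) (fun i _ s hs => hb i s hs) i () s hs
  have e : ∀ i, iter (fun _ (_ : Unit) => PMF.pure ()) i () = PMF.pure () := by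
    intro i
    induction i with
    | zero => rfl
    | succ i ih => rw [iter, PMF.pure_bind, ih]
  rwa [e] at h

end rules

/-! ### Symbolic execution of loop-free programs -/

/-- The effect of a program without loops and random choices. -/
def Prog.eval : Prog → State → State
  | .const x k, s => s.set x k
  | .add x y z, s => s.set x (s.reg y + s.reg z)
  | .sub x y z, s => s.set x (s.reg y - s.reg z)
  | .load x y, s => s.set x (s.mem (s.reg y))
  | .store x y, s => s.put (s.reg x) (s.reg y)
  | .seq p q, s => q.eval (p.eval s)
  | .ite x p q, s => if s.reg x ≠ 0 then p.eval s else q.eval s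
  | _, s => s

/-- The program has no loops and makes no random choices. -/
def Prog.Straight : Prog → Prop
  | .seq p q => p.Straight ∧ q.Straight
  | .ite _ p q => p.Straight ∧ q.Straight
  | .rand _ _ => False
  | .loop _ _ => False
  | _ => True

/-- An upper bound for the running time of a program without loops. -/
def Prog.cost : Prog → ℕ
  | .seq p q => p.cost + q.cost + 1
  | .ite _ p q => max p.cost q.cost + 1
  | _ => 1

theorem Prog.Straight.det {p : Prog} (hp : p.Straight) (s : State) :
    Det p s p.cost fun s' => s' = p.eval s := by
  induction p generalizing s with
  | rand => exact hp.elim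
  | loop => exact hp.elim
  | seq p q ihp ihq =>
    exact Sim.seq_det (ihp hp.1 s) fun s' hs => by subst hs; exact ihq hp.2 _
  | ite x p q ihp ihq =>
    refine Sim.ite (fun hx => ?_) (fun hx => ?_)
    · refine (ihp hp.1 s).mono (le_max_left _ _) fun _ _ s' hs => ?_
      simp [Prog.eval, hx, hs]
    · refine (ihq hp.2 s).mono (le_max_right _ _) fun _ _ s' hs => ?_
      simp [Prog.eval, hx, hs]
  | _ =>
    refine (sim_of_step (PMF.pure ()) (fun _ => _) fun K => ?_)
    rw [PMF.pure_map]; rfl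

theorem Det.straight {p : Prog} {s : State} {t : ℕ} {Q : State → Prop} (hp : p.Straight)
    (ht : p.cost ≤ t) (h : Q (p.eval s)) : Det p s t Q :=
  (hp.det s).mono ht fun _ _ s' hs => by subst hs; exact h

/-! ### From the program logic to laws of runs -/

/-- What `Sim` says about a program that is started with the input `a`, `b`, `M`. -/
theorem Sim.run_start {α β : Type} {p : Prog} {a b t T : ℕ} {M : ℕ → ℕ} {μ : PMF α}
    {R : α → State → Prop} (h : Sim p ⟨(p.start a b M).reg, M⟩ t μ R) (hT : t ≤ T)
    (g : Config → β) (f : α → β) (hg : ∀ a ∈ μ.support, ∀ s', R a s' → g (s'.conf []) = f a) :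
    ((p.start a b M).run T).map g = μ.map f := by
  have := h β g [] (fun a => PMF.pure (f a)) 0 T (fun a ha s' hs T' _ => by
    rw [run_nil, PMF.pure_map, hg a ha s' hs]) (by omega)
  exact this

/-- Taking the desired property itself as the observable `g`, its law is the point mass at `True`,
so every configuration in the support has the property. -/
theorem Sim.of_mem_support {α : Type} {p : Prog} {a b t T : ℕ} {M : ℕ → ℕ} {μ : PMF α}
    {R : α → State → Prop} (h : Sim p ⟨(p.start a b M).reg, M⟩ t μ R) (hT : t ≤ T)
    {c : Config} (hc : c ∈ ((p.start a b M).run T).support) :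
    ∃ a ∈ μ.support, ∃ s', R a s' ∧ c = s'.conf [] := by
  have := h.run_start hT (fun c => ∃ a ∈ μ.support, ∃ s', R a s' ∧ c = s'.conf []) (fun _ => True)
    (fun a ha s' hs => eq_true ⟨a, ha, s', hs, rfl⟩)
  have h2 : (∃ a ∈ μ.support, ∃ s', R a s' ∧ c = s'.conf []) ∈
      (((p.start a b M).run T).map
        (fun c => ∃ a ∈ μ.support, ∃ s', R a s' ∧ c = s'.conf [])).support :=
    (PMF.mem_support_map_iff _ _ _).2 ⟨c, hc, rfl⟩
  rw [this, PMF.mem_support_map_iff] at h2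
  obtain ⟨_, _, h3⟩ := h2
  exact h3 ▸ trivial

theorem Sim.haltsWithin {α : Type} {p : Prog} {a b t T : ℕ} {M : ℕ → ℕ} {μ : PMF α}
    {R : α → State → Prop} (h : Sim p ⟨(p.start a b M).reg, M⟩ t μ R) (hT : t ≤ T) :
    (p.start a b M).HaltsWithin T := fun c hc => by
  obtain ⟨_, _, s', _, rfl⟩ := h.of_mem_support hT hc
  rfl

/-! ### Selection sampling and thinning -/

/-- A step of selection sampling from `{0, …, N - 1}`: the element `N - (i + 1)` is added to a sample
`S`, which is to have `k` elements, with probability `(k - #S) / (i + 1)`. -/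
def pickStep (N k i : ℕ) (S : Finset ℕ) : PMF (Finset ℕ) :=
  (PMF.uniformOfFintype (Fin (i + 1))).map fun j : Fin (_ + 1) =>
    if (j : ℕ) < k - S.card then insert (N - (i + 1)) S else S

/-- The machine realizes a rational probability `r / (i + 1)` by comparing a uniform number with a
threshold; the resulting law is a mixture of two. -/
theorem uniform_threshold_bind {α : Type} {r i : ℕ} (h : r ≤ i + 1) (μ ν : PMF α) (a : α) :
    ((PMF.uniformOfFintype (Fin (i + 1))).bind fun j => if (j : ℕ) < r then μ else ν) a =
      ((i + 1 : ℕ) : ENNReal)⁻¹ * (r * μ a + (i + 1 - r : ℕ) * ν a) := by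
  rw [PMF.bind_apply, tsum_fintype]
  simp only [PMF.uniformOfFintype_apply, Fintype.card_fin, ← Finset.mul_sum]
  congr 1
  have : ∀ j : Fin (i + 1), (if (j : ℕ) < r then μ else ν) a = if (j : ℕ) < r then μ a else ν a :=
    fun j => by split <;> rfl
  simp only [this]
  rw [Fin.sum_univ_eq_sum_range (fun j => if j < r then μ a else ν a), Finset.sum_ite,
    Finset.sum_const, Finset.sum_const, nsmul_eq_mul, nsmul_eq_mul]
  have h1 : (Finset.range (i + 1)).filter (· < r) = Finset.range r := by
    ext; simp; omega
  have h2 : (Finset.range (i + 1)).filter (¬ · < r) = Finset.Ico r (i + 1) := by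
    ext; simp; omega
  rw [h1, h2, Finset.card_range, Nat.card_Ico]

theorem ENNReal_inv_mul_mul_inv {a b c d : ℕ} (hb : b ≠ 0) (hc : c ≠ 0) (hd : d ≠ 0)
    (h : b * c = d * a) : ((b : ENNReal))⁻¹ * (a * (c : ENNReal)⁻¹) = (d : ENNReal)⁻¹ := by
  have e : ((b : ENNReal) * c) = d * a := by exact_mod_cast h
  have hb' : (b : ENNReal) ≠ 0 := by exact_mod_cast hb
  have hc' : (c : ENNReal) ≠ 0 := by exact_mod_cast hc
  have hd' : (d : ENNReal) ≠ 0 := by exact_mod_cast hd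
  have ha' : (a : ENNReal) ≠ 0 := by
    rintro h0
    rw [h0, mul_zero] at e
    exact mul_ne_zero hb' hc' e
  have hT : ∀ k : ℕ, (k : ENNReal) ≠ ⊤ := ENNReal.natCast_ne_top
  calc ((b : ENNReal))⁻¹ * (a * (c : ENNReal)⁻¹) = a * ((b : ENNReal) * c)⁻¹ := by
        rw [ENNReal.mul_inv (Or.inl hb') (Or.inl (hT b))]; ring
    _ = a * ((d : ENNReal)⁻¹ * (a : ENNReal)⁻¹) := by
        rw [e, ENNReal.mul_inv (Or.inl hd') (Or.inl (hT d))]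
    _ = (d : ENNReal)⁻¹ * (a * (a : ENNReal)⁻¹) := by ring
    _ = _ := by rw [ENNReal.mul_inv_cancel ha' (hT a), mul_one]

/-- Generalized to a partial sample `S` of the elements already decided: all completions to `k`
elements are equally likely. The induction step is the identity `(i + 1) * i.choose r = (i +
1).choose (r + 1) * (r + 1)` if the next element belongs to `T`, and its counterpart for `i + 1 - r`
if it does not. -/
theorem iter_pickStep_apply (N k i : ℕ) (hi : i ≤ N) (S : Finset ℕ) (hS : S ⊆ Finset.range (N - i))
    (hk : S.card ≤ k) (hki : k - S.card ≤ i) (T : Finset ℕ) :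
    iter (pickStep N k) i S T =
      if T ⊆ Finset.range N ∧ T ∩ Finset.range (N - i) = S ∧ T.card = k then
        ((i.choose (k - S.card) : ℕ) : ENNReal)⁻¹ else 0 := by
  induction i generalizing S with
  | zero =>
    rw [iter, PMF.pure_apply]
    have : (T = S) ↔ (T ⊆ Finset.range N ∧ T ∩ Finset.range (N - 0) = S ∧ T.card = k) := by
      constructor
      · rintro rfl
        exact ⟨by simpa using hS, Finset.inter_eq_left.2 hS, by omega⟩
      · rintro ⟨h1, h2, -⟩
        rw [← h2, Nat.sub_zero]
        exact (Finset.inter_eq_left.2 h1).symm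
    simp only [this]
    have h0 : k - S.card = 0 := by omega
    simp [h0]
  | succ i ih =>
    set a := N - (i + 1) with ha
    have haS : a ∉ S := fun h => by simpa using hS h
    have hSi : S ⊆ Finset.range (N - i) := hS.trans (Finset.range_subset_range.2 (by omega))
    have hSa : insert a S ⊆ Finset.range (N - i) :=
      Finset.insert_subset (Finset.mem_range.2 (by omega)) hSi
    have hcard := Finset.card_insert_of_notMem haS
    have hrange : Finset.range (N - i) = insert a (Finset.range a) := by
      rw [← Finset.range_add_one]; congr 1; omega
    have e : iter (pickStep N k) (i + 1) S = (PMF.uniformOfFintype (Fin (i + 1))).bind fun j =>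
        if (j : ℕ) < k - S.card then iter (pickStep N k) i (insert a S)
          else iter (pickStep N k) i S := by
      rw [iter, pickStep, PMF.bind_map]
      congr 1
      funext j
      simp only [Function.comp]
      split <;> rfl
    rw [e, uniform_threshold_bind hki]
    by_cases haT : a ∈ T
    -- A sample without `a` can no longer become `T`; if all remaining elements are needed, this
    -- branch has weight `0` anyway.
    · have h2 : ((i + 1 - (k - S.card) : ℕ) : ENNReal) * iter (pickStep N k) i S T = 0 := by
        by_cases hr : k - S.card ≤ i
        · rw [ih (by omega) S hSi hk hr, if_neg, mul_zero]
          rintro ⟨-, h, -⟩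
          exact haS (h ▸ Finset.mem_inter.2 ⟨haT, Finset.mem_range.2 (by omega)⟩)
        · rw [show i + 1 - (k - S.card) = 0 by omega, Nat.cast_zero, zero_mul]
      rw [h2, add_zero]
      by_cases hr : S.card = k
      · rw [hr, Nat.sub_self, Nat.cast_zero, zero_mul, mul_zero, if_neg]
        rintro ⟨-, h, hT⟩
        have : S ⊂ T := by
          refine ⟨h ▸ Finset.inter_subset_left, fun h' => haS (h' haT)⟩
        have := Finset.card_lt_card this
        omega
      rw [ih (by omega) _ hSa (by omega) (by omega)]
      have hiff : T ∩ Finset.range (N - i) = insert a S ↔ T ∩ Finset.range a = S := by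
        rw [hrange, Finset.inter_insert_of_mem haT]
        constructor
        · intro h
          have := congrArg (fun X => X.erase a) h
          simpa [Finset.erase_insert haS, Finset.erase_insert] using this
        · rintro rfl; rfl
      simp only [hiff]
      split_ifs with hc
      · obtain ⟨r, hr⟩ : ∃ r, k - S.card = r + 1 := ⟨k - S.card - 1, by omega⟩
        rw [show k - (insert a S).card = r by omega, hr]
        refine ENNReal_inv_mul_mul_inv (by omega) (Nat.choose_pos (by omega)).ne'
          (Nat.choose_pos (by omega)).ne' ?_
        exact Nat.add_one_mul_choose_eq i r
      · simp
    · have h1 : ((k - S.card : ℕ) : ENNReal) * iter (pickStep N k) i (insert a S) T = 0 := by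
        by_cases hr : S.card = k
        · rw [hr, Nat.sub_self, Nat.cast_zero, zero_mul]
        rw [ih (by omega) _ hSa (by omega) (by omega), if_neg, mul_zero]
        rintro ⟨-, h, -⟩
        exact haT (Finset.inter_subset_left (h ▸ Finset.mem_insert_self a S))
      rw [h1, zero_add]
      have hinter : T ∩ Finset.range (N - i) = T ∩ Finset.range a := by
        rw [hrange, Finset.inter_insert_of_notMem haT]
      by_cases hr : k - S.card ≤ i
      · rw [ih (by omega) S hSi hk hr, hinter]
        split_ifs with hc
        · refine ENNReal_inv_mul_mul_inv (by omega) (Nat.choose_pos hr).ne'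
            (Nat.choose_pos hki).ne' ?_
          rw [mul_comm, Nat.choose_mul_succ_eq i (k - S.card)]
        · simp
      · rw [show i + 1 - (k - S.card) = 0 by omega, Nat.cast_zero, zero_mul, mul_zero, if_neg]
        rintro ⟨h3, h, hT⟩
        -- Here all `i + 1` remaining elements are needed, so a set that omits `a` is too small.
        have hsub : T ⊆ S ∪ Finset.Ico (N - i) N := by
          intro x hx
          have := Finset.mem_range.1 (h3 hx)
          by_cases hxa : x < a
          · exact Finset.mem_union_left _ (h ▸ Finset.mem_inter.2 ⟨hx, Finset.mem_range.2 hxa⟩)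
          · refine Finset.mem_union_right _ (Finset.mem_Ico.2 ⟨?_, this⟩)
            have : x ≠ a := fun h => haT (h ▸ hx)
            omega
        have := (Finset.card_le_card hsub).trans (Finset.card_union_le _ _)
        rw [Nat.card_Ico] at this
        omega

theorem iter_pickStep {N k : ℕ} (hk : k ≤ N) :
    iter (pickStep N k) N ∅ = PMF.uniformOfFinset ((Finset.range N).powersetCard k)
      (Finset.powersetCard_nonempty.2 (by simpa using hk)) := by
  ext T
  rw [iter_pickStep_apply N k N le_rfl ∅ (by simp) (by simp) (by simpa using hk),
    PMF.uniformOfFinset_apply, Finset.card_powersetCard, Finset.card_range, Finset.card_empty,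
    Nat.sub_zero]
  simp [Finset.mem_powersetCard]

/-! ### Images and random subsets of uniformly random sets -/

theorem uniformOfFinset_map {α β : Type} [DecidableEq β] {s : Finset α} (hs : s.Nonempty) (f : α →
    β)
    (hf : Set.InjOn f s) (t : Finset β) (ht : t.Nonempty) (hst : s.image f = t) :
    (PMF.uniformOfFinset s hs).map f = PMF.uniformOfFinset t ht := by
  subst hst
  ext b
  rw [PMF.map_apply, PMF.uniformOfFinset_apply, Finset.card_image_of_injOn hf]
  by_cases hb : b ∈ s.image f
  · obtain ⟨a, ha, rfl⟩ := Finset.mem_image.1 hb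
    rw [if_pos hb, tsum_eq_single a, if_pos rfl, PMF.uniformOfFinset_apply_of_mem _ ha]
    intro a' ha'
    by_cases has : a' ∈ s
    · rw [if_neg fun h => ha' (hf has ha h.symm)]
    · rw [PMF.uniformOfFinset_apply_of_notMem _ has, ite_self]
  · rw [if_neg hb, ENNReal.tsum_eq_zero]
    intro a
    by_cases has : a ∈ s
    · rw [if_neg]; rintro rfl; exact hb (Finset.mem_image_of_mem f has)
    · rw [PMF.uniformOfFinset_apply_of_notMem _ has, ite_self]

theorem image_powersetCard_image {α β : Type} [DecidableEq β] (k : ℕ) (s : Finset α) (f : α → β)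
    (hf : Set.InjOn f s) :
    (s.powersetCard k).image (Finset.image f) = (s.image f).powersetCard k := by
  ext t
  simp only [Finset.mem_image, Finset.mem_powersetCard]
  constructor
  · rintro ⟨u, ⟨hu, rfl⟩, rfl⟩
    exact ⟨Finset.image_subset_image hu, Finset.card_image_of_injOn (hf.mono hu)⟩
  · rintro ⟨ht, rfl⟩
    obtain ⟨u, hu, rfl⟩ := Finset.subset_image_iff.1 ht
    exact ⟨u, ⟨hu, (Finset.card_image_of_injOn (hf.mono hu)).symm⟩, rfl⟩

theorem image_injOn_powersetCard {α β : Type} [DecidableEq β] (k : ℕ) (s : Finset α) (f : α → β)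
    (hf : Set.InjOn f s) : Set.InjOn (Finset.image f) (s.powersetCard k : Set (Finset α)) := by
  intro a ha b hb h
  have ha := (Finset.mem_powersetCard.1 ha).1
  have hb := (Finset.mem_powersetCard.1 hb).1
  have h' : f '' (a : Set α) = f '' (b : Set α) := by
    rw [← Finset.coe_image, ← Finset.coe_image, h]
  exact_mod_cast (hf.image_eq_image_iff (by exact_mod_cast ha) (by exact_mod_cast hb)).1 h'

/-- A uniformly random `k`-subset of a uniformly random `m`-subset is a uniformly random
`k`-subset. -/
theorem uniform_powersetCard_bind {α : Type} [DecidableEq α] (E : Finset α) {m k : ℕ} (hm : m ≤ E.card)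
    (hk : k ≤ m) (κ : Finset α → PMF (Finset α))
    (hκ : ∀ Q ∈ E.powersetCard m, ∀ h, κ Q = PMF.uniformOfFinset (Q.powersetCard k) h)
    {G : Finset α} (hG : G ∈ E.powersetCard k) :
    ((PMF.uniformOfFinset (E.powersetCard m) (Finset.powersetCard_nonempty.2 hm)).bind κ) G =
      ((E.card.choose k : ℕ) : ENNReal)⁻¹ := by
  obtain ⟨hGE, hGk⟩ := Finset.mem_powersetCard.1 hG
  have hκ' : ∀ Q ∈ E.powersetCard m,
      κ Q G = if G ⊆ Q then ((m.choose k : ℕ) : ENNReal)⁻¹ else 0 := by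
    intro Q hQ
    have hQ' := Finset.mem_powersetCard.1 hQ
    rw [hκ Q hQ (Finset.powersetCard_nonempty.2 (by omega)), PMF.uniformOfFinset_apply,
      Finset.card_powersetCard, hQ'.2]
    simp [Finset.mem_powersetCard, hGk]
  rw [PMF.bind_apply, tsum_eq_sum (s := E.powersetCard m)]
  swap
  · intro Q hQ
    rw [PMF.uniformOfFinset_apply_of_notMem _ hQ, zero_mul]
  rw [Finset.sum_congr rfl fun Q hQ => by
    rw [PMF.uniformOfFinset_apply_of_mem _ hQ, hκ' Q hQ, Finset.card_powersetCard]]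
  rw [← Finset.mul_sum, ← Finset.sum_filter, Finset.sum_const, nsmul_eq_mul]
  -- An `m`-set that contains `G` is `G` together with `m - k` elements of the complement. With this
  -- count, `Nat.choose_mul` makes the three binomial coefficients cancel.
  have hcard : ((E.powersetCard m).filter (G ⊆ ·)).card = (E.card - k).choose (m - k) := by
    rw [← hGk, ← Finset.card_sdiff_of_subset hGE, ← Finset.card_powersetCard]
    refine Finset.card_nbij' (· \ G) (· ∪ G) ?_ ?_ ?_ ?_
    · intro Q hQ
      simp only [Finset.coe_filter, Finset.mem_powersetCard, Set.mem_ofPred_eq] at hQ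
      simp only [Finset.mem_coe,
        Finset.mem_powersetCard]
      exact ⟨Finset.sdiff_subset_sdiff hQ.1.1 le_rfl, by
        rw [Finset.card_sdiff_of_subset hQ.2, hQ.1.2]⟩
    · intro Q hQ
      simp only [Finset.mem_coe, Finset.mem_powersetCard] at hQ
      simp only [Finset.coe_filter, Finset.mem_powersetCard, Set.mem_ofPred_eq]
      have hd : Disjoint Q G := Finset.disjoint_left.2 fun x hx =>
        (Finset.mem_sdiff.1 (hQ.1 hx)).2
      refine ⟨⟨Finset.union_subset (hQ.1.trans Finset.sdiff_subset) hGE, ?_⟩,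
        Finset.subset_union_right⟩
      rw [Finset.card_union_of_disjoint hd, hQ.2]; omega
    · intro Q hQ
      simp only [Finset.coe_filter, Set.mem_ofPred_eq] at hQ
      exact Finset.sdiff_union_of_subset hQ.2
    · intro Q hQ
      simp only [Finset.mem_coe, Finset.mem_powersetCard] at hQ
      have hd : Disjoint Q G := Finset.disjoint_left.2 fun x hx =>
        (Finset.mem_sdiff.1 (hQ.1 hx)).2
      exact Finset.union_sdiff_cancel_right hd
  rw [hcard]
  have hc := Nat.choose_mul (n := E.card) (k := m) (s := k) hk
  exact ENNReal_inv_mul_mul_inv (Nat.choose_pos hm).ne' (Nat.choose_pos hk).ne'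
    (Nat.choose_pos (hk.trans hm)).ne' hc

/-! ### A binomial counter -/

/-- A step of a counter that is increased with probability `m / (d + 1)`. -/
def countStep (d m : ℕ) (_ c : ℕ) : PMF ℕ :=
  (PMF.uniformOfFintype (Fin (d + 1))).map fun j : Fin (_ + 1) => if (j : ℕ) < m then c + 1 else c

/-- The binomial law shifted by the initial value `c`; conditioning on the first trial changes `c`,
and the two cases combine by Pascal's rule. -/
theorem iter_countStep_apply {d m : ℕ} (hm : m ≤ d + 1) (i c k : ℕ) :
    iter (countStep d m) i c k = if c ≤ k then
      (i.choose (k - c) : ENNReal) * ((m : ENNReal) / (d + 1 : ℕ)) ^ (k - c) *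
        (((d + 1 - m : ℕ) : ENNReal) / (d + 1 : ℕ)) ^ (i - (k - c)) else 0 := by
  set p : ENNReal := (m : ENNReal) / (d + 1 : ℕ) with hp
  set q : ENNReal := ((d + 1 - m : ℕ) : ENNReal) / (d + 1 : ℕ) with hq
  induction i generalizing c with
  | zero =>
    rw [iter, PMF.pure_apply]
    by_cases hck : c ≤ k
    · rw [if_pos hck]
      by_cases h : k = c
      · subst h; simp
      · rw [if_neg h, Nat.choose_eq_zero_of_lt (by omega)]; simp
    · rw [if_neg hck, if_neg (by omega)]
  | succ i ih =>
    have e : iter (countStep d m) (i + 1) c = (PMF.uniformOfFintype (Fin (d + 1))).bind fun j =>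
        if (j : ℕ) < m then iter (countStep d m) i (c + 1) else iter (countStep d m) i c := by
      rw [iter, countStep, PMF.bind_map]
      congr 1
      funext j
      simp only [Function.comp]
      split <;> rfl
    rw [e, uniform_threshold_bind hm, mul_add, ← mul_assoc, ← mul_assoc,
      mul_comm _ (m : ENNReal), mul_comm _ ((d + 1 - m : ℕ) : ENNReal), ← div_eq_mul_inv,
      ← div_eq_mul_inv, ← hp, ← hq, ih, ih]
    by_cases hck : c ≤ k
    swap
    · rw [if_neg hck, if_neg (by omega), if_neg hck]; simp
    rw [if_pos hck, if_pos hck]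
    obtain ⟨r, rfl⟩ := Nat.exists_eq_add_of_le hck
    rcases r with _ | r
    · rw [if_neg (by omega)]
      simp [pow_succ, mul_comm]
    · rw [if_pos (by omega), show c + (r + 1) - (c + 1) = r by omega, Nat.add_sub_cancel_left,
        Nat.choose_succ_succ, Nat.add_sub_add_right]
      by_cases hri : r + 1 ≤ i
      · rw [show i - r = (i - (r + 1)) + 1 by omega]
        push_cast
        ring
      · rw [Nat.choose_eq_zero_of_lt (show i < r + 1 by omega)]
        push_cast
        ring

/-! ### The sampler -/

infixr:60 " ;; " => Prog.seq

theorem Sim.rand_seq {α : Type} {q : Prog} {s : State} {t x y i : ℕ} {R : α → State → Prop}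
    (hy : s.reg y = i) (f : Fin (i + 1) → α)
    (hq : ∀ j : Fin (i + 1), Det q (s.set x j) t fun s' => R (f j) s') :
    Sim (.rand x y ;; q) s (t + 2) ((PMF.uniformOfFintype (Fin (i + 1))).map f) R := by
  subst hy
  have := Sim.seq (ν := fun j => PMF.pure (f j)) (R' := R) (Sim.rand (s := s) x y)
    (fun j _ s' hs => by subst hs; exact (hq j).sim (f j) fun _ h => h)
  exact this.mono_time (by omega)

theorem choose_two_succ (i : ℕ) : (i + 1).choose 2 = i + i.choose 2 := by
  rw [Nat.choose_succ_succ' i 1, Nat.choose_one_right]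

/-- The pairs `(u, v)` with `v < u` in lexicographic order. -/
def pairAt : ℕ → ℕ × ℕ
  | 0 => (1, 0)
  | i + 1 => if (pairAt i).2 + 1 < (pairAt i).1 then ((pairAt i).1, (pairAt i).2 + 1)
    else ((pairAt i).1 + 1, 0)

/-- The index of `(u, v)` is the triangular number `u.choose 2` plus `v`. This yields injectivity,
and shows that the first `n.choose 2` indices give exactly the pairs below `n`. -/
theorem pairAt_spec (i : ℕ) :
    (pairAt i).2 < (pairAt i).1 ∧ (pairAt i).1.choose 2 + (pairAt i).2 = i := by
  induction i with
  | zero => simp [pairAt]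
  | succ i ih =>
    rw [pairAt]
    split_ifs with h
    · exact ⟨h, by simp only; omega⟩
    · refine ⟨by simp, ?_⟩
      have := choose_two_succ (pairAt i).1
      simp only
      omega

theorem pairAt_lt {i n : ℕ} (hi : i < n.choose 2) : (pairAt i).1 < n := by
  have h := (pairAt_spec i).2
  by_contra! hn
  have := Nat.choose_le_choose 2 hn
  omega

/-- Pair number `i`, unordered. -/
def symAt (i : ℕ) : Sym2 ℕ := s((pairAt i).1, (pairAt i).2)

theorem symAt_injective : Function.Injective symAt := by
  intro i j h
  have hi := pairAt_spec i
  have hj := pairAt_spec j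
  rw [symAt, symAt, Sym2.eq_iff] at h
  rcases h with ⟨h1, h2⟩ | ⟨h1, h2⟩
  · rw [h1, h2] at hi; omega
  · omega

theorem image_symAt (n : ℕ) : (Finset.range (n.choose 2)).image symAt = pairs n := by
  refine Finset.eq_of_subset_of_card_le ?_ ?_
  · intro e he
    obtain ⟨i, hi, rfl⟩ := Finset.mem_image.1 he
    have h1 := pairAt_lt (Finset.mem_range.1 hi)
    have h2 := (pairAt_spec i).1
    refine Finset.mem_image.2 ⟨pairAt i, ?_, rfl⟩
    simp only [Finset.mem_offDiag, Finset.mem_range]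
    omega
  · rw [card_pairs, Finset.card_image_of_injective _ symAt_injective, Finset.card_range]

/-- Adds `0 + 1 + ⋯ + (reg 0 - 1)` to register `x`, with the counter `c`. -/
def triangle (x c z : ℕ) : Prog :=
  .add c 0 z ;; .loop c (.sub c c 2 ;; .add x x c)

/-- With no multiplication at hand the triangular number is summed; `reg x + (reg c).choose 2` is
invariant. The register `z` only supplies a zero. -/
theorem triangle_det {x c z n : ℕ} (s : State) (hx : x ≠ c) (h2x : x ≠ 2) (h2c : c ≠ 2) (h1 : s.reg 0 = n) (h2 : s.reg 2 = 1) (hz : s.reg z = 0)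
    (hx0 : s.reg x = 0) :
    Det (triangle x c z) s (4 * n + 3) fun s' => s'.mem = s.mem ∧ s'.reg x = n.choose 2 ∧
      ∀ i, i ≠ x → i ≠ c → s'.reg i = s.reg i := by
  refine Sim.mono_time (t₁ := 1 + (n * (3 + 1) + 1) + 1) ?_ (by omega)
  refine Sim.seq_det (Det.straight trivial le_rfl (Q := fun s' => s' = s.set c n) ?_) ?_
  · simp [Prog.eval, h1, hz]
  rintro _ rfl
  refine (Det.loop (fun i s' => s'.reg c = i ∧ i ≤ n ∧ s'.mem = s.mem ∧
    s'.reg x + i.choose 2 = n.choose 2 ∧ ∀ i, i ≠ x → i ≠ c → s'.reg i = s.reg i)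
    (fun i s h => h.1) ?_ n _ ?_).post ?_
  · rintro i s' ⟨hc, hi, hm, hs, hr⟩
    refine Det.straight (by simp [Prog.Straight]) (by simp [Prog.cost]) ?_
    have e2 : s'.reg 2 = 1 := by rw [hr 2 (by omega) (by omega), h2]
    have := choose_two_succ i
    refine ⟨?_, by omega, ?_, ?_, fun j hj hj' => ?_⟩
    · simp [Prog.eval, State.set_reg, hx.symm, e2, hc]
    · simp [Prog.eval, hm]
    · simp [Prog.eval, State.set_reg, hx, e2, hc]; omega
    · simp [Prog.eval, State.set_reg, hj, hj', hr]
  · refine ⟨by simp [State.set_reg], le_rfl, rfl, by simp [State.set_reg, hx, hx0],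
        fun j _ hj => ?_⟩
    simp [State.set_reg, hj]
  · rintro _ - s' ⟨-, -, hm, hs, hr⟩
    exact ⟨hm, by simpa using hs, hr⟩

/-- Selection sampling of `m` of the `n.choose 2` pairs. -/
def sampler : Prog :=
  .const 2 1 ;; triangle 3 4 5 ;; .const 4 1 ;;
  .loop 3 (.sub 3 3 2 ;; .rand 8 3 ;; .sub 9 1 8 ;;
    .ite 9 (.store 6 4 ;; .add 6 6 2 ;; .store 6 5 ;; .add 6 6 2 ;; .sub 1 1 2) .skip ;;
    .add 5 5 2 ;; .sub 9 4 5 ;; .ite 9 .skip (.add 4 4 2 ;; .const 5 0)) ;;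
  .const 0 0

/-- The memory holds an array of the pairs with indices in `S`, in some order. -/
def Stored (n : ℕ) (S : Finset ℕ) (M : ℕ → ℕ) : Prop :=
  ((Finset.range S.card).image fun i => s(M (2 * i), M (2 * i + 1))) = S.image symAt ∧
    ∀ i < S.card, M (2 * i) < n ∧ M (2 * i + 1) < n

theorem Stored.insert {n a : ℕ} {S : Finset ℕ} {M : ℕ → ℕ} (h : Stored n S M) (ha : a ∉ S)
    (han : a < n.choose 2) : Stored n (insert a S) (Function.update (Function.update M (2 * S.card)
      (pairAt a).1) (2 * S.card + 1) (pairAt a).2) := by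
  have hlt := pairAt_lt han
  have hlt' := (pairAt_spec a).1
  set M' := Function.update (Function.update M (2 * S.card)
      (pairAt a).1) (2 * S.card + 1) (pairAt a).2 with hM
  have h1 : ∀ i < S.card, M' (2 * i) = M (2 * i) ∧ M' (2 * i + 1) = M (2 * i + 1) := by
    intro i hi
    simp only [hM, Function.update_apply]
    constructor <;> rw [if_neg (by omega), if_neg (by omega)]
  have h2 : M' (2 * S.card) = (pairAt a).1 ∧ M' (2 * S.card + 1) = (pairAt a).2 := by
    simp [hM]
  rw [Stored, Finset.card_insert_of_notMem ha]
  constructor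
  · rw [Finset.range_add_one, Finset.image_insert, Finset.image_insert, h2.1, h2.2, ← h.1, symAt]
    congr 1
    refine Finset.image_congr fun i hi => ?_
    simp only [(h1 i (Finset.mem_range.1 hi)).1, (h1 i (Finset.mem_range.1 hi)).2]
  · intro i hi
    rcases Nat.lt_succ_iff_lt_or_eq.1 hi with h' | rfl
    · rw [(h1 i h').1, (h1 i h').2]; exact h.2 i h'
    · rw [h2.1, h2.2]; omega

/-- Register 3 counts the pairs still to be examined, register 1 those still to be drawn, registers
4 and 5 hold the current pair, and register 6 is the write address. The truncated difference `m -
S.card - j` is nonzero exactly when the current pair is selected. -/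
theorem sampler_sim (n m : ℕ) (hm : m ≤ n.choose 2) :
    Sim sampler ⟨(sampler.start n m fun _ => 0).reg, fun _ => 0⟩ (4 * n + 40 * n.choose 2 + 20)
      (iter (pickStep (n.choose 2) m) (n.choose 2) ∅)
      fun S s => s.reg 0 = 0 ∧ Stored n S s.mem := by
  set N := n.choose 2 with hN
  refine Sim.mono_time (t₁ := 1 + ((4 * n + 3) + (1 + ((N * (31 + 1) + 1) + 1 + 1) + 1) + 1) + 1)
    ?_ (by omega)
  refine Sim.seq_det (Det.straight trivial le_rfl rfl) ?_
  rintro _ rfl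
  refine Sim.seq_det (triangle_det (n := n) _ (by decide) (by decide) (by decide) ?_ ?_ ?_ ?_) ?_
  iterate 4 simp [Prog.eval, State.set_reg, Prog.start]
  rintro s ⟨hmem, h3, hreg⟩
  refine Sim.seq_det (Det.straight trivial le_rfl rfl) ?_
  rintro _ rfl
  have hfin := Sim.seq (p := _) (q := Prog.const 0 0) (t₂ := 1)
    (s := Prog.eval (Prog.const 4 1) s) (ν := PMF.pure)
    (R' := fun S s => s.reg 0 = 0 ∧ Stored n S s.mem)
    (Sim.loop (x := 3) (t := 31) (p := .sub 3 3 2 ;; .rand 8 3 ;; .sub 9 1 8 ;;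
      .ite 9 (.store 6 4 ;; .add 6 6 2 ;; .store 6 5 ;; .add 6 6 2 ;; .sub 1 1 2) .skip ;;
      .add 5 5 2 ;; .sub 9 4 5 ;; .ite 9 .skip (.add 4 4 2 ;; .const 5 0))
      (fun i S s => s.reg 3 = i ∧ i ≤ N ∧ s.reg 1 = m - S.card ∧ s.reg 2 = 1 ∧
        s.reg 6 = 2 * S.card ∧ s.reg 4 = (pairAt (N - i)).1 ∧ s.reg 5 = (pairAt (N - i)).2 ∧
        S ⊆ Finset.range (N - i) ∧
            Stored n S s.mem) (pickStep N m) (fun i S s h => h.1) ?_ N ∅ _ ?_)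
    (fun S _ s' hs => ?_)
  · rw [PMF.bind_pure] at hfin
    exact hfin
  · rintro i S s ⟨h3, hi, h1, h2, h6, h4, h5, hS, hst⟩
    refine Sim.mono_time (t₁ := 1 + (27 + 2) + 1) ?_ (by omega)
    refine Sim.seq_det (Det.straight trivial le_rfl rfl) ?_
    rintro _ rfl
    refine Sim.rand_seq (i := i) (by simp [Prog.eval, State.set_reg, h3, h2]) _ fun j => ?_
    refine Det.straight (by simp [Prog.Straight]) (by simp [Prog.cost]) ?_
    have ha : N - (i + 1) ∉ S := fun h => by simpa using hS h
    have hNi : N - i = (N - (i + 1)) + 1 := by omega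
    have hsucc := congrArg pairAt hNi
    rw [pairAt] at hsucc
    have hlt := (pairAt_spec (N - (i + 1))).1
    have hins := hst.insert ha (show N - (i + 1) < n.choose 2 by omega)
    have hsub : S ⊆ Finset.range (N - i) := hS.trans (Finset.range_subset_range.2 (by omega))
    have hsub' : insert (N - (i + 1)) S ⊆ Finset.range (N - i) :=
      Finset.insert_subset (Finset.mem_range.2 (by omega)) hsub
    have hcard := Finset.card_insert_of_notMem ha
    by_cases hj : (j : ℕ) < m - S.card
    · have hj' : m - S.card - j ≠ 0 := by omega
      by_cases hv : (pairAt (N - (i + 1))).2 + 1 < (pairAt (N - (i + 1))).1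
      · have hv' : (pairAt (N - (i + 1))).1 - ((pairAt (N - (i + 1))).2 + 1) ≠ 0 := by omega
        rw [if_pos hv] at hsucc
        simp only [Prog.eval, State.set_reg, State.put_reg, h1, h2, h3, h4, h5, h6, hj, hj', hv',
          if_true, if_false, Nat.reduceEqDiff, ne_eq, not_false_eq_true, hsucc, hsub', hcard]
        simp only [State.set_mem, State.put, and_true, true_and]
        refine ⟨by omega, by omega, by omega, by omega, ?_⟩
        simpa using hins
      · have hv' : (pairAt (N - (i + 1))).1 - ((pairAt (N - (i + 1))).2 + 1) = 0 := by omega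
        rw [if_neg hv] at hsucc
        simp only [Prog.eval, State.set_reg, State.put_reg, h1, h2, h3, h4, h5, h6, hj, hj', hv',
          if_true, if_false, Nat.reduceEqDiff, ne_eq, not_false_eq_true, hsucc, hsub', hcard,
          not_true_eq_false]
        simp only [State.set_mem, State.put, and_true, true_and]
        refine ⟨by omega, by omega, by omega, by omega, ?_⟩
        simpa using hins
    · have hj' : m - S.card - j = 0 := by omega
      by_cases hv : (pairAt (N - (i + 1))).2 + 1 < (pairAt (N - (i + 1))).1
      · have hv' : (pairAt (N - (i + 1))).1 - ((pairAt (N - (i + 1))).2 + 1) ≠ 0 := by omega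
        rw [if_pos hv] at hsucc
        simp only [Prog.eval, State.set_reg, State.put_reg, h1, h2, h3, h4, h5, h6, hj, hj', hv',
          if_true, if_false, Nat.reduceEqDiff, ne_eq, not_false_eq_true, hsucc, hsub, hcard,
          not_true_eq_false]
        simp only [State.set_mem, State.put, and_true, true_and]
        exact ⟨by omega, by omega, hst⟩
      · have hv' : (pairAt (N - (i + 1))).1 - ((pairAt (N - (i + 1))).2 + 1) = 0 := by omega
        rw [if_neg hv] at hsucc
        simp only [Prog.eval, State.set_reg, State.put_reg, h1, h2, h3, h4, h5, h6, hj, hj', hv',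
          if_true, if_false, Nat.reduceEqDiff, ne_eq, not_false_eq_true, hsucc, hsub, hcard,
          not_true_eq_false]
        simp only [State.set_mem, State.put, and_true, true_and]
        exact ⟨by omega, by omega, hst⟩
  · have e1 : s.reg 1 = m := by
      rw [hreg 1 (by decide) (by decide)]; simp [Prog.eval, State.set_reg, Prog.start]
    have e2 : s.reg 2 = 1 := by
      rw [hreg 2 (by decide) (by decide)]; simp [Prog.eval, State.set_reg]
    have e5 : s.reg 5 = 0 := by
      rw [hreg 5 (by decide) (by decide)]; simp [Prog.eval, State.set_reg, Prog.start]
    have e6 : s.reg 6 = 0 := by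
      rw [hreg 6 (by decide) (by decide)]; simp [Prog.eval, State.set_reg, Prog.start]
    simp [Prog.eval, State.set_reg, h3, e1, e2, e5, e6, pairAt, Stored, hN]
  · refine (Det.straight (p := .const 0 0) trivial le_rfl ?_).sim S fun _ h => h
    exact ⟨by simp [Prog.eval, State.set_reg], hs.2.2.2.2.2.2.2.2⟩

/-! ### Thinning of the queries -/

/-- Makes a number `M` of independent choices of queries (register 23), and keeps a random set of `M`
queries. The other queries become void, as their second item is replaced by the first one. -/
def thinning : Prog :=
  triangle 20 21 5 ;; (.add 22 20 20 ;; .sub 22 22 2) ;;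
  .loop 20 (.rand 24 22 ;; .sub 24 1 24 ;; .ite 24 (.add 23 23 2) .skip ;; .sub 20 20 2) ;;
  (.sub 24 23 1 ;; .sub 23 23 24 ;; .add 20 1 5) ;;
  .loop 20 (.sub 20 20 2 ;; .rand 24 20 ;; .sub 24 23 24 ;;
    .ite 24 (.sub 23 23 2 ;; .add 25 25 2) (.load 24 25 ;; .add 25 25 2 ;; .store 25 24) ;;
    .add 25 25 2 ;; .add 25 25 2)

/-- The effect of thinning: only the queries with indices in `S` are kept. -/
def thin (M : ℕ → ℕ) (m : ℕ) (S : Finset ℕ) (a : ℕ) : ℕ :=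
  if a % 3 = 1 ∧ a / 3 < m ∧ a / 3 ∉ S then M (a - 1) else M a

/-- Together with `thin_succ` this describes one pass of the second loop of `thinning`: a kept query
leaves the memory alone, a rejected one gets its second item overwritten. -/
theorem thin_insert (M : ℕ → ℕ) (j : ℕ) (S : Finset ℕ) (hS : S ⊆ Finset.range j) :
    thin M (j + 1) (insert j S) = thin M j S := by
  funext a
  have hj : j ∉ S := fun h => by simpa using hS h
  unfold thin
  by_cases h : a / 3 = j
  · rw [if_neg (by simp [h]), if_neg (by omega)]
  · have e : (a / 3 < j + 1 ∧ a / 3 ∉ insert j S) ↔ (a / 3 < j ∧ a / 3 ∉ S) := by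
      simp only [Finset.mem_insert, not_or]
      constructor
      · rintro ⟨h1, h2, h3⟩; exact ⟨by omega, h3⟩
      · rintro ⟨h1, h2⟩; exact ⟨by omega, h, h2⟩
    simp only [e]

theorem thin_succ (M : ℕ → ℕ) (j : ℕ) (S : Finset ℕ) (hS : S ⊆ Finset.range j) :
    thin M (j + 1) S = Function.update (thin M j S) (3 * j + 1) (thin M j S (3 * j)) := by
  funext a
  have hj : j ∉ S := fun h => by simpa using hS h
  rw [Function.update_apply]
  unfold thin
  by_cases h : a = 3 * j + 1
  · subst h
    have e : (3 * j + 1) / 3 = j := by omega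
    rw [if_pos ⟨by omega, by omega, by rwa [e]⟩, if_pos rfl, if_neg (by omega)]
    rfl
  · rw [if_neg h]
    by_cases h1 : a % 3 = 1
    · have e : a / 3 < j + 1 ↔ a / 3 < j := by omega
      simp only [e]
    · rw [if_neg (by omega), if_neg (by omega)]

/-- The law of the set of the indices of the queries that are kept. -/
def thinLaw (N m : ℕ) : PMF (Finset ℕ) :=
  (iter (countStep (2 * N - 1) m) N 0).bind fun c => iter (pickStep m (min c m)) m ∅

/-- Register 22 holds `2 * N - 1`, since `rand` includes its upper end; comparison with `m` then
succeeds with probability `m / (2 * N)` if `N > 0`. Two truncated subtractions give `c - (c - m) =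
min c m`, and register 25 is the address of the query under consideration. -/
theorem thinning_sim {n m : ℕ} (s : State) (h0 : s.reg 0 = n) (h1 : s.reg 1 = m) (h2 : s.reg 2 = 1)
    (h5 : s.reg 5 = 0) (ht : ∀ i, 20 ≤ i → s.reg i = 0) :
    Sim thinning s (4 * n + 20 * n.choose 2 + 30 * m + 30) (thinLaw (n.choose 2) m)
      fun S s' => (∀ i < 20, s'.reg i = s.reg i) ∧ s'.mem = thin s.mem m S := by
  set N := n.choose 2 with hN
  refine Sim.mono_time (t₁ := (4 * n + 3) + (3 + ((N * (13 + 1) + 1) +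
    (5 + (m * (20 + 1) + 1) + 1) + 1) + 1) + 1) ?_ (by omega)
  refine Sim.seq_det (triangle_det (n := n) _ (by decide) (by decide) (by decide) h0 h2 h5 (ht 20 le_rfl)) ?_
  rintro s₁ ⟨hmem, h20, hreg⟩
  refine Sim.seq_det (Det.straight (by simp [Prog.Straight]) (by simp [Prog.cost]) rfl) ?_
  rintro _ rfl
  have e2 : s₁.reg 2 = 1 := by rw [hreg 2 (by decide) (by decide), h2]
  refine Sim.seq (Sim.loop (x := 20) (t := 13) (fun i c s' => s'.reg 20 = i ∧
      s'.reg 22 = 2 * N - 1 ∧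
    s'.reg 23 = c ∧ s'.reg 25 = 0 ∧ s'.mem = s.mem ∧ ∀ i < 20, s'.reg i = s.reg i)
    (countStep (2 * N - 1) m) (fun i c s h => h.1) ?_ N 0 _ ?_) ?_
  · rintro i c s' ⟨g20, g22, g23, g25, gm, gr⟩
    refine Sim.mono_time (t₁ := 11 + 2) ?_ (by omega)
    refine Sim.rand_seq g22 _ fun j => ?_
    refine Det.straight (by simp [Prog.Straight]) (by simp [Prog.cost]) ?_
    have g1 : s'.reg 1 = m := by rw [gr 1 (by decide), h1]
    have g2 : s'.reg 2 = 1 := by rw [gr 2 (by decide), h2]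
    by_cases hj : (j : ℕ) < m
    · have hj' : m - j ≠ 0 := by omega
      simp only [Prog.eval, State.set_reg, g1, g2, g20, g22, g23, g25, hj, hj',
        if_true, if_false, Nat.reduceEqDiff, ne_eq, not_false_eq_true, State.set_mem, gm]
      refine ⟨by omega, trivial, trivial, trivial, trivial, fun i hi => ?_⟩
      rw [if_neg (by omega), if_neg (by omega), if_neg (by omega), if_neg (by omega), gr i hi]
    · have hj' : m - j = 0 := by omega
      simp only [Prog.eval, State.set_reg, g1, g2, g20, g22, g23, g25, hj, hj',
        if_true, if_false, Nat.reduceEqDiff, ne_eq, not_false_eq_true, State.set_mem, gm,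
        not_true_eq_false]
      refine ⟨by omega, trivial, trivial, trivial, trivial, fun i hi => ?_⟩
      rw [if_neg (by omega), if_neg (by omega), if_neg (by omega), gr i hi]
  · simp only [Prog.eval, State.set_reg, State.set_mem, Nat.reduceEqDiff, if_true, if_false, hmem,
        e2,
      h20]
    refine ⟨rfl, by omega, ?_, ?_, trivial, fun i hi => ?_⟩
    · rw [hreg 23 (by decide) (by decide), ht 23 (by decide)]
    · rw [hreg 25 (by decide) (by decide), ht 25 (by decide)]
    · rw [if_neg (by omega), if_neg (by omega), hreg i (by omega) (by omega)]
  rintro c - s₂ ⟨g20, g22, g23, g25, gm, gr⟩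
  have g1 : s₂.reg 1 = m := by rw [gr 1 (by decide), h1]
  have g5 : s₂.reg 5 = 0 := by rw [gr 5 (by decide), h5]
  refine Sim.seq_det (Det.straight (by simp [Prog.Straight]) (by simp [Prog.cost]) rfl) ?_
  rintro _ rfl
  refine (Sim.loop (x := 20) (t := 20) (fun i S s' => s'.reg 20 = i ∧ i ≤ m ∧
    s'.reg 23 = min c m - S.card ∧ s'.reg 25 = 3 * (m - i) ∧ S ⊆ Finset.range (m - i) ∧
    s'.mem = thin s.mem (m - i) S ∧ ∀ i < 20, s'.reg i = s.reg i)
    (pickStep m (min c m)) (fun i c s h => h.1) ?_ m ∅ _ ?_).post ?_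
  · rintro i S s' ⟨k20, hi, k23, k25, hS, km, kr⟩
    refine Sim.mono_time (t₁ := 1 + (16 + 2) + 1) ?_ (by omega)
    refine Sim.seq_det (Det.straight trivial le_rfl rfl) ?_
    rintro _ rfl
    have k2 : s'.reg 2 = 1 := by rw [kr 2 (by decide), h2]
    refine Sim.rand_seq (i := i) (by simp [Prog.eval, State.set_reg, k20, k2]) _ fun j => ?_
    refine Det.straight (by simp [Prog.Straight]) (by simp [Prog.cost]) ?_
    have ha : m - (i + 1) ∉ S := fun h => by simpa using hS h
    have hNi : m - i = (m - (i + 1)) + 1 := by omega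
    have hsub : S ⊆ Finset.range (m - i) := hS.trans (Finset.range_subset_range.2 (by omega))
    have hsub' : insert (m - (i + 1)) S ⊆ Finset.range (m - i) :=
      Finset.insert_subset (Finset.mem_range.2 (by omega)) hsub
    have hcard := Finset.card_insert_of_notMem ha
    have hins := thin_insert s.mem _ S hS
    have hsuc := thin_succ s.mem _ S hS
    rw [← hNi] at hins hsuc
    by_cases hj : (j : ℕ) < min c m - S.card
    · have hj' : min c m - S.card - j ≠ 0 := by omega
      simp only [Prog.eval, State.set_reg, State.put_reg, k2, k20, k23, k25, hj, hj', hcard, hsub',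
        if_true, if_false, Nat.reduceEqDiff, ne_eq, not_false_eq_true, State.set_mem, km, hins]
      refine ⟨by omega, by omega, by omega, by omega, trivial, trivial, fun i hi => ?_⟩
      iterate 7 rw [if_neg (by omega)]
      exact kr i hi
    · have hj' : min c m - S.card - j = 0 := by omega
      simp only [Prog.eval, State.set_reg, State.put_reg, k2, k20, k23, k25, hj, hj', hsub,
        if_true, if_false, Nat.reduceEqDiff, ne_eq, not_false_eq_true, State.set_mem, km, hsuc,
        not_true_eq_false, State.put]
      refine ⟨by omega, by omega, trivial, by omega, trivial, trivial, fun i hi => ?_⟩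
      iterate 7 rw [if_neg (by omega)]
      exact kr i hi
  · simp only [Prog.eval, State.set_reg, State.set_mem, Nat.reduceEqDiff, if_true, if_false, gm, g1,
      g5, g23, g25, Finset.card_empty, Nat.sub_self]
    refine ⟨by omega, le_rfl, by omega, trivial, by simp, ?_, fun i hi => ?_⟩
    · funext a; simp [thin]
    · rw [if_neg (by omega), if_neg (by omega), if_neg (by omega), gr i hi]
  · rintro S - s' ⟨-, -, -, -, -, km, kr⟩
    exact ⟨kr, by simpa using km⟩

/-! ### The decoder: elementary passes -/

/-- The memory holds the queries `M`, and the integer array `x` as a difference of two arrays. -/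
def Arr (M : ℕ → ℕ) (m n : ℕ) (x : ℕ → ℤ) (mem : ℕ → ℕ) : Prop :=
  (∀ a < 3 * m, mem a = M a) ∧ ∀ v ≤ n, (mem (3 * m + v) : ℤ) - mem (3 * m + (n + 1) + v) = x v

theorem Arr.put {M mem : ℕ → ℕ} {m n : ℕ} {x : ℕ → ℤ} (h : Arr M m n x mem) {v : ℕ} (hv : v ≤ n)
    (P Q : ℕ) : Arr M m n (Function.update x v (P - Q))
      (Function.update (Function.update mem (3 * m + v) P) (3 * m + (n + 1) + v) Q) := by
  refine ⟨fun a ha => ?_, fun w hw => ?_⟩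
  · simp only [Function.update_apply]
    rw [if_neg (by omega), if_neg (by omega), h.1 a ha]
  · simp only [Function.update_apply]
    by_cases hwv : w = v
    · subst hwv
      rw [if_neg (by omega), if_pos rfl, if_pos rfl, if_pos rfl]
    · rw [if_neg (by omega), if_neg (by omega), if_neg (by omega), if_neg (by omega), if_neg hwv,
        h.2 w hw]

/-- The registers of the decoder that hold the dimensions. -/
def Dims (m n : ℕ) (r : ℕ → ℕ) : Prop :=
  r 0 = n ∧ r 1 = m ∧ r 2 = 1 ∧ r 3 = 3 * m ∧ r 4 = 3 * m + (n + 1) ∧ r 5 = 0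

/-- The source and target intervals. -/
def Ends (a b c d : ℕ) (r : ℕ → ℕ) : Prop := r 12 = a ∧ r 13 = b ∧ r 14 = c ∧ r 15 = d

/-- Registers from 20 on are scratch space. The array passes preserve all registers below 20, so the
dimensions and the interval ends survive them. -/
theorem Dims.congr {m n : ℕ} {r r' : ℕ → ℕ} (h : Dims m n r) (hr : ∀ i < 20, r' i = r i) :
    Dims m n r' := by
  unfold Dims at *
  rw [hr 0 (by decide), hr 1 (by decide), hr 2 (by decide), hr 3 (by decide), hr 4 (by decide),
    hr 5 (by decide)]
  exact h

theorem Ends.congr {a b c d : ℕ} {r r' : ℕ → ℕ} (h : Ends a b c d r) (hr : ∀ i < 20, r' i = r i) :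
    Ends a b c d r' := by
  unfold Ends at *
  rw [hr 12 (by decide), hr 13 (by decide), hr 14 (by decide), hr 15 (by decide)]
  exact h

/-- A loop over the target interval. -/
def scan (p : Prog) : Prog :=
  .sub 20 15 14 ;; .add 21 14 5 ;; .loop 20 (p ;; .add 21 21 2 ;; .sub 20 20 2)

/-- The body is tested against an arbitrary array `y` that agrees with `x` at `v`, because the
earlier entries have already been replaced. The clause on `w < v` protects the words `g` recorded so
far. -/
theorem scan_det {M : ℕ → ℕ} {m n a b c d t : ℕ} {p : Prog} (x : ℕ → ℤ) (f : ℕ → ℤ) (hd : d ≤ n + 1)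
    (s : State) (hs : Dims m n s.reg) (he : Ends a b c d s.reg) (hA : Arr M m n x s.mem)
    (g : ℕ → ℕ)
    (hp : ∀ (v : ℕ) (y : ℕ → ℤ) (s' : State), v ≤ n → Dims m n s'.reg → s'.reg 21 = v →
      Arr M m n y s'.mem → y v = x v → Det p s' t fun s'' => (∀ i < 22, s''.reg i = s'.reg i) ∧
        Arr M m n (Function.update y v (f v)) s''.mem ∧ s''.mem (3 * m + v) = g v ∧
        ∀ w < v, s''.mem (3 * m + w) = s'.mem (3 * m + w)) :
    Det (scan p) s ((t + 6) * (n + 1) + 6) fun s' => (∀ i < 20, s'.reg i = s.reg i) ∧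
      Arr M m n (fun v => if c ≤ v ∧ v < d then f v else x v) s'.mem ∧
      ∀ v, c ≤ v → v < d → s'.mem (3 * m + v) = g v := by
  obtain ⟨h0, h1, h2, h3, h4, h5⟩ := hs
  obtain ⟨h12, h13, h14, h15⟩ := he
  refine Sim.mono_time (t₁ := 1 + (1 + ((d - c) * (t + 4 + 1) + 1) + 1) + 1) ?_ ?_
  swap
  · have : (d - c) * (t + 4 + 1) ≤ (n + 1) * (t + 6) := Nat.mul_le_mul (by omega) (by omega)
    rw [mul_comm (t + 6)]
    omega
  refine Sim.seq_det (Det.straight trivial le_rfl rfl) ?_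
  rintro _ rfl
  refine Sim.seq_det (Det.straight trivial le_rfl rfl) ?_
  rintro _ rfl
  refine (Det.loop (fun i s' => s'.reg 20 = i ∧ i ≤ d - c ∧ s'.reg 21 = c + (d - c - i) ∧
    (∀ i < 20, s'.reg i = s.reg i) ∧
    Arr M m n (fun v => if c ≤ v ∧ v < c + (d - c - i) then f v else x v) s'.mem ∧
    ∀ v, c ≤ v → v < c + (d - c - i) → s'.mem (3 * m + v) = g v)
    (fun i s h => h.1) ?_ (d - c) _ ?_).post ?_
  · rintro i s' ⟨g20, hi, g21, gr, gA, gg⟩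
    have gD : Dims m n s'.reg := Dims.congr ⟨h0, h1, h2, h3, h4, h5⟩ gr
    refine Sim.mono_time (t₁ := t + 3 + 1) ?_ (by omega)
    set v := c + (d - c - (i + 1)) with hv
    have hv' : c + (d - c - i) = v + 1 := by omega
    refine Sim.seq_det (hp v _ s' (by omega) gD g21 gA ?_) ?_
    · simp
    rintro s'' ⟨kr, kA, kg, kw⟩
    refine Det.straight (by simp [Prog.Straight]) (by simp [Prog.cost]) ?_
    have k2 : s''.reg 2 = 1 := by rw [kr 2 (by decide), gr 2 (by decide), h2]
    have k20 : s''.reg 20 = i + 1 := by rw [kr 20 (by decide), g20]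
    have k21 : s''.reg 21 = v := by rw [kr 21 (by decide), g21]
    simp only [Prog.eval, State.set_reg, State.set_mem, k2, k20, k21, Nat.reduceEqDiff, if_true,
      if_false, hv']
    refine ⟨by omega, by omega, trivial, fun j hj => ?_, ?_, fun w hw hw' => ?_⟩
    · rw [if_neg (by omega), if_neg (by omega), kr j (by omega), gr j hj]
    · convert kA using 1
      funext w
      rw [Function.update_apply]
      by_cases hwv : w = v
      · rw [if_pos hwv, if_pos (by omega), hwv]
      · have : (c ≤ w ∧ w < v + 1) ↔ (c ≤ w ∧ w < v) := by omega
        rw [if_neg hwv]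
        simp only [this]
    · by_cases hwv : w = v
      · rw [hwv, kg]
      · rw [kw w (by omega), gg w hw (by omega)]
  · simp only [Prog.eval, State.set_reg, State.set_mem, Nat.reduceEqDiff, if_true,
      if_false, h14, h15, h5]
    refine ⟨trivial, le_rfl, by omega, fun j hj => ?_, ?_, fun w hw hw' => by omega⟩
    · rw [if_neg (by omega), if_neg (by omega)]
    · convert hA using 1
      funext w
      rw [if_neg (by omega)]
  · rintro _ - s' ⟨-, -, -, gr, gA, gg⟩
    refine ⟨gr, ?_, fun v hv hv' => gg v hv (by omega)⟩
    convert gA using 1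
    funext w
    have : (c ≤ w ∧ w < d) ↔ (c ≤ w ∧ w < c + (d - c - 0)) := by omega
    simp only [this]

/-- Clears the target interval. -/
def clear : Prog := scan (.add 22 3 21 ;; .store 22 5 ;; .add 22 4 21 ;; .store 22 5)

theorem clear_det {M : ℕ → ℕ} {m n a b c d : ℕ} (x : ℕ → ℤ) (hd : d ≤ n + 1)
    (s : State) (hs : Dims m n s.reg) (he : Ends a b c d s.reg) (hA : Arr M m n x s.mem) :
    Det clear s (13 * (n + 1) + 6) fun s' => (∀ i < 20, s'.reg i = s.reg i) ∧
      Arr M m n (fun v => if c ≤ v ∧ v < d then 0 else x v) s'.mem := by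
  refine (scan_det (t := 7) x (fun _ => 0) hd s hs he hA (fun _ => 0) ?_).post
    fun _ _ s' h => ⟨h.1, h.2.1⟩
  rintro v y s' hv ⟨h0, h1, h2, h3, h4, h5⟩ h21 hA -
  refine Det.straight (by simp [Prog.Straight]) (by simp [Prog.cost]) ?_
  simp only [Prog.eval, State.set_reg, State.set_mem, State.put, h3, h4, h5, h21, Nat.reduceEqDiff,
    if_true, if_false]
  refine ⟨fun i hi => ?_, ?_, ?_, fun w hw => ?_⟩
  · rw [if_neg (by omega), if_neg (by omega)]
  · simpa using hA.put hv 0 0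
  · rw [Function.update_of_ne (by omega), Function.update_self]
  · rw [Function.update_of_ne (by omega), Function.update_of_ne (by omega)]

/-- The sign of an integer, with the sign `-1` for `0`. -/
def sgn (k : ℤ) : ℤ := if 0 < k then 1 else -1

/-- Replaces the entries in the target interval by their signs. -/
def signs : Prog := scan (.add 22 3 21 ;; .load 23 22 ;; .add 24 4 21 ;; .load 25 24 ;;
  .sub 25 23 25 ;; .ite 25 (.store 22 2 ;; .store 24 5) (.store 22 5 ;; .store 24 2))

/-- The last clause serves the final pass only: there the array of positive parts is itself the
returned array of labels. -/
theorem signs_det {M : ℕ → ℕ} {m n a b c d : ℕ} (x : ℕ → ℤ) (hd : d ≤ n + 1)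
    (s : State) (hs : Dims m n s.reg) (he : Ends a b c d s.reg) (hA : Arr M m n x s.mem) :
    Det signs s (20 * (n + 1) + 6) fun s' => (∀ i < 20, s'.reg i = s.reg i) ∧
      Arr M m n (fun v => if c ≤ v ∧ v < d then sgn (x v) else x v) s'.mem ∧
      ∀ v, c ≤ v → v < d → s'.mem (3 * m + v) = if 0 < x v then 1 else 0 := by
  refine scan_det (t := 14) x (fun v => sgn (x v)) hd s hs he hA _ ?_
  rintro v y s' hv ⟨h0, h1, h2, h3, h4, h5⟩ h21 hA hy
  refine Det.straight (by simp [Prog.Straight]) (by simp [Prog.cost]) ?_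
  have hxv := hA.2 v hv
  rw [hy] at hxv
  by_cases hx : 0 < x v
  · have : s'.mem (3 * m + v) - s'.mem (3 * m + (n + 1) + v) ≠ 0 := by omega
    simp only [Prog.eval, State.set_reg, State.set_mem, State.put, h2, h3, h4, h5, h21,
      Nat.reduceEqDiff, if_true, if_false, this, ne_eq, not_false_eq_true, hx, sgn]
    refine ⟨fun i hi => ?_, ?_, ?_, fun w hw => ?_⟩
    · iterate 5 rw [if_neg (by omega)]
    · simpa using hA.put hv 1 0
    · rw [Function.update_of_ne (by omega), Function.update_self]
    · rw [Function.update_of_ne (by omega), Function.update_of_ne (by omega)]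
  · have : s'.mem (3 * m + v) - s'.mem (3 * m + (n + 1) + v) = 0 := by omega
    simp only [Prog.eval, State.set_reg, State.set_mem, State.put, h2, h3, h4, h5, h21,
      Nat.reduceEqDiff, if_true, if_false, this, ne_eq, not_true_eq_false, hx, sgn]
    refine ⟨fun i hi => ?_, ?_, ?_, fun w hw => ?_⟩
    · iterate 5 rw [if_neg (by omega)]
    · simpa using hA.put hv 0 1
    · rw [Function.update_of_ne (by omega), Function.update_self]
    · rw [Function.update_of_ne (by omega), Function.update_of_ne (by omega)]

/-- If `reg u` is in the source interval and `reg v` in the target interval, then the entry of `u`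
is added to or subtracted from the entry of `v`, according to the answer `reg 24`. -/
def edge (u v : ℕ) : Prog :=
  .sub 25 12 u ;; .ite 25 .skip (.sub 25 13 u ;; .ite 25 (.sub 25 14 v ;; .ite 25 .skip
    (.sub 25 15 v ;; .ite 25 (
      .add 25 3 u ;; .load 26 25 ;; .add 25 4 u ;; .load 27 25 ;;
      .add 28 3 v ;; .load 29 28 ;; .add 30 4 v ;; .load 31 30 ;;
      .ite 24 (.add 29 29 26 ;; .add 31 31 27) (.add 29 29 27 ;; .add 31 31 26) ;;
      .store 28 29 ;; .store 30 31) .skip)) .skip)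

/-- The sign that is encoded by an answer. -/
def sign (a : ℕ) : ℤ := if a ≠ 0 then 1 else -1

/-- The interval tests are signs of truncated differences. A negative answer is applied by
exchanging the positive and the negative part of the source entry. -/
theorem edge_det {M : ℕ → ℕ} {m n a b c d u v u' v' e : ℕ} (x : ℕ → ℤ) (s : State)
    (hs : Dims m n s.reg) (he : Ends a b c d s.reg) (hA : Arr M m n x s.mem) (hu : s.reg u = u')
    (hv : s.reg v = v') (h24 : s.reg 24 = e) (hu' : u' ≤ n) (hv' : v' ≤ n) (hu25 : u < 24)
    (hv25 : v < 24) :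
    Det (edge u v) s 40 fun s' => (∀ i < 25, s'.reg i = s.reg i) ∧
      Arr M m n (if (a ≤ u' ∧ u' < b) ∧ (c ≤ v' ∧ v' < d) then
        Function.update x v' (x v' + sign e * x u') else x) s'.mem := by
  obtain ⟨h0, h1, h2, h3, h4, h5⟩ := hs
  obtain ⟨h12, h13, h14, h15⟩ := he
  refine Det.straight (by simp [Prog.Straight, edge]) (by simp [Prog.cost, edge]) ?_
  have n1 : u ≠ 25 := by omega
  have n2 : v ≠ 25 := by omega
  by_cases c1 : a ≤ u'
  swap
  · have : a - u' ≠ 0 := by omega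
    rw [if_neg (by omega)]
    simp only [edge, Prog.eval, State.set_reg, State.set_mem, h12, hu, this, if_true, ne_eq,
      not_false_eq_true]
    exact ⟨fun i hi => by rw [if_neg (by omega)], hA⟩
  have c1' : a - u' = 0 := by omega
  by_cases c2 : u' < b
  swap
  · have : b - u' = 0 := by omega
    rw [if_neg (by omega)]
    simp only [edge, Prog.eval, State.set_reg, State.set_mem, h12, h13, hu, c1', this, if_true,
        ne_eq,
      not_true_eq_false, if_false, n1, Nat.reduceEqDiff]
    exact ⟨fun i hi => by rw [if_neg (by omega), if_neg (by omega)], hA⟩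
  have c2' : b - u' ≠ 0 := by omega
  by_cases c3 : c ≤ v'
  swap
  · have : c - v' ≠ 0 := by omega
    rw [if_neg (by omega)]
    simp only [edge, Prog.eval, State.set_reg, State.set_mem, h12, h13, h14, hu, hv, c1', c2', this,
      if_true, ne_eq, not_true_eq_false, not_false_eq_true, if_false, n1, n2, Nat.reduceEqDiff]
    exact ⟨fun i hi => by rw [if_neg (by omega), if_neg (by omega), if_neg (by omega)], hA⟩
  have c3' : c - v' = 0 := by omega
  by_cases c4 : v' < d
  swap
  · have : d - v' = 0 := by omega
    rw [if_neg (by omega)]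
    simp only [edge, Prog.eval, State.set_reg, State.set_mem, h12, h13, h14, h15, hu, hv, c1', c2',
      c3', this, if_true, ne_eq, not_true_eq_false, not_false_eq_true, if_false, n1, n2,
      Nat.reduceEqDiff]
    exact ⟨fun i hi => by iterate 4 rw [if_neg (by omega)], hA⟩
  have c4' : d - v' ≠ 0 := by omega
  rw [if_pos ⟨⟨c1, c2⟩, c3, c4⟩]
  have m1 : u ≠ 26 := by omega
  have m2 : v ≠ 26 := by omega
  have m3 : u ≠ 27 := by omega
  have m4 : v ≠ 27 := by omega
  have m5 : v ≠ 28 := by omega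
  have m6 : v ≠ 29 := by omega
  have hxu := hA.2 u' hu'
  have hxv := hA.2 v' hv'
  by_cases h0 : e = 0
  · simp only [edge, Prog.eval, State.set_reg, State.set_mem, State.put, h3, h4, h12, h13, h14, h15,
      hu, hv, h24, c1', c2', c3', c4', if_true, ne_eq, not_true_eq_false, not_false_eq_true,
          if_false,
      n1, n2, m1, m2, m3, m4, m5, m6, Nat.reduceEqDiff, h0, sign]
    refine ⟨fun i hi => by iterate 14 rw [if_neg (by omega)], ?_⟩
    convert hA.put hv' _ _ using 2
    push_cast
    linarith
  · simp only [edge, Prog.eval, State.set_reg, State.set_mem, State.put, h3, h4, h12, h13, h14, h15,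
      hu, hv, h24, c1', c2', c3', c4', if_true, ne_eq, not_true_eq_false, not_false_eq_true,
          if_false,
      n1, n2, m1, m2, m3, m4, m5, m6, Nat.reduceEqDiff, h0, sign]
    refine ⟨fun i hi => by iterate 14 rw [if_neg (by omega)], ?_⟩
    convert hA.put hv' _ _ using 2
    push_cast
    linarith

/-- The symmetric matrix of the answers. -/
def answerMatrix (M : ℕ → ℕ) (m : ℕ) (t w : ℕ) : ℤ :=
  ∑ j ∈ Finset.range m, ((if M (3 * j + 1) = t ∧ M (3 * j) = w then sign (M (3 * j + 2)) else 0) +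
    if M (3 * j) = t ∧ M (3 * j + 1) = w then sign (M (3 * j + 2)) else 0)

/-- The entries in `[c, d)` are replaced by the sums of the entries in `[a, b)` with the weights given
by the matrix `A`. -/
def push (A : ℕ → ℕ → ℤ) (a b c d : ℕ) (x : ℕ → ℤ) (t : ℕ) : ℤ :=
  if c ≤ t ∧ t < d then ∑ w ∈ Finset.Ico a b, A t w * x w else x t

theorem sum_Ico_ite_and (p : Prop) [Decidable p] (a b q : ℕ) (k : ℤ) (x : ℕ → ℤ) :
    ∑ w ∈ Finset.Ico a b, (if p ∧ q = w then k else 0) * x w =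
      if p ∧ a ≤ q ∧ q < b then k * x q else 0 := by
  by_cases hp : p
  · simp only [hp, true_and, ite_mul, zero_mul, Finset.sum_ite_eq, Finset.mem_Ico]
  · simp [hp]

theorem push_succ (M : ℕ → ℕ) (j a b c d : ℕ) (x : ℕ → ℤ) (t : ℕ) :
    push (answerMatrix M (j + 1)) a b c d x t = push (answerMatrix M j) a b c d x t +
      (if c ≤ t ∧ t < d then
        ((if M (3 * j + 1) = t ∧ a ≤ M (3 * j) ∧ M (3 * j) < b then
          sign (M (3 * j + 2)) * x (M (3 * j)) else 0) +
        (if M (3 * j) = t ∧ a ≤ M (3 * j + 1) ∧ M (3 * j + 1) < b then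
          sign (M (3 * j + 2)) * x (M (3 * j + 1)) else 0)) else 0) := by
  have h : ∀ w, answerMatrix M (j + 1) t w = answerMatrix M j t w +
      ((if M (3 * j + 1) = t ∧ M (3 * j) = w then sign (M (3 * j + 2)) else 0) +
        if M (3 * j) = t ∧ M (3 * j + 1) = w then sign (M (3 * j + 2)) else 0) := fun w =>
    Finset.sum_range_succ _ _
  unfold push
  by_cases ht : c ≤ t ∧ t < d
  · simp only [if_pos ht, h, add_mul, Finset.sum_add_distrib, sum_Ico_ite_and]
  · simp [if_neg ht]

/-- Adds all the contributions of the source interval to the target interval. -/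
def accumulate : Prog :=
  .add 20 1 5 ;; .const 21 0 ;; .loop 20 (
    (.load 22 21 ;; .add 21 21 2 ;; .load 23 21 ;; .add 21 21 2 ;; .load 24 21 ;; .add 21 21 2) ;;
    edge 22 23 ;; edge 23 22 ;; .sub 20 20 2)

/-- Since source and target are disjoint, source values do not change during the pass, and at most
one of the two orientations of a query has an effect. The partial results are therefore `push` for
the matrix of the queries read so far. -/
theorem accumulate_det {M : ℕ → ℕ} {m n a b c d : ℕ} (x : ℕ → ℤ) (s : State)
    (hM : ∀ j < m, M (3 * j) ≤ n ∧ M (3 * j + 1) ≤ n) (hdis : ∀ t, a ≤ t → t < b → c ≤ t → d ≤ t)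
    (hs : Dims m n s.reg) (he : Ends a b c d s.reg) (hA : Arr M m n x s.mem)
    (hx : ∀ t, c ≤ t → t < d → x t = 0) :
    Det accumulate s (110 * m + 6) fun s' => (∀ i < 20, s'.reg i = s.reg i) ∧
      Arr M m n (push (answerMatrix M m) a b c d x) s'.mem := by
  obtain ⟨h0, h1, h2, h3, h4, h5⟩ := hs
  refine Sim.mono_time (t₁ := 1 + (1 + (m * (95 + 1) + 1) + 1) + 1) ?_ (by omega)
  refine Sim.seq_det (Det.straight trivial le_rfl rfl) ?_
  rintro _ rfl
  refine Sim.seq_det (Det.straight trivial le_rfl rfl) ?_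
  rintro _ rfl
  refine (Det.loop (fun i s' => s'.reg 20 = i ∧ i ≤ m ∧ s'.reg 21 = 3 * (m - i) ∧
    (∀ i < 20, s'.reg i = s.reg i) ∧
    Arr M m n (push (answerMatrix M (m - i)) a b c d x) s'.mem)
    (fun i s h => h.1) ?_ m _ ?_).post ?_
  · rintro i s' ⟨g20, hi, g21, gr, gA⟩
    set j := m - (i + 1) with hj
    have hj' : m - i = j + 1 := by omega
    have gD : Dims m n s'.reg := Dims.congr ⟨h0, h1, h2, h3, h4, h5⟩ gr
    have gE := he.congr gr
    have g2 : s'.reg 2 = 1 := gD.2.2.1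
    obtain ⟨hu, hv⟩ := hM j (by omega)
    have q0 : s'.mem (3 * j) = M (3 * j) := gA.1 _ (by omega)
    have q1 : s'.mem (3 * j + 1) = M (3 * j + 1) := gA.1 _ (by omega)
    have q2 : s'.mem (3 * j + 1 + 1) = M (3 * j + 2) := gA.1 _ (by omega)
    refine Sim.mono_time (t₁ := 11 + (40 + (40 + 1 + 1) + 1) + 1) ?_ (by omega)
    refine Sim.seq_det (Det.straight (by simp [Prog.Straight]) (by simp [Prog.cost])
      (Q := fun s'' => s''.mem = s'.mem ∧ (∀ i < 21, s''.reg i = s'.reg i) ∧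
        s''.reg 21 = 3 * (j + 1) ∧ s''.reg 22 = M (3 * j) ∧ s''.reg 23 = M (3 * j + 1) ∧
        s''.reg 24 = M (3 * j + 2)) ?_) ?_
    · simp only [Prog.eval, State.set_reg, State.set_mem, Nat.reduceEqDiff, if_true, if_false, g2,
        g21, q0, q1, q2, true_and, and_true]
      refine ⟨fun i hi => ?_, by omega⟩
      iterate 6 rw [if_neg (by omega)]
    rintro s₁ ⟨k, kr, k21, k22, k23, k24⟩
    have kr' : ∀ i < 20, s₁.reg i = s'.reg i := fun i hi => kr i (by omega)
    rw [← k] at gA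
    refine Sim.mono_time (t₁ := 40 + (40 + 1 + 1) + 1) ?_ (by omega)
    refine Sim.seq_det (edge_det _ s₁ (gD.congr kr') (gE.congr kr') gA k22 k23 k24 hu hv
      (by decide) (by decide)) ?_
    rintro s₂ ⟨lr, lA⟩
    have lr' : ∀ i < 20, s₂.reg i = s₁.reg i := fun i hi => lr i (by omega)
    refine Sim.mono_time (t₁ := 40 + 1 + 1) ?_ (by omega)
    refine Sim.seq_det (edge_det _ s₂ ((gD.congr kr').congr lr') ((gE.congr kr').congr lr') lA
      (by rw [lr 23 (by decide), k23]) (by rw [lr 22 (by decide), k22])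
      (by rw [lr 24 (by decide), k24]) hv hu (by decide) (by decide)) ?_
    rintro s₃ ⟨or, oA⟩
    refine Det.straight trivial le_rfl ?_
    have e2 : s₃.reg 2 = 1 := by
      rw [or 2 (by decide), lr 2 (by decide), kr 2 (by decide), g2]
    have e20 : s₃.reg 20 = i + 1 := by
      rw [or 20 (by decide), lr 20 (by decide), kr 20 (by decide), g20]
    have e21 : s₃.reg 21 = 3 * (j + 1) := by
      rw [or 21 (by decide), lr 21 (by decide), k21]
    simp only [Prog.eval, State.set_reg, State.set_mem, Nat.reduceEqDiff, if_true, if_false, e2,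
        e20,
      e21, hj', Nat.add_sub_cancel, true_and]
    refine ⟨by omega, fun i hi => ?_, ?_⟩
    · rw [if_neg (by omega), or i (by omega), lr i (by omega), kr i (by omega), gr i (by omega)]
    convert oA using 1
    have hsrc : ∀ u, a ≤ u → u < b → ∀ A, push A a b c d x u = x u := fun u h1 h2 A => by
      rw [push, if_neg]; intro h; have := hdis u h1 h2 h.1; omega
    funext t
    have hstep := push_succ M j a b c d x t
    rw [hstep]
    generalize hy : push (answerMatrix M j) a b c d x = y at *
    have hsrc' : ∀ u, a ≤ u → u < b → y u = x u := fun u h1 h2 => hy ▸ hsrc u h1 h2 _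
    by_cases c1 : (a ≤ M (3 * j) ∧ M (3 * j) < b) ∧ c ≤ M (3 * j + 1) ∧ M (3 * j + 1) < d
    · have c2 : ¬ ((a ≤ M (3 * j + 1) ∧ M (3 * j + 1) < b) ∧ c ≤ M (3 * j) ∧ M (3 * j) < d) := by
        rintro ⟨⟨h1, h2⟩, -⟩
        have := hdis _ h1 h2 c1.2.1
        omega
      rw [if_pos c1, if_neg c2, Function.update_apply]
      by_cases ht : t = M (3 * j + 1)
      · rw [if_pos ht, if_pos (by omega), if_pos ⟨ht.symm, c1.1⟩, if_neg, hsrc' _ c1.1.1 c1.1.2, ht,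
          add_zero]
        rintro ⟨h, -⟩
        have := hdis _ c1.1.1 c1.1.2 (by omega)
        omega
      · have hn : ¬ (M (3 * j) = t ∧ a ≤ M (3 * j + 1) ∧ M (3 * j + 1) < b) := by
          rintro ⟨h, h1, h2⟩
          have := hdis _ h1 h2 c1.2.1
          omega
        simp [if_neg ht, if_neg hn, if_neg fun h : M (3 * j + 1) = t ∧ _ => ht h.1.symm]
    · rw [if_neg c1]
      by_cases c2 : (a ≤ M (3 * j + 1) ∧ M (3 * j + 1) < b) ∧ c ≤ M (3 * j) ∧ M (3 * j) < d
      · rw [if_pos c2, Function.update_apply]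
        by_cases ht : t = M (3 * j)
        · rw [if_pos ht, if_pos (by omega), if_neg, if_pos ⟨ht.symm, c2.1⟩, hsrc' _ c2.1.1 c2.1.2,
            ht, zero_add]
          rintro ⟨h, -⟩
          have := hdis _ c2.1.1 c2.1.2 (by omega)
          omega
        · have hn : ¬ (M (3 * j + 1) = t ∧ a ≤ M (3 * j) ∧ M (3 * j) < b) := by
            rintro ⟨h, h1, h2⟩
            have := hdis _ h1 h2 c2.2.1
            omega
          simp [if_neg ht, if_neg hn, if_neg fun h : M (3 * j) = t ∧ _ => ht h.1.symm]
      · rw [if_neg c2]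
        split_ifs <;> omega
  · simp only [Prog.eval, State.set_reg, State.set_mem, Nat.reduceEqDiff, if_true,
      if_false, h1, h5]
    refine ⟨by omega, le_rfl, by omega, fun j hj => ?_, ?_⟩
    · rw [if_neg (by omega), if_neg (by omega)]
    · convert hA using 1
      funext w
      simp only [push, Nat.sub_self, answerMatrix, Finset.range_zero, Finset.sum_empty, zero_mul,
        Finset.sum_const_zero]
      split_ifs with h
      · rw [hx w h.1 h.2]
      · rfl
  · rintro _ - s' ⟨-, -, -, gr, gA⟩
    exact ⟨gr, gA⟩

/-- Replaces the entries of the target interval. -/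
def round : Prog := clear ;; accumulate

theorem round_det {M : ℕ → ℕ} {m n a b c d : ℕ} (x : ℕ → ℤ) (s : State)
    (hM : ∀ j < m, M (3 * j) ≤ n ∧ M (3 * j + 1) ≤ n) (hdis : ∀ t, a ≤ t → t < b → c ≤ t → d ≤ t)
    (hd : d ≤ n + 1)
    (hs : Dims m n s.reg) (he : Ends a b c d s.reg) (hA : Arr M m n x s.mem) :
    Det round s (110 * m + 13 * n + 30) fun s' => (∀ i < 20, s'.reg i = s.reg i) ∧
      Arr M m n (push (answerMatrix M m) a b c d x) s'.mem := by
  refine Sim.mono_time (t₁ := (13 * (n + 1) + 6) + (110 * m + 6) + 1) ?_ (by omega)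
  refine Sim.seq_det (clear_det x hd s hs he hA) ?_
  rintro s₁ ⟨hr, hA₁⟩
  refine (accumulate_det _ s₁ hM hdis (hs.congr hr) (he.congr hr) hA₁ ?_).post ?_
  · intro t h1 h2; rw [if_pos ⟨h1, h2⟩]
  · rintro _ - s₂ ⟨hr', hA₂⟩
    refine ⟨fun i hi => by rw [hr' i hi, hr i hi], ?_⟩
    convert hA₂ using 1
    funext t
    unfold push
    dsimp only
    split_ifs with h
    · refine Finset.sum_congr rfl fun w hw => ?_
      rw [Finset.mem_Ico] at hw
      rw [if_neg]
      intro hw'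
      have := hdis w hw.1 hw.2 hw'.1
      omega
    · rfl

/-! ### The decoder -/

theorem Sim.seq_det_le {α : Type} {p q : Prog} {s : State} {t t₁ t₂ : ℕ} {μ : PMF α}
    {R : α → State → Prop} {Q : State → Prop} (hp : Det p s t₁ Q)
    (hq : ∀ s', Q s' → Sim q s' t₂ μ R) (ht : t₁ + t₂ + 1 ≤ t) : Sim (.seq p q) s t μ R :=
  (hp.seq_det hq).mono_time ht

/-- `reg q := reg y / reg z`. -/
def divide (q y z : ℕ) : Prog :=
  .const q 0 ;; .const 21 0 ;; .add 20 y 5 ;; .loop 20 (.add 21 21 2 ;; .sub 22 z 21 ;;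
    .ite 22 .skip (.add q q 2 ;; .const 21 0) ;; .sub 20 20 2)

/-- The invariant is `quotient * Z + remainder + i = Y`. The alternative `Y = 0` covers `n ≤ 1`,
where the divisor `Nat.clog 2 n` vanishes, but the loop is not entered. -/
theorem divide_det {q y z Y Z : ℕ} (s : State) (h2 : s.reg 2 = 1) (h5 : s.reg 5 = 0) (hq : q < 20)
    (hq5 : 5 < q) (hy : y < 20) (hz : z < 20) (hqy : q ≠ y) (hqz : q ≠ z) (hY : s.reg y = Y)
    (hZ : s.reg z = Z) (hYZ : 0 < Z ∨ Y = 0) :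
    Det (divide q y z) s (16 * Y + 7) fun s' => s'.mem = s.mem ∧ s'.reg q = Y / Z ∧
      ∀ i < 20, i ≠ q → s'.reg i = s.reg i := by
  refine Sim.mono_time (t₁ := 1 + (1 + (1 + (Y * (13 + 1) + 1) + 1) + 1) + 1) ?_ (by omega)
  refine Sim.seq_det (Det.straight trivial le_rfl rfl) ?_
  rintro _ rfl
  refine Sim.seq_det (Det.straight trivial le_rfl rfl) ?_
  rintro _ rfl
  refine Sim.seq_det (Det.straight trivial le_rfl rfl) ?_
  rintro _ rfl
  refine (Det.loop (fun i s' => s'.reg 20 = i ∧ i ≤ Y ∧ s'.reg q * Z + s'.reg 21 + i = Y ∧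
      s'.reg q + i ≤ Y ∧
    (0 < Z → s'.reg 21 < Z) ∧ s'.mem = s.mem ∧ ∀ i < 20, i ≠ q → s'.reg i = s.reg i)
    (fun i s h => h.1) ?_ Y _ ?_).post ?_
  · rintro i s' ⟨g20, hi, hdiv, hqi, hlt, gm, gr⟩
    refine Det.straight (by simp [Prog.Straight]) (by simp [Prog.cost]) ?_
    have e2 : s'.reg 2 = 1 := by rw [gr 2 (by omega) (by omega), h2]
    have ez : s'.reg z = Z := by rw [gr z (by omega) (by omega), hZ]
    have n1 : z ≠ 21 := by omega
    have n2 : q ≠ 21 := by omega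
    have n3 : q ≠ 22 := by omega
    have n4 : q ≠ 20 := by omega
    have hZ0 : 0 < Z := hYZ.resolve_right (by omega)
    have hlt' := hlt hZ0
    have m2 : 2 ≠ q := by omega
    by_cases hc : Z - (s'.reg 21 + 1) = 0
    · simp only [Prog.eval, State.set_reg, State.set_mem, e2, ez, n1, n2, n3, n4, g20, gm, hc, m2,
        n4.symm, n2.symm, Nat.reduceEqDiff, if_true, if_false, ne_eq, not_true_eq_false]
      refine ⟨by omega, by omega, ?_, by omega, fun _ => hZ0, trivial, fun j hj hjq => ?_⟩
      · rw [add_mul]; omega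
      · rw [if_neg (by omega), if_neg (by omega), if_neg (by omega), if_neg (by omega),
          if_neg (by omega), gr j hj hjq]
    · simp only [Prog.eval, State.set_reg, State.set_mem, e2, ez, n1, n2, n3, n4, g20, gm, hc, m2,
        n4.symm, n2.symm, Nat.reduceEqDiff, if_true, if_false, ne_eq, not_false_eq_true]
      refine ⟨by omega, by omega, by omega, by omega, fun _ => by omega, trivial,
          fun j hj hjq => ?_⟩
      rw [if_neg (by omega), if_neg (by omega), if_neg (by omega), gr j hj hjq]
  · have n1 : y ≠ 21 := by omega
    have n2 : q ≠ 21 := by omega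
    have n4 : q ≠ 20 := by omega
    have m5 : 5 ≠ q := by omega
    simp only [Prog.eval, State.set_reg, State.set_mem, n1, n2, n4, m5, hqy.symm, hY, h5,
      Nat.reduceEqDiff, if_true, if_false]
    refine ⟨by omega, le_rfl, by omega, by omega, fun h => h, trivial, fun j hj hjq => ?_⟩
    rw [if_neg (by omega), if_neg (by omega), if_neg (by omega)]
  · rintro _ - s' ⟨-, -, hdiv, hqi, hlt, gm, gr⟩
    refine ⟨gm, ?_, gr⟩
    rcases hYZ with hZ0 | rfl
    · rw [← hdiv, Nat.add_zero, mul_comm, Nat.mul_add_div hZ0, Nat.div_eq_of_lt (hlt hZ0), add_zero]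
    · rw [Nat.zero_div]
      omega

/-- `reg 8 := ⌈log₂ (reg 0)⌉` -/
def clog : Prog :=
  .const 8 0 ;; .const 18 1 ;; .add 20 0 5 ;; .loop 20 (.sub 21 0 18 ;;
    .ite 21 (.add 18 18 18 ;; .add 8 8 2) .skip ;; .sub 20 20 2)

theorem clog_le (n : ℕ) : Nat.clog 2 n ≤ n :=
  Nat.clog_le_of_le_pow (Nat.lt_two_pow_self).le

/-- A power of two is doubled as long as it is below `n`; `n` passes suffice by `clog_le`, and later
passes change nothing but the loop counter and scratch registers. -/
theorem clog_det {n : ℕ} (s : State) (h0 : s.reg 0 = n) (h2 : s.reg 2 = 1) (h5 : s.reg 5 = 0) :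
    Det clog s (11 * n + 7) fun s' => s'.mem = s.mem ∧ s'.reg 8 = Nat.clog 2 n ∧
      ∀ i < 18, i ≠ 8 → s'.reg i = s.reg i := by
  refine Sim.mono_time (t₁ := 1 + (1 + (1 + (n * (9 + 1) + 1) + 1) + 1) + 1) ?_ (by omega)
  refine Sim.seq_det (Det.straight trivial le_rfl rfl) ?_
  rintro _ rfl
  refine Sim.seq_det (Det.straight trivial le_rfl rfl) ?_
  rintro _ rfl
  refine Sim.seq_det (Det.straight trivial le_rfl rfl) ?_
  rintro _ rfl
  refine (Det.loop (fun i s' => s'.reg 20 = i ∧ i ≤ n ∧ s'.reg 8 = min (n - i) (Nat.clog 2 n) ∧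
    s'.reg 18 = 2 ^ s'.reg 8 ∧ s'.mem = s.mem ∧ ∀ i < 18, i ≠ 8 → s'.reg i = s.reg i)
    (fun i s h => h.1) ?_ n _ ?_).post ?_
  · rintro i s' ⟨g20, hi, g8, g18, gm, gr⟩
    refine Det.straight (by simp [Prog.Straight]) (by simp [Prog.cost]) ?_
    have e0 : s'.reg 0 = n := by rw [gr 0 (by omega) (by omega), h0]
    have e2 : s'.reg 2 = 1 := by rw [gr 2 (by omega) (by omega), h2]
    have hiff := Nat.lt_clog_iff_pow_lt (b := 2) (by decide) (x := n) (y := s'.reg 8)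
    rw [← g18] at hiff
    by_cases hc : n - s'.reg 18 = 0
    · have hc' : n - 2 ^ s'.reg 8 = 0 := by rwa [← g18]
      simp only [Prog.eval, State.set_reg, State.set_mem, e0, e2, g20, gm, hc', g18,
        Nat.reduceEqDiff, if_true, if_false, ne_eq, not_true_eq_false]
      refine ⟨by omega, by omega, by omega, trivial, trivial, fun j hj hjq => ?_⟩
      rw [if_neg (by omega), if_neg (by omega), gr j hj hjq]
    · have hc' : n - 2 ^ s'.reg 8 ≠ 0 := by rwa [← g18]
      simp only [Prog.eval, State.set_reg, State.set_mem, e0, e2, g20, gm, hc', g18,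
        Nat.reduceEqDiff, if_true, if_false, ne_eq, not_false_eq_true]
      refine ⟨by omega, by omega, by omega, by rw [pow_succ]; omega, trivial, fun j hj hjq => ?_⟩
      rw [if_neg (by omega), if_neg (by omega), if_neg (by omega), if_neg (by omega), gr j hj hjq]
  · simp only [Prog.eval, State.set_reg, State.set_mem, h0, h5,
      Nat.reduceEqDiff, if_true, if_false]
    refine ⟨by omega, le_rfl, by omega, by simp, trivial, fun j hj hjq => ?_⟩
    rw [if_neg (by omega), if_neg (by omega), if_neg (by omega)]
  · rintro _ - s' ⟨-, -, g8, -, gm, gr⟩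
    have := clog_le n
    exact ⟨gm, by omega, gr⟩

/-- The sizes of the layers: `1`, `B`, then `l` times `b`, and then `B`. -/
def layerSize (B b l i : ℕ) : ℕ :=
  if i = 0 then 1 else if i = 1 then B else if i ≤ l + 1 then b else B

/-- The first item of layer `i`. -/
def layerStart (B b l i : ℕ) : ℕ := ∑ j ∈ Finset.range i, layerSize B b l j

/-- The values of the items of the layers up to `i`; the value of an item is the sum of the values
of the previous layer, weighted with `A`. -/
def walk (A : ℕ → ℕ → ℤ) (f : ℕ → ℕ) : ℕ → ℕ → ℤ
  | 0 => fun v => if v = 0 then 1 else 0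
  | i + 1 => push A (f i) (f (i + 1)) (f (i + 1)) (f (i + 2)) (walk A f i)

/-- Takes the signs of the entries in `[c, d)`. -/
def sgnOn (c d : ℕ) (x : ℕ → ℤ) (v : ℕ) : ℤ := if c ≤ v ∧ v < d then sgn (x v) else x v

/-- From the values in `[g, h)`, the items of `[h, n)` are labelled by a majority vote, and these
labels determine those of the items of `[0, h)`. -/
def vote (A : ℕ → ℕ → ℤ) (g h n : ℕ) (x : ℕ → ℤ) : ℕ → ℤ :=
  push A h n 0 h (sgnOn h n (push A g h h n (sgnOn g h x)))

/-- Moves to the next layer, of size `reg z`. -/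
def advance (z : ℕ) : Prog :=
  (.add 12 10 5 ;; .add 10 11 5 ;; .add 11 11 z ;; .add 13 10 5 ;; .add 14 10 5 ;; .add 15 11 5) ;;
    round

/-- Computes the sizes of the layers and initializes the values. -/
def setup : Prog :=
  (.const 17 5 ;; .add 3 1 1 ;; .add 3 3 1 ;; .add 4 3 0 ;; .add 4 4 2 ;; .sub 18 0 2) ;;
  divide 6 18 17 ;; clog ;; divide 7 6 8 ;;
  (.const 10 0 ;; .const 11 1 ;; .store 3 2 ;; .add 16 8 5)

/-- The two majority votes. -/
def voting : Prog :=
  signs ;; (.add 12 10 5 ;; .add 13 11 5 ;; .add 14 11 5 ;; .add 15 0 5) ;; round ;; signs ;;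
  (.add 12 11 5 ;; .add 13 0 5 ;; .const 14 0 ;; .add 15 11 5) ;; round ;;
  .add 15 0 5 ;; signs ;; .add 0 3 5

/-- Thinning, the walk through the layers, and the votes. -/
def decoder : Prog :=
  .const 2 1 ;; thinning ;; setup ;;
  advance 6 ;; .loop 16 (advance 7 ;; .sub 16 16 2) ;; advance 6 ;; advance 6 ;; voting

/-- The state of the decoder when it has computed the values of the layer `i`. -/
def AtLayer (M : ℕ → ℕ) (m n B b l i : ℕ) (s : State) : Prop :=
  Dims m n s.reg ∧ s.reg 6 = B ∧ s.reg 7 = b ∧ s.reg 10 = layerStart B b l i ∧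
    s.reg 11 = layerStart B b l (i + 1) ∧
    Arr M m n (walk (answerMatrix M m) (layerStart B b l) i) s.mem

theorem layerStart_succ (B b l i : ℕ) :
    layerStart B b l (i + 1) = layerStart B b l i + layerSize B b l i :=
  Finset.sum_range_succ _ _

theorem advance_det {M : ℕ → ℕ} {m n B b l i z : ℕ} (s : State)
    (hM : ∀ j < m, M (3 * j) ≤ n ∧ M (3 * j + 1) ≤ n) (hs : AtLayer M m n B b l i s)
    (hz : s.reg z = layerSize B b l (i + 1)) (hz' : z = 6 ∨ z = 7)
    (hn : layerStart B b l (i + 2) ≤ n + 1) :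
    Det (advance z) s (110 * m + 13 * n + 50) fun s' => AtLayer M m n B b l (i + 1) s' ∧
      s'.reg 14 = s'.reg 10 ∧ s'.reg 15 = s'.reg 11 ∧ s'.reg 16 = s.reg 16 := by
  obtain ⟨hD, h6, h7, h10, h11, hA⟩ := hs
  refine Sim.mono_time (t₁ := 11 + (110 * m + 13 * n + 30) + 1) ?_ (by omega)
  refine Sim.seq_det (Det.straight (by simp [Prog.Straight]) (by simp [Prog.cost])
    (Q := fun s' => Dims m n s'.reg ∧ s'.reg 6 = B ∧ s'.reg 7 = b ∧
      s'.reg 10 = layerStart B b l (i + 1) ∧ s'.reg 11 = layerStart B b l (i + 2) ∧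
      Ends (layerStart B b l i) (layerStart B b l (i + 1)) (layerStart B b l (i + 1))
        (layerStart B b l (i + 2)) s'.reg ∧ s'.reg 16 = s.reg 16 ∧ s'.mem = s.mem) ?_) ?_
  · obtain ⟨h0, h1, h2, h3, h4, h5⟩ := hD
    have hz1 : z ≠ 10 := by omega
    have hz2 : z ≠ 12 := by omega
    simp only [Dims, Ends, Prog.eval, State.set_reg, State.set_mem, h0, h1, h2, h3, h4, h5, h6, h7,
      h10, h11, hz, hz1, hz2, Nat.reduceEqDiff, if_true, if_false, Nat.add_zero, true_and, and_true]
    rw [layerStart_succ B b l (i + 1), and_self]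
  rintro s₁ ⟨gD, g6, g7, g10, g11, gE, g16, gm⟩
  refine (round_det _ s₁ hM (fun t _ h1 h2 => by omega) hn gD gE (by rw [gm]; exact hA)).post ?_
  rintro _ - s₂ ⟨hr, hA₂⟩
  refine ⟨⟨gD.congr hr, ?_, ?_, ?_, ?_, hA₂⟩, ?_, ?_, ?_⟩
  · rw [hr 6 (by decide), g6]
  · rw [hr 7 (by decide), g7]
  · rw [hr 10 (by decide), g10]
  · rw [hr 11 (by decide), g11]
  · rw [hr 14 (by decide), hr 10 (by decide), gE.2.2.1, g10]
  · rw [hr 15 (by decide), hr 11 (by decide), gE.2.2.2, g11]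
  · rw [hr 16 (by decide), g16]

theorem voting_det {M : ℕ → ℕ} {m n B b l i : ℕ} (s : State)
    (hM : ∀ j < m, M (3 * j) ≤ n ∧ M (3 * j + 1) ≤ n) (hs : AtLayer M m n B b l i s)
    (h14 : s.reg 14 = s.reg 10) (h15 : s.reg 15 = s.reg 11) (hn : layerStart B b l (i + 1) ≤ n + 1) :
    Det voting s (220 * m + 100 * n + 200) fun s' => ∀ v < n, s'.mem (s'.reg 0 + v) =
      if 0 < vote (answerMatrix M m) (layerStart B b l i) (layerStart B b l (i + 1)) n
        (walk (answerMatrix M m) (layerStart B b l) i) v then 1 else 0 := by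
  obtain ⟨hD, h6, h7, h10, h11, hA⟩ := hs
  set g := layerStart B b l i with hg
  set h := layerStart B b l (i + 1) with hh
  set A := answerMatrix M m with hAA
  set x := walk A (layerStart B b l) i with hx
  have hD2 := hD
  obtain ⟨h0, h1, h2, h3, h4, h5⟩ := hD2
  refine Sim.mono_time (t₁ := (20 * (n + 1) + 6) + (7 + ((110 * m + 13 * n + 30) +
    ((20 * (n + 1) + 6) + (7 + ((110 * m + 13 * n + 30) + (1 + ((20 * (n + 1) + 6) + 1 + 1) + 1) + 1)
      + 1) + 1) + 1) + 1) + 1) ?_ (by omega)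
  refine Sim.seq_det (signs_det (a := s.reg 12) (b := s.reg 13) (c := g) (d := h) x hn s hD
    ⟨rfl, rfl, by rw [h14, h10], by rw [h15, h11]⟩ hA) ?_
  rintro s₁ ⟨r₁, A₁, -⟩
  refine Sim.seq_det (Det.straight (by simp [Prog.Straight]) (by simp [Prog.cost]) (Q := fun s' =>
    Dims m n s'.reg ∧ s'.reg 11 = h ∧ Ends g h h n s'.reg ∧ s'.mem = s₁.mem) ?_) ?_
  · simp only [Dims, Ends, Prog.eval, State.set_reg, State.set_mem, r₁ 0 (by decide),
      r₁ 1 (by decide), r₁ 2 (by decide), r₁ 3 (by decide), r₁ 4 (by decide), r₁ 5 (by decide),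
      r₁ 10 (by decide), r₁ 11 (by decide), h0, h1, h2, h3, h4, h5, h10, h11,
      Nat.reduceEqDiff, if_true, if_false, Nat.add_zero, and_true, and_self]
  rintro s₂ ⟨D₂, g₂, E₂, m₂⟩
  refine Sim.seq_det (round_det (sgnOn g h x) s₂ hM (fun t _ h1 h2 => by omega) (Nat.le_succ n) D₂ E₂
    (by rw [m₂]; exact A₁)) ?_
  rintro s₃ ⟨r₃, A₃⟩
  refine Sim.seq_det (signs_det _ (Nat.le_succ n) s₃ (D₂.congr r₃) (E₂.congr r₃) A₃) ?_
  rintro s₄ ⟨r₄, A₄, -⟩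
  have D₄ := (D₂.congr r₃).congr r₄
  have g₄ : s₄.reg 11 = h := by rw [r₄ 11 (by decide), r₃ 11 (by decide), g₂]
  refine Sim.seq_det (Det.straight (by simp [Prog.Straight]) (by simp [Prog.cost]) (Q := fun s' =>
    Dims m n s'.reg ∧ Ends h n 0 h s'.reg ∧ s'.mem = s₄.mem) ?_) ?_
  · obtain ⟨h0, h1, h2, h3, h4, h5⟩ := D₄
    simp only [Dims, Ends, Prog.eval, State.set_reg, State.set_mem, h0, h1, h2, h3, h4, h5, g₄,
      Nat.reduceEqDiff, if_true, if_false, Nat.add_zero, and_true, and_self]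
  rintro s₅ ⟨D₅, E₅, m₅⟩
  refine Sim.seq_det (round_det (sgnOn h n (push A g h h n (sgnOn g h x))) s₅ hM
    (fun t _ h1 h2 => by omega) hn D₅ E₅ (by rw [m₅]; exact A₄)) ?_
  rintro s₆ ⟨r₆, A₆⟩
  have D₆ := D₅.congr r₆
  have E₆ := E₅.congr r₆
  refine Sim.seq_det (Det.straight (by simp [Prog.Straight]) (by simp [Prog.cost]) (Q := fun s' =>
    Dims m n s'.reg ∧ Ends h n 0 n s'.reg ∧ s'.mem = s₆.mem) ?_) ?_
  · obtain ⟨h0, h1, h2, h3, h4, h5⟩ := D₆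
    obtain ⟨k1, k2, k3, k4⟩ := E₆
    simp only [Dims, Ends, Prog.eval, State.set_reg, State.set_mem, h0, h1, h2, h3, h4, h5, k1, k2,
      k3, Nat.reduceEqDiff, if_true, if_false, Nat.add_zero, and_true, and_self]
  rintro s₇ ⟨D₇, E₇, m₇⟩
  refine Sim.seq_det_le (t₂ := 1) (signs_det _ (Nat.le_succ n) s₇ D₇ E₇ (by rw [m₇]; exact A₆)) ?_
    (by omega)
  rintro s₈ ⟨r₈, -, o₈⟩
  obtain ⟨k0, k1, k2, k3, k4, k5⟩ := D₇.congr r₈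
  refine Det.straight trivial le_rfl fun v hv => ?_
  simp only [Prog.eval, State.set_reg, State.set_mem, if_true, k3, k5, Nat.add_zero]
  exact o₈ v (Nat.zero_le v) hv

theorem setup_det {M : ℕ → ℕ} {m n : ℕ} (s : State) (h0 : s.reg 0 = n) (h1 : s.reg 1 = m)
    (h2 : s.reg 2 = 1) (h5 : s.reg 5 = 0) (hmem : s.mem = M) (hM : ∀ a, 3 * m ≤ a → M a = 0) :
    Det setup s (60 * n + 60) fun s' =>
      AtLayer M m n ((n - 1) / 5) ((n - 1) / 5 / Nat.clog 2 n) (Nat.clog 2 n) 0 s' ∧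
        s'.reg 16 = Nat.clog 2 n := by
  have hB : (n - 1) / 5 ≤ n := (Nat.div_le_self _ _).trans (by omega)
  refine Sim.mono_time (t₁ := 11 + ((16 * (n - 1) + 7) + ((11 * n + 7) +
    ((16 * ((n - 1) / 5) + 7) + 7 + 1) + 1) + 1) + 1) ?_ (by omega)
  refine Sim.seq_det (Det.straight (by simp [Prog.Straight]) (by simp [Prog.cost]) (Q := fun s' =>
    Dims m n s'.reg ∧ s'.reg 17 = 5 ∧ s'.reg 18 = n - 1 ∧ s'.mem = s.mem) ?_) ?_
  · simp only [Dims, Prog.eval, State.set_reg, State.set_mem, h0, h1, h2, h5,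
      Nat.reduceEqDiff, if_true, if_false, true_and, and_true]
    omega
  rintro s₁ ⟨D₁, a17, a18, m₁⟩
  refine Sim.seq_det (divide_det s₁ D₁.2.2.1 D₁.2.2.2.2.2 (by decide) (by decide) (by decide)
    (by decide) (by decide) (by decide) a18 a17 (Or.inl (by norm_num))) ?_
  rintro s₂ ⟨m₂, q₂, r₂⟩
  have D₂ : Dims m n s₂.reg := by
    simp only [Dims, r₂ 0 (by decide) (by decide), r₂ 1 (by decide) (by decide),
      r₂ 2 (by decide) (by decide), r₂ 3 (by decide) (by decide), r₂ 4 (by decide) (by decide),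
      r₂ 5 (by decide) (by decide)]
    exact D₁
  refine Sim.seq_det (clog_det s₂ D₂.1 D₂.2.2.1 D₂.2.2.2.2.2) ?_
  rintro s₃ ⟨m₃, q₃, r₃⟩
  have D₃ : Dims m n s₃.reg := by
    simp only [Dims, r₃ 0 (by decide) (by decide), r₃ 1 (by decide) (by decide),
      r₃ 2 (by decide) (by decide), r₃ 3 (by decide) (by decide), r₃ 4 (by decide) (by decide),
      r₃ 5 (by decide) (by decide)]
    exact D₂
  have e6 : s₃.reg 6 = (n - 1) / 5 := by rw [r₃ 6 (by decide) (by decide), q₂]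
  have hdiv : 0 < Nat.clog 2 n ∨ (n - 1) / 5 = 0 := by
    by_cases hn : n ≤ 1
    · right; omega
    · left; exact Nat.clog_pos (by decide) (by omega)
  refine Sim.seq_det_le (t₂ := 7) (divide_det (q := 7) (y := 6) (z := 8) s₃ D₃.2.2.1 D₃.2.2.2.2.2
    (by decide) (by decide) (by decide) (by decide) (by decide) (by decide) e6 q₃ hdiv) ?_ (by omega)
  rintro s₄ ⟨m₄, q₄, r₄⟩
  refine Det.straight (by simp [Prog.Straight]) (by simp [Prog.cost]) ?_
  obtain ⟨k0, k1, k2, k3, k4, k5⟩ := D₃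
  have hm4 : s₄.mem = M := by rw [m₄, m₃, m₂, m₁, hmem]
  simp only [AtLayer, Dims, Prog.eval, State.set_reg, State.set_mem, State.put_reg, State.put,
    r₄ 0 (by decide) (by decide), r₄ 1 (by decide) (by decide),
    r₄ 2 (by decide) (by decide), r₄ 3 (by decide) (by decide), r₄ 4 (by decide) (by decide),
    r₄ 5 (by decide) (by decide), r₄ 6 (by decide) (by decide), r₄ 8 (by decide) (by decide),
    k0, k1, k2, k3, k4, k5, e6, q₃, q₄, hm4, Nat.reduceEqDiff, if_true, if_false, and_true,
    true_and, Nat.add_zero]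
  refine ⟨by simp [layerStart], by simp [layerStart, layerSize], fun a ha => ?_, fun v hv => ?_⟩
  · rw [Function.update_of_ne (by omega)]
  · rw [Function.update_of_ne (a := 3 * m + (n + 1) + v) (by omega), hM _ (by omega)]
    by_cases hv0 : v = 0
    · subst hv0; simp [walk]
    · rw [Function.update_of_ne (by omega), hM _ (by omega)]
      simp [walk, hv0]

theorem layerStart_add_two (B b l i : ℕ) (hi : i ≤ l) : layerStart B b l (i + 2) = 1 + B + i * b := by
  induction i with
  | zero => simp [layerStart, layerSize, Finset.sum_range_succ]
  | succ i ih =>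
    rw [show i + 1 + 2 = (i + 2) + 1 by ring, layerStart_succ, ih (by omega), layerSize,
      if_neg (by omega), if_neg (by omega), if_pos (by omega)]
    ring

theorem layerStart_last (B b l : ℕ) : layerStart B b l (l + 3) = 1 + B + l * b + B ∧
    layerStart B b l (l + 4) = 1 + B + l * b + B + B := by
  have h1 : layerStart B b l (l + 3) = 1 + B + l * b + B := by
    rw [layerStart_succ, layerStart_add_two B b l l le_rfl, layerSize,
      if_neg (by omega), if_neg (by omega), if_neg (by omega)]
  refine ⟨h1, ?_⟩
  rw [layerStart_succ, h1, layerSize, if_neg (by omega), if_neg (by omega), if_neg (by omega)]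

theorem layerStart_mono (B b l : ℕ) : Monotone (layerStart B b l) :=
  monotone_nat_of_le_succ fun i => by rw [layerStart_succ]; omega

/-- The values from which the decoder computes its labels, for the matrix `A` of the answers. -/
def decode (A : ℕ → ℕ → ℤ) (n : ℕ) : ℕ → ℤ :=
  let B := (n - 1) / 5
  let l := Nat.clog 2 n
  let f := layerStart B (B / l) l
  vote A (f (l + 3)) (f (l + 4)) n (walk A f (l + 3))

/-- A bound for the running time of the decoder. -/
def decoderTime (n m : ℕ) : ℕ :=
  20 * n.choose 2 + (n + 3) * (110 * m + 13 * n + 60) + 250 * m + 164 * n + 320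

theorem decoder_sim {n m : ℕ} (M : ℕ → ℕ) (hM : ∀ j < m, M (3 * j) ≤ n ∧ M (3 * j + 1) ≤ n)
    (hM0 : ∀ a, 3 * m ≤ a → M a = 0) :
    Sim decoder ⟨(decoder.start n m M).reg, M⟩ (decoderTime n m) (thinLaw (n.choose 2) m)
      fun S s => ∀ v < n, s.mem (s.reg 0 + v) =
        if 0 < decode (answerMatrix (thin M m S) m) n v then 1 else 0 := by
  set N := n.choose 2 with hN
  set B := (n - 1) / 5 with hB
  set l := Nat.clog 2 n with hl
  set Ta := 110 * m + 13 * n + 50 with hTa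
  have hlb : l * (B / l) ≤ B := Nat.mul_div_le B l
  -- The bound is `n + 1` and not `n` because item `0` is a layer even for `n = 0`. This is why the
  -- arrays have `n + 1` entries.
  have htop : layerStart B (B / l) l (l + 4) ≤ n + 1 := by
    rw [(layerStart_last _ _ _).2]; omega
  have hle : ∀ i ≤ l + 4, layerStart B (B / l) l i ≤ n + 1 := fun i hi =>
    (layerStart_mono _ _ _ hi).trans htop
  have hln : l * (Ta + 2 + 1) ≤ n * (Ta + 3) := Nat.mul_le_mul_right _ (clog_le n)
  refine Sim.mono_time (t₁ := 1 + ((4 * n + 20 * N + 30 * m + 30) + ((60 * n + 60) + (Ta +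
    ((l * (Ta + 2 + 1) + 1) + (Ta + (Ta + (220 * m + 100 * n + 200) + 1) + 1) + 1) + 1) + 1) + 1) + 1)
    ?_ ?_
  swap
  · have e : (n + 3) * (110 * m + 13 * n + 60) = n * (Ta + 3) + 7 * n + 3 * (110 * m + 13 * n + 60) := by
      rw [hTa]; ring
    rw [decoderTime, e]
    omega
  refine Sim.seq_det (Det.straight trivial le_rfl rfl) ?_
  rintro _ rfl
  have hpure : thinLaw N m = (thinLaw N m).bind PMF.pure := (PMF.bind_pure _).symm
  rw [hpure]
  refine Sim.seq (thinning_sim (n := n) _ ?_ ?_ ?_ ?_ fun i hi => ?_) fun S _ s hs => ?_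
  iterate 4 simp [Prog.eval, State.set_reg, Prog.start]
  · simp only [Prog.eval, State.set_reg, Prog.start]
    rw [if_neg (by omega), if_neg (by omega), if_neg (by omega)]
  obtain ⟨hr, hm⟩ := hs
  simp only [Prog.eval, State.set_reg, Prog.start, State.set_mem] at hr hm
  set M' := thin M m S with hM'
  have hM1 : ∀ j < m, M' (3 * j) ≤ n ∧ M' (3 * j + 1) ≤ n := by
    intro j hj
    simp only [hM', thin]
    rw [if_neg (by omega)]
    refine ⟨(hM j hj).1, ?_⟩
    split_ifs
    · exact (hM j hj).1
    · exact (hM j hj).2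
  have hM2 : ∀ a, 3 * m ≤ a → M' a = 0 := fun a ha => by
    rw [hM', thin, if_neg (by omega), hM0 a ha]
  refine Det.sim (Q := fun s => ∀ v < n, s.mem (s.reg 0 + v) =
        if 0 < decode (answerMatrix M' m) n v then 1 else 0) ?_ S fun _ h => h
  refine Sim.seq_det (setup_det (M := M') (m := m) (n := n) s ?_ ?_ ?_ ?_ hm hM2) ?_
  iterate 4 simp [hr]
  rintro s₀ ⟨h₀, k₀⟩
  refine Sim.seq_det (advance_det s₀ hM1 h₀ (by rw [h₀.2.1]; simp [layerSize]) (Or.inl rfl)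
    (hle _ (by omega))) ?_
  rintro s₁ ⟨h₁, a₁, b₁, k₁⟩
  refine Sim.seq_det (Det.loop (x := 16) (t := Ta + 2) (fun i s => s.reg 16 = i ∧ i ≤ l ∧
    AtLayer M' m n B (B / l) l (l - i + 1) s) (fun i s h => h.1) ?_ l _ ?_) ?_
  · rintro i s' ⟨g16, hi, hA⟩
    refine Sim.seq_det (advance_det s' hM1 hA ?_ (Or.inr rfl) (hle _ (by omega))) ?_
    · rw [hA.2.2.1, layerSize, if_neg (by omega), if_neg (by omega), if_pos (by omega)]
    rintro s'' ⟨hA', a, b, k⟩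
    refine Det.straight trivial le_rfl ?_
    obtain ⟨⟨h0, h1, h2, h3, h4, h5⟩, h6, h7, h10, h11, hArr⟩ := hA'
    rw [show l - (i + 1) + 1 + 1 = l - i + 1 by omega] at *
    simp only [AtLayer, Dims, Prog.eval, State.set_reg, State.set_mem, h0, h1, h2, h3, h4, h5, h6,
        h7,
      h10, h11, k, g16, hArr, if_true, if_false, Nat.reduceEqDiff, and_true, true_and]
    exact ⟨by omega, by omega⟩
  · exact ⟨by rw [k₁, k₀], le_rfl, by simpa using h₁⟩
  rintro s₂ ⟨-, -, h₂⟩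
  rw [Nat.sub_zero] at h₂
  have hsz : ∀ i, l + 1 < i → layerSize B (B / l) l i = B := fun i hi => by
    rw [layerSize, if_neg (by omega), if_neg (by omega), if_neg (by omega)]
  refine Sim.seq_det (advance_det s₂ hM1 h₂ (by rw [h₂.2.1, hsz _ (by omega)]) (Or.inl rfl)
    (hle _ (by omega))) ?_
  rintro s₃ ⟨h₃, a₃, b₃, k₃⟩
  refine Sim.seq_det (advance_det s₃ hM1 h₃ (by rw [h₃.2.1, hsz _ (by omega)]) (Or.inl rfl)
    (hle _ (by omega))) ?_
  rintro s₄ ⟨h₄, a₄, b₄, k₄⟩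
  exact voting_det s₄ hM1 h₄ a₄ b₄ (hle _ (by omega))

/-! ### The decoder as a function of the set of kept pairs -/

/-- Disjoint source and target intervals never meet the diagonal. Hence void queries, which only
touch diagonal entries, have no influence, and the model may put anything on the diagonal. -/
theorem push_congr {A A' : ℕ → ℕ → ℤ} (h : ∀ t w, t ≠ w → A t w = A' t w) {a b c d : ℕ}
    (hdis : ∀ t, a ≤ t → t < b → c ≤ t → d ≤ t) (x : ℕ → ℤ) :
    push A a b c d x = push A' a b c d x := by
  funext t
  unfold push
  split_ifs with ht
  · refine Finset.sum_congr rfl fun w hw => ?_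
    rw [Finset.mem_Ico] at hw
    rw [h t w]
    rintro rfl
    have := hdis t hw.1 hw.2 ht.1
    omega
  · rfl

theorem walk_congr {A A' : ℕ → ℕ → ℤ} (h : ∀ t w, t ≠ w → A t w = A' t w) (f : ℕ → ℕ) (i : ℕ) :
    walk A f i = walk A' f i := by
  induction i with
  | zero => rfl
  | succ i ih => rw [walk, walk, ih, push_congr h fun t _ _ _ => by omega]

theorem vote_congr {A A' : ℕ → ℕ → ℤ} (h : ∀ t w, t ≠ w → A t w = A' t w) (a b n : ℕ) (x : ℕ → ℤ) :
    vote A a b n x = vote A' a b n x := by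
  rw [vote, vote, push_congr (a := a) h fun t _ _ _ => by omega,
    push_congr (a := b) h fun t _ _ _ => by omega]

theorem decode_congr {A A' : ℕ → ℕ → ℤ} (h : ∀ t w, t ≠ w → A t w = A' t w) (n : ℕ) :
    decode A n = decode A' n := by
  rw [decode, decode, walk_congr h, vote_congr h]

/-- The matrix of the answers to the queries in `G`. -/
def signed {n : ℕ} (G : Finset (Sym2 ℕ)) (τ : Sym2 (Fin n) → ℤˣ) (t w : ℕ) : ℤ :=
  if h : t < n ∧ w < n then (if s(t, w) ∈ G then (τ s(⟨t, h.1⟩, ⟨w, h.2⟩) : ℤ) else 0) else 0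

/-- The labels that are computed from the answers to the queries in `G`. -/
def label {n : ℕ} (τ : Sym2 (Fin n) → ℤˣ) (G : Finset (Sym2 ℕ)) (v : Fin n) : ℕ :=
  if 0 < decode (signed G τ) n v then 1 else 0

theorem sign_answer {n : ℕ} (τ : Sym2 (Fin n) → ℤˣ) {u v : ℕ} (h : u < n ∧ v < n) :
    sign (answer τ u v) = (τ s(⟨u, h.1⟩, ⟨v, h.2⟩) : ℤ) := by
  rw [answer, dif_pos h]
  rcases Int.units_eq_one_or (τ s(⟨u, h.1⟩, ⟨v, h.2⟩)) with h1 | h1 <;> simp [h1, sign]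

/-- A pair is queried at most once (`hinj`), so at most one kept query contributes to an
off-diagonal entry; a rejected query has two equal items and contributes to none. -/
theorem answerMatrix_thin {n m : ℕ} (q : ℕ → ℕ × ℕ) (τ : Sym2 (Fin n) → ℤˣ) (S : Finset ℕ)
    (hS : S ⊆ Finset.range m) (hq : ∀ j < m, (q j).1 < n ∧ (q j).2 < n)
    (hinj : Set.InjOn (fun j => s((q j).1, (q j).2)) (Finset.range m)) (M : ℕ → ℕ)
    (hM : ∀ j < m, M (3 * j) = (q j).1 ∧ M (3 * j + 1) = (q j).2 ∧
      M (3 * j + 2) = answer τ (q j).1 (q j).2) (t w : ℕ) (htw : t ≠ w) :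
    answerMatrix (thin M m S) m t w = signed (S.image fun j => s((q j).1, (q j).2)) τ t w := by
  have hterm : ∀ j ∈ Finset.range m,
      ((if thin M m S (3 * j + 1) = t ∧
          thin M m S (3 * j) = w then sign (thin M m S (3 * j + 2)) else 0) +
      if thin M m S (3 * j) = t ∧
          thin M m S (3 * j + 1) = w then sign (thin M m S (3 * j + 2)) else 0) =
      if j ∈ S then (if s((q j).1, (q j).2) = s(t, w) then sign (answer τ (q j).1 (q j).2) else 0)
        else 0 := by
    intro j hj
    have hj' := Finset.mem_range.1 hj
    obtain ⟨h0, h1, h2⟩ := hM j hj'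
    have e0 : thin M m S (3 * j) = (q j).1 := by rw [thin, if_neg (by omega), h0]
    have e2 : thin M m S (3 * j + 2) = answer τ (q j).1 (q j).2 := by
      rw [thin, if_neg (by omega), h2]
    have e : (3 * j + 1) / 3 = j := by omega
    rw [e0, e2]
    by_cases hjS : j ∈ S
    · have e1 : thin M m S (3 * j + 1) = (q j).2 := by
        rw [thin, e, if_neg (by simp [hjS]), h1]
      rw [e1, if_pos hjS]
      simp only [Sym2.eq_iff]
      by_cases ha : (q j).1 = t ∧ (q j).2 = w
      · rw [if_neg (by omega), if_pos ha, if_pos (Or.inl ha), zero_add]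
      · by_cases hb : (q j).2 = t ∧ (q j).1 = w
        · rw [if_pos hb, if_neg (by omega), if_pos (Or.inr ⟨hb.2, hb.1⟩), add_zero]
        · rw [if_neg hb, if_neg ha, if_neg (by omega), add_zero]
    · have e1 : thin M m S (3 * j + 1) = (q j).1 := by
        rw [thin, e, if_pos ⟨by omega, hj', hjS⟩, Nat.add_sub_cancel, h0]
      rw [e1, if_neg hjS, if_neg (by omega), add_zero]
  rw [answerMatrix, Finset.sum_congr rfl hterm, ← Finset.sum_filter, Finset.filter_mem_eq_inter,
    Finset.inter_eq_right.2 hS]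
  by_cases hmem : s(t, w) ∈ S.image fun j => s((q j).1, (q j).2)
  · obtain ⟨j, hj, hjtw⟩ := Finset.mem_image.1 hmem
    have hjm := Finset.mem_range.1 (hS hj)
    have hq' := hq j hjm
    rw [Finset.sum_eq_single j]
    · rw [if_pos hjtw, sign_answer τ hq']
      rcases Sym2.eq_iff.1 hjtw with ⟨h1, h2⟩ | ⟨h1, h2⟩
      · have h : t < n ∧ w < n := by rw [← h1, ← h2]; exact hq'
        rw [signed, dif_pos h, if_pos hmem]
        simp only [h1, h2]
      · have h : t < n ∧ w < n := by rw [← h1, ← h2]; exact hq'.symm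
        rw [signed, dif_pos h, if_pos hmem, Sym2.eq_swap]
        simp only [h1, h2]
    · intro i hi hij
      rw [if_neg]
      intro h
      exact hij (hinj (hS hi) (hS hj) (h.trans hjtw.symm))
    · exact fun h => absurd hj h
  · rw [Finset.sum_eq_zero, signed]
    · split_ifs <;> rfl
    · intro j hj
      rw [if_neg]
      exact fun h => hmem (h ▸ Finset.mem_image_of_mem _ hj)

/-! ### Running time of the algorithm and law of its output -/

/-- The algorithm. -/
def algorithm : Algorithm := ⟨sampler, decoder⟩

/-- A polynomial that bounds the running times. -/
def timeBound : Polynomial ℕ := Polynomial.C 1000 * (Polynomial.X + 1) ^ 3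

theorem choose_two_le (n : ℕ) : n.choose 2 ≤ n ^ 2 := Nat.choose_le_pow n 2

theorem sampler_time_le (n : ℕ) : 4 * n + 40 * n.choose 2 + 20 ≤ timeBound.eval n := by
  have := choose_two_le n
  simp only [timeBound, Polynomial.eval_mul, Polynomial.eval_C, Polynomial.eval_pow,
    Polynomial.eval_add, Polynomial.eval_X, Polynomial.eval_one]
  have e : 1000 * (n + 1) ^ 3 = 1000 * n ^ 3 + 3000 * n ^ 2 + 3000 * n + 1000 := by ring
  omega

/-- The dominant cost is that of the passes over the `m ≤ n ^ 2` queries, whose number is bounded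
crudely by `n` up to a constant; this gives the cubic bound. -/
theorem decoder_time_le {n m : ℕ} (hm : m ≤ n.choose 2) : decoderTime n m ≤ timeBound.eval n := by
  have := choose_two_le n
  simp only [timeBound, Polynomial.eval_mul, Polynomial.eval_C, Polynomial.eval_pow,
    Polynomial.eval_add, Polynomial.eval_X, Polynomial.eval_one, decoderTime]
  have e : 1000 * (n + 1) ^ 3 = 1000 * n ^ 3 + 3000 * n ^ 2 + 3000 * n + 1000 := by ring
  have h : (n + 3) * (110 * m + 13 * n + 60) ≤ (n + 3) * (110 * n ^ 2 + 13 * n + 60) :=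
    Nat.mul_le_mul_left _ (by omega)
  have e2 : (n + 3) * (110 * n ^ 2 + 13 * n + 60) = 110 * n ^ 3 + 343 * n ^ 2 + 99 * n + 180 := by ring
  omega

/-- The queries are distinct pairs of items. -/
def ValidQueries (n m : ℕ) (q : ℕ → ℕ × ℕ) : Prop :=
  (∀ j < m, (q j).1 < n ∧ (q j).2 < n) ∧
    Set.InjOn (fun j => s((q j).1, (q j).2)) (Finset.range m)

theorem mem_support_pick {n m : ℕ} (hm : m ≤ n.choose 2) {S : Finset ℕ}
    (hS : S ∈ (iter (pickStep (n.choose 2) m) (n.choose 2) ∅).support) :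
    S ⊆ Finset.range (n.choose 2) ∧ S.card = m := by
  rw [iter_pickStep hm, PMF.support_uniformOfFinset] at hS
  exact Finset.mem_powersetCard.1 hS

/-- That no pair is queried twice follows by counting: `S.card` queries have an image with `S.card`
elements. -/
theorem stored_query {n : ℕ} {S : Finset ℕ} {s : State} (h0 : s.reg 0 = 0) (h : Stored n S s.mem) :
    querySet S.card (s.conf []) = S.image symAt ∧ ValidQueries n S.card (query (s.conf [])) := by
  have hq : ∀ i, query (s.conf []) i = (s.mem (2 * i), s.mem (2 * i + 1)) := fun i => by
    simp [query, Config.out, State.conf, h0]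
  have h1 : querySet S.card (s.conf []) = S.image symAt := by
    rw [querySet, ← h.1]
    simp only [hq]
  refine ⟨h1, fun j hj => by rw [hq]; exact h.2 j hj, ?_⟩
  rw [← Finset.card_image_iff, Finset.card_range]
  have h2 := congrArg Finset.card h1
  rw [Finset.card_image_of_injective _ symAt_injective] at h2
  exact h2

theorem validQueries_of_mem_support {n m T : ℕ} (hm : m ≤ n.choose 2)
    (hT : 4 * n + 40 * n.choose 2 + 20 ≤ T) {c : Config}
    (hc : c ∈ ((algorithm.samplerStart n m).run T).support) : ValidQueries n m (query c) := by
  obtain ⟨S, hS, s, ⟨h0, hst⟩, rfl⟩ := (sampler_sim n m hm).of_mem_support hT hc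
  rw [← (mem_support_pick hm hS).2]
  exact (stored_query h0 hst).2

theorem map_querySet {n m T : ℕ} (hm : m ≤ n.choose 2) (hT : 4 * n + 40 * n.choose 2 + 20 ≤ T) :
    ((algorithm.samplerStart n m).run T).map (querySet m) =
      PMF.uniformOfFinset (Finset.powersetCard m (pairs n)) (powersetCard_pairs_nonempty hm) := by
  have h := (sampler_sim n m hm).run_start hT (querySet m) (fun S => S.image symAt) ?_
  · refine h.trans ?_
    rw [iter_pickStep hm]
    refine uniformOfFinset_map _ _ (image_injOn_powersetCard _ _ _ symAt_injective.injOn) _ _ ?_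
    rw [image_powersetCard_image _ _ _ symAt_injective.injOn, image_symAt]
  · rintro S hS s ⟨h0, hst⟩
    rw [← (mem_support_pick hm hS).2]
    exact (stored_query h0 hst).1

/-- The initial memory of the decoder. -/
def decoderMem {n : ℕ} (m : ℕ) (q : ℕ → ℕ × ℕ) (τ : Sym2 (Fin n) → ℤˣ) : ℕ → ℕ :=
  (algorithm.decoderStart m q τ).mem

theorem decoderMem_spec {n m : ℕ} (q : ℕ → ℕ × ℕ) (τ : Sym2 (Fin n) → ℤˣ) :
    (∀ j < m, decoderMem m q τ (3 * j) = (q j).1 ∧ decoderMem m q τ (3 * j + 1) = (q j).2 ∧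
      decoderMem m q τ (3 * j + 2) = answer τ (q j).1 (q j).2) ∧
    ∀ a, 3 * m ≤ a → decoderMem m q τ a = 0 := by
  constructor
  · intro j hj
    have e0 : 3 * j / 3 = j := by omega
    have e1 : (3 * j + 1) / 3 = j := by omega
    have e2 : (3 * j + 2) / 3 = j := by omega
    refine ⟨?_, ?_, ?_⟩
    · simp only [decoderMem, Algorithm.decoderStart, Prog.start]
      rw [if_pos (by omega), if_pos (by omega), e0]
    · simp only [decoderMem, Algorithm.decoderStart, Prog.start]
      rw [if_pos (by omega), if_neg (by omega), if_pos (by omega), e1]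
    · simp only [decoderMem, Algorithm.decoderStart, Prog.start]
      rw [if_pos (by omega), if_neg (by omega), if_neg (by omega), e2]
  · intro a ha
    simp only [decoderMem, Algorithm.decoderStart, Prog.start]
    rw [if_neg (by omega)]

theorem decoder_sim_query {n m : ℕ} {q : ℕ → ℕ × ℕ} (hq : ValidQueries n m q)
    (τ : Sym2 (Fin n) → ℤˣ) :
    Sim decoder ⟨(decoder.start n m (decoderMem m q τ)).reg, decoderMem m q τ⟩ (decoderTime n m)
      (thinLaw (n.choose 2) m) fun S s => ∀ v < n, s.mem (s.reg 0 + v) =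
        if 0 < decode (answerMatrix (thin (decoderMem m q τ) m S) m) n v then 1 else 0 := by
  have hs := decoderMem_spec (m := m) q τ
  refine decoder_sim _ (fun j hj => ?_) hs.2
  rw [(hs.1 j hj).1, (hs.1 j hj).2.1]
  exact ⟨(hq.1 j hj).1.le, (hq.1 j hj).2.le⟩

theorem runsWithin {n m : ℕ} (hm : m ≤ n.choose 2) :
    algorithm.RunsWithin n m (timeBound.eval n) := by
  refine ⟨(sampler_sim n m hm).haltsWithin (sampler_time_le n), fun c hc τ => ?_⟩
  exact (decoder_sim_query (validQueries_of_mem_support hm (sampler_time_le n) hc) τ).haltsWithin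
    (decoder_time_le hm)

/-- The law of the set of the queries that are kept, given the set of all queries. -/
def keptLaw (N m : ℕ) (Q : Finset (Sym2 ℕ)) : PMF (Finset (Sym2 ℕ)) :=
  (iter (countStep (2 * N - 1) m) N 0).bind fun k =>
    if h : (Q.powersetCard (min k m)).Nonempty then PMF.uniformOfFinset _ h else PMF.pure ∅

theorem PMF.map_congr_support {α β : Type} (μ : PMF α) (f g : α → β)
    (h : ∀ a ∈ μ.support, f a = g a) : μ.map f = μ.map g :=
  PMF.bind_congr_support _ _ _ fun a ha => by simp only [Function.comp, h a ha]

/-- The injective map from indices to queried pairs carries a uniform set of indices to a uniform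
set of pairs. Thus the labels depend on the sampler only through the set of its queries, not through
their order. -/
theorem decoder_law {n m T : ℕ} (hT : decoderTime n m ≤ T) {c : Config}
    (hc : ValidQueries n m (query c)) (τ : Sym2 (Fin n) → ℤˣ) :
    (((algorithm.decoderStart m (query c) τ).run T).map
      fun c' (v : Fin n) => c'.out v) =
      (keptLaw (n.choose 2) m (querySet m c)).map (label τ) := by
  have hs := decoderMem_spec (m := m) (query c) τ
  have h := (decoder_sim_query hc τ).run_start hT
    (fun c' (v : Fin n) => c'.out v)
    (fun S => fun v : Fin n => if 0 < decode (answerMatrix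
      (thin (decoderMem m (query c) τ) m S) m) n v then 1 else 0) ?_
  swap
  · intro S _ s hs'
    funext v
    exact hs' v v.2
  have e : algorithm.decoderStart m (query c) τ = decoder.start n m (decoderMem m (query c) τ) := rfl
  rw [e, h, thinLaw, keptLaw, PMF.map_bind, PMF.map_bind]
  refine PMF.bind_congr_support _ _ _ fun k _ => ?_
  have hQ : (querySet m c) = (Finset.range m).image fun j => s((query c j).1, (query c j).2) := rfl
  have hcard : (querySet m c).card = m := by
    rw [hQ, Finset.card_image_of_injOn hc.2, Finset.card_range]
  have hne : ((querySet m c).powersetCard (min k m)).Nonempty :=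
    Finset.powersetCard_nonempty.2 (by omega)
  rw [iter_pickStep (min_le_right k m), dif_pos hne]
  rw [← uniformOfFinset_map (Finset.powersetCard_nonempty.2 (by simp)) _
    (image_injOn_powersetCard (min k m) (Finset.range m) _ hc.2) _ hne
    (by rw [image_powersetCard_image _ _ _ hc.2, hQ]), PMF.map_comp]
  refine PMF.map_congr_support _ _ _ fun S hS => ?_
  rw [PMF.support_uniformOfFinset] at hS
  have hS' := (Finset.mem_powersetCard.1 hS).1
  have hdec := decode_congr (fun t w htw =>
    answerMatrix_thin (query c) τ S hS' hc.1 hc.2 _ hs.1 t w htw) n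
  funext v
  rw [hdec]
  rfl

theorem output_eq {n m : ℕ} (hm : m ≤ n.choose 2) (τ : Sym2 (Fin n) → ℤˣ) :
    algorithm.output m (timeBound.eval n) τ =
      ((PMF.uniformOfFinset (Finset.powersetCard m (pairs n)) (powersetCard_pairs_nonempty hm)).bind
        (keptLaw (n.choose 2) m)).map (label τ) := by
  rw [Algorithm.output, PMF.bind_congr_support _ _
    (fun c => (keptLaw (n.choose 2) m (querySet m c)).map (label τ)) fun c hc =>
    decoder_law (decoder_time_le hm) (validQueries_of_mem_support hm (sampler_time_le n) hc) τ,
    ← map_querySet hm (sampler_time_le n), PMF.bind_map, PMF.map_bind]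
  rfl

/-- Only the counter value `G.card` is used: its binomial weight times `1 / (n.choose 2).choose
G.card`, the probability that a random subset of a random `m`-set is `G`, is the left side.
Truncation at `m` can only add mass, and only if `G.card = m`. -/
theorem kept_lower_bound {n m : ℕ} (hm : m ≤ n.choose 2) {G : Finset (Sym2 ℕ)} (hG : G ⊆ pairs n)
    (hGm : G.card ≤ m) :
    ((m : ENNReal) / (2 * n.choose 2 - 1 + 1 : ℕ)) ^ G.card *
        (((2 * n.choose 2 - 1 + 1 - m : ℕ) : ENNReal) / (2 * n.choose 2 - 1 + 1 : ℕ)) ^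
          (n.choose 2 - G.card) ≤
      ((PMF.uniformOfFinset (Finset.powersetCard m (pairs n)) (powersetCard_pairs_nonempty hm)).bind
        (keptLaw (n.choose 2) m)) G := by
  have hcard := card_pairs n
  have hGN : G.card ≤ n.choose 2 := hGm.trans hm
  unfold keptLaw
  rw [PMF.bind_comm, PMF.bind_apply]
  refine le_trans ?_ (ENNReal.le_tsum G.card)
  rw [iter_countStep_apply (by omega), if_pos (Nat.zero_le _), Nat.sub_zero]
  rw [uniform_powersetCard_bind (pairs n) (m := m) (k := G.card) (by rwa [hcard]) hGm _ ?_
    (Finset.mem_powersetCard.2 ⟨hG, rfl⟩), hcard]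
  · have h0 : ((n.choose 2).choose G.card : ENNReal) ≠ 0 := by
      exact_mod_cast (Nat.choose_pos hGN).ne'
    refine le_of_eq ?_
    rw [mul_comm _ ((_ : ENNReal)⁻¹), mul_assoc ((n.choose 2).choose G.card : ENNReal), ← mul_assoc,
      ENNReal.inv_mul_cancel h0 (ENNReal.natCast_ne_top _), one_mul]
  · intro Q hQ h
    rw [min_eq_left hGm, dif_pos h]

/-! ### Expectations over finitely many independent variables -/

section expectation

variable {ι S : Type} [Fintype ι] [DecidableEq ι] [Fintype S]

/-- The weight of `ω` if the coordinates are independent with the density `r`. -/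
def weight (r : S → ℝ) (ω : ι → S) : ℝ := ∏ e, r (ω e)

/-- The expectation of `f` if the coordinates are independent with the density `r`. -/
def expect (r : S → ℝ) (f : (ι → S) → ℝ) : ℝ := ∑ ω, weight r ω * f ω

open Classical in
/-- The probability of `T` if the coordinates are independent with the density `r`. -/
def prob (r : S → ℝ) (T : (ι → S) → Prop) : ℝ := expect r fun ω => if T ω then 1 else 0

/-- A probability density on a finite type. -/
structure IsDensity (r : S → ℝ) : Prop where
  nonneg : ∀ s, 0 ≤ r s
  sum_eq : ∑ s, r s = 1

variable {r : S → ℝ}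

theorem weight_nonneg (hr : IsDensity r) (ω : ι → S) : 0 ≤ weight r ω :=
  Finset.prod_nonneg fun _ _ => hr.nonneg _

theorem sum_weight (hr : IsDensity r) : ∑ ω : ι → S, weight r ω = 1 := by
  have := Finset.prod_univ_sum (fun _ : ι => (Finset.univ : Finset S)) (fun _ s => r s)
  simp only [hr.sum_eq, Finset.prod_const_one, Fintype.piFinset_univ] at this
  exact this.symm

theorem expect_const (hr : IsDensity r) (c : ℝ) : expect r (fun _ : ι → S => c) = c := by
  rw [expect, ← Finset.sum_mul, sum_weight hr, one_mul]

theorem expect_add (f g : (ι → S) → ℝ) :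
    expect r (fun ω => f ω + g ω) = expect r f + expect r g := by
  simp only [expect, mul_add, Finset.sum_add_distrib]

theorem expect_mul_left (c : ℝ) (f : (ι → S) → ℝ) :
    expect r (fun ω => c * f ω) = c * expect r f := by
  simp only [expect, Finset.mul_sum]
  exact Finset.sum_congr rfl fun ω _ => by ring

theorem expect_sum {κ : Type} (s : Finset κ) (f : κ → (ι → S) → ℝ) :
    expect r (fun ω => ∑ k ∈ s, f k ω) = ∑ k ∈ s, expect r (f k) := by
  simp only [expect, Finset.mul_sum]
  exact Finset.sum_comm

theorem expect_mono (hr : IsDensity r) {f g : (ι → S) → ℝ} (h : ∀ ω, f ω ≤ g ω) :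
    expect r f ≤ expect r g :=
  Finset.sum_le_sum fun ω _ => mul_le_mul_of_nonneg_left (h ω) (weight_nonneg hr ω)

/-- The coordinates in `A` are taken from `ω`, the others from `ω'`. -/
def mix (A : Set ι) [DecidablePred (· ∈ A)] (ω ω' : ι → S) : ι →
    S := fun e => if e ∈ A then ω e else ω' e

/-- Two independent copies may exchange their coordinates outside `A`: this is an involution on
pairs of outcomes which preserves the product of the weights. -/
theorem expect_resample (hr : IsDensity r) (A : Set ι) [DecidablePred (· ∈ A)] (f : (ι → S) → ℝ) :
    expect r f = expect r fun ω => expect r fun ω' => f (mix A ω ω') := by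
  have hinv : Function.Involutive fun x : (ι → S) × (ι → S) => (mix A x.1 x.2, mix A x.2 x.1) := by
    rintro ⟨ω, ω'⟩
    ext e <;> simp only [mix] <;> split_ifs <;> rfl
  have hw : ∀ ω ω' : ι → S, weight r ω * weight r ω' =
      weight r (mix A ω ω') * weight r (mix A ω' ω) := by
    intro ω ω'
    simp only [weight, ← Finset.prod_mul_distrib]
    refine Finset.prod_congr rfl fun e _ => ?_
    simp only [mix]
    split_ifs
    · rfl
    · ring
  have h2 := Equiv.sum_comp hinv.toPerm fun x : (ι → S) × (ι → S) =>
    weight r x.1 * weight r x.2 * f x.1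
  simp only [Function.Involutive.coe_toPerm, Fintype.sum_prod_type] at h2
  calc expect r f = ∑ ω, ∑ ω', weight r ω * weight r ω' * f ω := by
        simp only [expect, mul_assoc, ← Finset.mul_sum]
        refine Finset.sum_congr rfl fun ω _ => ?_
        rw [← Finset.sum_mul, sum_weight (ι := ι) hr, one_mul]
    _ = ∑ ω, ∑ ω', weight r ω * weight r ω' * f (mix A ω ω') := by
        rw [← h2]
        exact Finset.sum_congr rfl fun ω _ => Finset.sum_congr rfl fun ω' _ => by rw [hw ω ω']
    _ = _ := by simp only [expect, mul_assoc, Finset.mul_sum]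

theorem mix_eqOn (A : Set ι) [DecidablePred (· ∈ A)] (ω ω' : ι → S) {f : (ι → S) → ℝ}
    (hf : DependsOn f A) : f (mix A ω ω') = f ω :=
  hf fun e he => by simp only [mix]; rw [if_pos he]

theorem expect_mul (hr : IsDensity r) {A B : Set ι} (hAB : Disjoint A B) {f g : (ι → S) → ℝ}
    (hf : DependsOn f A) (hg : DependsOn g B) :
    expect r (fun ω => f ω * g ω) = expect r f * expect r g := by
  classical
  rw [expect_resample hr A]
  have h : ∀ ω ω', f (mix A ω ω') * g (mix A ω ω') = f ω * g ω' := fun ω ω' => by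
    rw [mix_eqOn A ω ω' hf]
    congr 1
    exact hg fun e he => by
      simp only [mix]; rw [if_neg fun he' => Set.disjoint_left.1 hAB he' he]
  simp only [h, expect_mul_left]
  simp only [expect, Finset.sum_mul]
  exact Finset.sum_congr rfl fun ω _ => by ring

theorem expect_coord (hr : IsDensity r) (e : ι) (φ : S → ℝ) :
    expect r (fun ω : ι → S => φ (ω e)) = ∑ s, r s * φ s := by
  have := Finset.prod_univ_sum (fun _ : ι => (Finset.univ : Finset S))
    (fun e' s => r s * if e' = e then φ s else 1)
  rw [Fintype.piFinset_univ] at this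
  calc expect r (fun ω : ι → S => φ (ω e)) =
        ∑ ω : ι → S, ∏ e', (r (ω e') * if e' = e then φ (ω e') else 1) := by
        refine Finset.sum_congr rfl fun ω _ => ?_
        rw [Finset.prod_mul_distrib, Finset.prod_ite_eq' Finset.univ e, if_pos (Finset.mem_univ e)]
        rfl
    _ = ∏ e', ∑ s, (r s * if e' = e then φ s else 1) := this.symm
    _ = _ := by
        rw [Finset.prod_eq_single e]
        · simp
        · intro e' _ he'
          simp [he', hr.sum_eq]
        · simp

theorem dependsOn_coord (e : ι) (φ : S → ℝ) : DependsOn (fun ω : ι → S => φ (ω e)) {e} :=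
  fun _ _ h => congrArg φ (h e rfl)

theorem expect_prod {κ : Type} [DecidableEq κ] (hr : IsDensity r) (U : Finset κ) (e : κ → ι)
    (he : Set.InjOn e U) (φ : κ → S → ℝ) :
    expect r (fun ω : ι → S => ∏ k ∈ U, φ k (ω (e k))) = ∏ k ∈ U, ∑ s, r s * φ k s := by
  induction U using Finset.induction_on with
  | empty => simp [expect_const hr]
  | insert a U ha ih =>
    simp only [Finset.prod_insert ha]
    rw [expect_mul hr (A := {e a}) (B := e '' U) ?_ (dependsOn_coord (e a) (φ a)) ?_,
      expect_coord hr, ih (he.mono (by simp))]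
    · rw [Set.disjoint_singleton_left]
      rintro ⟨k, hk, hka⟩
      have := he (by simp [show k ∈ U from hk]) (by simp) hka
      exact ha (this ▸ hk)
    · intro ω ω' h
      exact Finset.prod_congr rfl fun k hk => by rw [h (e k) ⟨k, hk, rfl⟩]

theorem prob_mono (hr : IsDensity r) {T T' : (ι → S) → Prop} (h : ∀ ω, T ω → T' ω) :
    prob r T ≤ prob r T' := by
  refine expect_mono hr fun ω => ?_
  by_cases hT : T ω
  · rw [if_pos hT, if_pos (h ω hT)]
  · rw [if_neg hT]; split_ifs <;> norm_num

theorem prob_or_le (hr : IsDensity r) (T T' : (ι → S) → Prop) :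
    prob r (fun ω => T ω ∨ T' ω) ≤ prob r T + prob r T' := by
  rw [prob, prob, prob, ← expect_add]
  refine expect_mono hr fun ω => ?_
  by_cases h : T ω <;> by_cases h' : T' ω <;> simp [h, h']

open Classical in
theorem prob_exists_le (hr : IsDensity r) {κ : Type} (U : Finset κ) (T : κ → (ι → S) → Prop) :
    prob r (fun ω => ∃ k ∈ U, T k ω) ≤ ∑ k ∈ U, prob r (T k) := by
  simp only [prob]
  rw [← expect_sum]
  refine expect_mono hr fun ω => ?_
  have h0 : ∀ k ∈ U, (0 : ℝ) ≤ if T k ω then 1 else 0 := fun k _ => by split_ifs <;> norm_num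
  by_cases h : ∃ k ∈ U, T k ω
  · rw [if_pos h]
    obtain ⟨k, hk, hT⟩ := h
    refine le_trans ?_ (Finset.single_le_sum h0 hk)
    rw [if_pos hT]
  · rw [if_neg h]
    exact Finset.sum_nonneg h0

theorem prob_not (hr : IsDensity r) (T : (ι → S) →
    Prop) : prob r (fun ω => ¬ T ω) = 1 - prob r T := by
  rw [eq_sub_iff_add_eq, prob, prob, ← expect_add]
  refine Eq.trans ?_ (expect_const (ι := ι) hr 1)
  congr 1
  funext ω
  by_cases h : T ω <;> simp [h]

/-- Markov's inequality. -/
theorem prob_le_expect (hr : IsDensity r) {T : (ι → S) → Prop} {f : (ι → S) → ℝ} (hf : ∀ ω, 0 ≤ f ω)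
    (h : ∀ ω, T ω → 1 ≤ f ω) : prob r T ≤ expect r f := by
  refine expect_mono hr fun ω => ?_
  by_cases hT : T ω
  · rw [if_pos hT]; exact h ω hT
  · rw [if_neg hT]; exact hf ω

end expectation

/-! ### Moments of the values of a layer -/

section moments

variable {n : ℕ} {S : Type} [Fintype S] {r : S → ℝ} {b : S → ℤ}

/-- The symmetric matrix with the entries `b (ω {t, w})`. -/
def randMatrix (b : S → ℤ) (ω : Sym2 (Fin n) → S) (t w : ℕ) : ℤ :=
  if h : t < n ∧ w < n then b (ω s(⟨t, h.1⟩, ⟨w, h.2⟩)) else 0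

/-- The pairs of items below `k`. -/
def inner (n k : ℕ) : Set (Sym2 (Fin n)) := {e | ∀ x ∈ e, (x : ℕ) < k}

theorem inner_mono {k k' : ℕ} (h : k ≤ k') : inner n k ⊆ inner n k' :=
  fun _ he x hx => (he x hx).trans_le h

theorem randMatrix_eq_of_inner {k : ℕ} {ω ω' : Sym2 (Fin n) → S} (h : ∀ e ∈ inner n k, ω e = ω' e)
    {t w : ℕ} (ht : t < k) (hw : w < k) : randMatrix b ω t w = randMatrix b ω' t w := by
  unfold randMatrix
  split_ifs with htw
  · rw [h]
    intro x hx
    rcases Sym2.mem_iff.1 hx with rfl | rfl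
    · exact ht
    · exact hw
  · rfl

/-- Layers up to `i` see only pairs of items below `f (i + 1)`. All entries that lead to later items
are therefore independent of them. -/
theorem walk_dependsOn (b : S → ℤ) {f : ℕ → ℕ} (hf : Monotone f) (i v : ℕ) (hv : v < f (i + 1)) :
    DependsOn (fun ω : Sym2 (Fin n) → S => walk (randMatrix b ω) f i v) (inner n (f (i + 1))) := by
  induction i generalizing v with
  | zero => exact fun ω ω' _ => rfl
  | succ i ih =>
    intro ω ω' h
    have h1 : f (i + 1) ≤ f (i + 2) := hf (by omega)
    have hw : ∀ w, w < f (i + 1) → walk (randMatrix b ω) f i w = walk (randMatrix b ω') f i w :=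
      fun w hw => ih w hw fun e he => h e (inner_mono h1 he)
    simp only [walk, push]
    split_ifs with hc
    · refine Finset.sum_congr rfl fun w hw' => ?_
      rw [Finset.mem_Ico] at hw'
      rw [hw w hw'.2, randMatrix_eq_of_inner h hc.2 (hw'.2.trans_le h1)]
    · have hv' : v < f (i + 2) := hv
      exact hw v (by omega)

variable (r b) in
/-- The mean of an entry. -/
def meanEntry : ℝ := ∑ s, r s * b s

variable (r b) in
/-- The second moment of an entry. -/
def sqEntry : ℝ := ∑ s, r s * (b s : ℝ) ^ 2

theorem randMatrix_of_lt (ω : Sym2 (Fin n) → S) {t w : ℕ} (ht : t < n) (hw : w < n) :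
    randMatrix b ω t w = b (ω s(⟨t, ht⟩, ⟨w, hw⟩)) := dif_pos ⟨ht, hw⟩

theorem expect_randMatrix (hr : IsDensity r) {t w : ℕ} (ht : t < n) (hw : w < n) :
    expect r (fun ω : Sym2 (Fin n) → S => (randMatrix b ω t w : ℝ)) = meanEntry r b := by
  simp only [randMatrix_of_lt _ ht hw]
  exact expect_coord hr _ fun s => (b s : ℝ)

/-- `hx` and `hx'` exclude that the two unordered pairs coincide with their ends exchanged, so they
are equal only if `t = t'` and `w = w'`. -/
theorem expect_randMatrix_mul (hr : IsDensity r) {t w t' w' : ℕ} (ht : t < n) (hw : w < n)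
    (ht' : t' < n) (hw' : w' < n) (hx : w < t') (hx' : w' < t) :
    expect r (fun ω : Sym2 (Fin n) → S => (randMatrix b ω t w : ℝ) * randMatrix b ω t' w') =
      meanEntry r b ^ 2 +
        if t = t' ∧ w = w' then sqEntry r b - meanEntry r b ^ 2 else 0 := by
  simp only [randMatrix_of_lt _ ht hw, randMatrix_of_lt _ ht' hw']
  split_ifs with h
  · obtain ⟨rfl, rfl⟩ := h
    rw [add_sub_cancel]
    simp only [sqEntry, ← pow_two]
    exact expect_coord hr _ fun s => (b s : ℝ) ^ 2
  · refine (expect_mul hr (A := {s((⟨t, ht⟩ : Fin n), (⟨w, hw⟩ : Fin n))})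
      (B := {s((⟨t', ht'⟩ : Fin n), (⟨w', hw'⟩ : Fin n))}) ?_
      (dependsOn_coord _ fun s => (b s : ℝ)) (dependsOn_coord _ fun s => (b s : ℝ))).trans ?_
    · rw [Set.disjoint_singleton, Ne, Sym2.eq_iff]
      simp only [Fin.mk.injEq]
      omega
    · rw [expect_coord hr _ fun s => (b s : ℝ), expect_coord hr _ fun s => (b s : ℝ), meanEntry]
      ring

theorem not_mem_inner {k t w : ℕ} (ht : t < n) (hw : w < n) (hk : k ≤ t) :
    s((⟨t, ht⟩ : Fin n), (⟨w, hw⟩ : Fin n)) ∉ inner n k := fun h => by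
  have := h ⟨t, ht⟩ (Sym2.mem_mk_left _ _)
  simp only at this
  omega

variable (b) in
/-- The value of the item `v` when layer `i` has been computed. -/
def val (f : ℕ → ℕ) (i v : ℕ) (ω : Sym2 (Fin n) → S) : ℝ := walk (randMatrix b ω) f i v

theorem val_succ (f : ℕ → ℕ) (i t : ℕ) (h1 : f (i + 1) ≤ t) (h2 : t < f (i + 2))
    (ω : Sym2 (Fin n) → S) :
    val b f (i + 1) t ω = ∑ w ∈ Finset.Ico (f i) (f (i + 1)),
        randMatrix b ω t w * val b f i w ω := by
  simp only [val, walk, push]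
  rw [if_pos ⟨h1, h2⟩]
  push_cast
  rfl

variable (b) in
/-- The sum of the values of layer `i`. -/
def layerSum (f : ℕ → ℕ) (i : ℕ) (ω : Sym2 (Fin n) → S) : ℝ :=
  ∑ v ∈ Finset.Ico (f i) (f (i + 1)), val b f i v ω

variable (b) in
/-- The sum of the squares of the values of layer `i`. -/
def layerSq (f : ℕ → ℕ) (i : ℕ) (ω : Sym2 (Fin n) → S) : ℝ :=
  ∑ v ∈ Finset.Ico (f i) (f (i + 1)), val b f i v ω ^ 2

theorem layerSum_sq (f : ℕ → ℕ) (i : ℕ) (ω : Sym2 (Fin n) → S) :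
    layerSum b f i ω ^ 2 = ∑ w ∈ Finset.Ico (f i) (f (i + 1)), ∑ w' ∈ Finset.Ico (f i) (f (i + 1)),
      val b f i w ω * val b f i w' ω := by
  rw [layerSum, pow_two, Finset.sum_mul_sum]

/-- Rows `t` and `t'` are fresh, so expectations factor. The products of the means assemble to the
squared sum of the previous layer; the variance of an entry enters only for `t = t'`, `w = w'`, and
brings the sum of squares. -/
theorem expect_val_mul (hr : IsDensity r) {f : ℕ → ℕ} (hf : Monotone f) (i : ℕ) (hn : f (i + 2) ≤ n)
    {t t' : ℕ} (h1 : f (i + 1) ≤ t) (h2 : t < f (i + 2)) (h1' : f (i + 1) ≤ t')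
    (h2' : t' < f (i + 2)) :
    expect r (fun ω : Sym2 (Fin n) → S => val b f (i + 1) t ω * val b f (i + 1) t' ω) =
      meanEntry r b ^ 2 * expect r (fun ω : Sym2 (Fin n) → S => layerSum b f i ω ^ 2) +
        if t = t' then (sqEntry r b - meanEntry r b ^ 2) *
          expect r (fun ω : Sym2 (Fin n) → S => layerSq b f i ω) else 0 := by
  have h12 : f (i + 1) ≤ f (i + 2) := hf (by omega)
  have key : ∀ w ∈ Finset.Ico (f i) (f (i + 1)), ∀ w' ∈ Finset.Ico (f i) (f (i + 1)),
      expect r (fun ω : Sym2 (Fin n) → S => randMatrix b ω t w * val b f i w ω *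
        (randMatrix b ω t' w' * val b f i w' ω)) =
      (meanEntry r b ^ 2 + if t = t' ∧ w = w' then sqEntry r b - meanEntry r b ^ 2 else 0) *
        expect r (fun ω : Sym2 (Fin n) → S => val b f i w ω * val b f i w' ω) := by
    intro w hw w' hw'
    rw [Finset.mem_Ico] at hw hw'
    rw [← expect_randMatrix_mul (n := n) hr (t := t) (w := w) (t' := t') (w' := w') (by omega) (by omega)
      (by omega) (by omega) (by omega) (by omega)]
    refine Eq.trans ?_ (expect_mul hr (A := {s((⟨t, by omega⟩ : Fin n), (⟨w, by omega⟩ : Fin n)),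
        s((⟨t', by omega⟩ : Fin n), (⟨w', by omega⟩ : Fin n))}) (B := inner n (f (i + 1)))
        (f := fun ω => (randMatrix b ω t w : ℝ) * randMatrix b ω t' w')
        (g := fun ω => val b f i w ω * val b f i w' ω) ?_ ?_ ?_)
    · congr 1
      funext ω
      ring
    · rw [Set.disjoint_left]
      rintro e (rfl | rfl)
      · exact not_mem_inner _ _ h1
      · exact not_mem_inner _ _ h1'
    · intro ω ω' h
      simp only [randMatrix_of_lt (b := b) _ (show t < n by omega) (show w < n by omega),
        randMatrix_of_lt (b := b) _ (show t' < n by omega) (show w' < n by omega)]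
      rw [h _ (Or.inl rfl), h _ (Or.inr rfl)]
    · intro ω ω' h
      have e1 := walk_dependsOn (n := n) b hf i w hw.2 h
      have e2 := walk_dependsOn (n := n) b hf i w' hw'.2 h
      simp only [val]
      simp only at e1 e2
      rw [e1, e2]
  have hexp : ∀ ω : Sym2 (Fin n) → S, val b f (i + 1) t ω * val b f (i + 1) t' ω =
      ∑ w ∈ Finset.Ico (f i) (f (i + 1)), ∑ w' ∈ Finset.Ico (f i) (f (i + 1)),
        randMatrix b ω t w * val b f i w ω * (randMatrix b ω t' w' * val b f i w' ω) := fun ω => by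
    rw [val_succ f i t h1 h2, val_succ f i t' h1' h2', Finset.sum_mul_sum]
  simp only [hexp, layerSum_sq, expect_sum]
  rw [Finset.sum_congr rfl fun w hw => Finset.sum_congr rfl fun w' hw' => key w hw w' hw']
  simp only [add_mul, Finset.sum_add_distrib, ← Finset.mul_sum]
  congr 1
  by_cases htt : t = t'
  · rw [if_pos htt]
    simp only [htt, true_and, ite_mul, zero_mul, Finset.sum_ite_eq, layerSq, expect_sum,
      Finset.mul_sum, pow_two]
    exact Finset.sum_congr rfl fun w hw => by rw [if_pos hw]
  · simp [htt]

theorem expect_layerSum_succ (hr : IsDensity r) {f : ℕ → ℕ} (hf : Monotone f) (i : ℕ)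
    (hn : f (i + 2) ≤ n) :
    expect r (fun ω : Sym2 (Fin n) → S => layerSum b f (i + 1) ω) =
      (f (i + 2) - f (i + 1) : ℕ) * meanEntry r b *
        expect r (fun ω : Sym2 (Fin n) → S => layerSum b f i ω) := by
  have h12 : f (i + 1) ≤ f (i + 2) := hf (by omega)
  have key : ∀ t ∈ Finset.Ico (f (i + 1)) (f (i + 2)),
      expect r (fun ω : Sym2 (Fin n) → S => val b f (i + 1) t ω) =
        meanEntry r b * expect r (fun ω : Sym2 (Fin n) → S => layerSum b f i ω) := by
    intro t ht
    rw [Finset.mem_Ico] at ht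
    simp only [val_succ f i t ht.1 ht.2, layerSum, expect_sum, Finset.mul_sum]
    refine Finset.sum_congr rfl fun w hw => ?_
    rw [Finset.mem_Ico] at hw
    rw [← expect_randMatrix (n := n) hr (b := b) (t := t) (w := w) (by omega) (by omega)]
    refine expect_mul hr (A := {s((⟨t, by omega⟩ : Fin n), (⟨w, by omega⟩ : Fin n))})
      (B := inner n (f (i + 1))) ?_ ?_ ?_
    · rw [Set.disjoint_singleton_left]
      exact not_mem_inner _ _ ht.1
    · intro ω ω' h
      simp only [randMatrix_of_lt (b := b) _ (show t < n by omega) (show w < n by omega)]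
      rw [h _ rfl]
    · intro ω ω' h
      have e1 := walk_dependsOn (n := n) b hf i w hw.2 h
      simp only [val]
      simp only at e1
      rw [e1]
  have e : (fun ω : Sym2 (Fin n) → S => layerSum b f (i + 1) ω) =
    fun ω => ∑ t ∈ Finset.Ico (f (i + 1)) (f (i + 2)), val b f (i + 1) t ω := rfl
  rw [e, expect_sum, Finset.sum_congr rfl key, Finset.sum_const, Nat.card_Ico, nsmul_eq_mul,
      mul_assoc]

theorem expect_layerSum_sq_succ (hr : IsDensity r) {f : ℕ → ℕ} (hf : Monotone f) (i : ℕ)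
    (hn : f (i + 2) ≤ n) :
    expect r (fun ω : Sym2 (Fin n) → S => layerSum b f (i + 1) ω ^ 2) =
      ((f (i + 2) - f (i + 1) : ℕ) : ℝ) ^ 2 * meanEntry r b ^ 2 *
        expect r (fun ω : Sym2 (Fin n) → S => layerSum b f i ω ^ 2) +
      (f (i + 2) - f (i + 1) : ℕ) * (sqEntry r b - meanEntry r b ^ 2) *
        expect r (fun ω : Sym2 (Fin n) → S => layerSq b f i ω) := by
  simp only [layerSum_sq (b := b) f (i + 1), expect_sum]
  rw [Finset.sum_congr rfl fun t ht => Finset.sum_congr rfl fun t' ht' =>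
    expect_val_mul (n := n) (b := b) hr hf i hn (Finset.mem_Ico.1 ht).1 (Finset.mem_Ico.1 ht).2
      (Finset.mem_Ico.1 ht').1 (Finset.mem_Ico.1 ht').2]
  simp only [Finset.sum_add_distrib, Finset.sum_const, Nat.card_Ico, nsmul_eq_mul,
    Finset.sum_ite_eq]
  rw [Finset.sum_ite_mem, Finset.inter_self, Finset.sum_const, Nat.card_Ico, nsmul_eq_mul]
  ring

theorem expect_layerSq_succ (hr : IsDensity r) {f : ℕ → ℕ} (hf : Monotone f) (i : ℕ)
    (hn : f (i + 2) ≤ n) :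
    expect r (fun ω : Sym2 (Fin n) → S => layerSq b f (i + 1) ω) =
      (f (i + 2) - f (i + 1) : ℕ) * (meanEntry r b ^ 2 *
        expect r (fun ω : Sym2 (Fin n) → S => layerSum b f i ω ^ 2) +
      (sqEntry r b - meanEntry r b ^ 2) *
        expect r (fun ω : Sym2 (Fin n) → S => layerSq b f i ω)) := by
  have e : (fun ω : Sym2 (Fin n) → S => layerSq b f (i + 1) ω) = fun ω =>
      ∑ t ∈ Finset.Ico (f (i + 1)) (f (i + 2)), val b f (i + 1) t ω * val b f (i + 1) t ω :=
    funext fun ω => Finset.sum_congr rfl fun t _ => pow_two _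
  rw [e, expect_sum]
  rw [Finset.sum_congr rfl fun t ht =>
    expect_val_mul (n := n) (b := b) hr hf i hn (Finset.mem_Ico.1 ht).1 (Finset.mem_Ico.1 ht).2
      (Finset.mem_Ico.1 ht).1 (Finset.mem_Ico.1 ht).2]
  simp only [if_true, Finset.sum_const, Nat.card_Ico, nsmul_eq_mul]

end moments

/-! ### The growth of the moments -/

section recursion

variable {α β N : ℕ → ℝ} {Γ B b ε : ℝ} {l : ℕ}

/-- The potential `α + β / b` grows by at most a factor `1 + 1 / b` per layer, which keeps `α ≤ 2`.
Then `β` satisfies `β' ≤ 2 + β / 4`, whence the bound with the slack constant `3`. -/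
theorem middle_bounds (hΓ : 0 ≤ Γ) (hb : 1 ≤ b) (hΓb : Γ / b ≤ 1 / 4)
    (hα : ∀ i, 2 ≤ i → i < l + 1 → α (i + 1) = α i + Γ * β i / (b * b))
    (hβ : ∀ i, 2 ≤ i → i < l + 1 → β (i + 1) = α i + Γ * β i / b)
    (hα2 : 1 ≤ α 2) (hβ2 : 0 ≤ β 2) (hfac : (1 + 1 / b) ^ l * (α 2 + β 2 / b) ≤ 2)
    (hβb : β 2 ≤ 3 + b) (j : ℕ) (hj : j + 1 ≤ l) :
    1 ≤ α (j + 2) ∧ 0 ≤ β (j + 2) ∧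
      α (j + 2) + β (j + 2) / b ≤ (1 + 1 / b) ^ j * (α 2 + β 2 / b) ∧
      β (j + 2) ≤ 3 + b / 4 ^ j := by
  have hb0 : 0 < b := by linarith
  induction j with
  | zero => simp [hα2, hβ2, hβb]
  | succ j ih =>
    obtain ⟨h1, h2, h3, h4⟩ := ih (by omega)
    rw [show j + 1 + 2 = j + 2 + 1 by ring, hα (j + 2) (by omega) (by omega),
      hβ (j + 2) (by omega) (by omega)]
    have e1 : Γ * β (j + 2) / b = Γ / b * β (j + 2) := by ring
    have e2 : Γ * β (j + 2) / (b * b) = Γ / b * (β (j + 2) / b) := by field_simp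
    have hg : 0 ≤ Γ / b := by positivity
    have hbb : 0 ≤ β (j + 2) / b := by positivity
    have hib : 0 < 1 / b := by positivity
    rw [e1, e2]
    have p1 : Γ / b * β (j + 2) ≤ 1 / 4 * β (j + 2) := mul_le_mul_of_nonneg_right hΓb h2
    have p2 : Γ / b * (β (j + 2) / b) ≤ 1 / 4 * (β (j + 2) / b) := mul_le_mul_of_nonneg_right hΓb hbb
    have p0 : 0 ≤ Γ / b * (β (j + 2) / b) := by positivity
    have hφ2 : α (j + 2) ≤ 2 := by
      have : (1 + 1 / b) ^ j * (α 2 + β 2 / b) ≤ (1 + 1 / b) ^ l * (α 2 + β 2 / b) := by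
        refine mul_le_mul_of_nonneg_right (pow_le_pow_right₀ (by linarith) (by omega)) (by positivity)
      linarith
    refine ⟨by linarith, by positivity, ?_, ?_⟩
    · have e3 : (α (j + 2) + Γ / b * β (j + 2)) / b = α (j + 2) / b + Γ / b * (β (j + 2) / b) := by
        field_simp
      rw [e3, pow_succ]
      calc _ ≤ (1 + 1 / b) * (α (j + 2) + β (j + 2) / b) := by
            have : 0 ≤ 1 / b * (β (j + 2) / b) := by positivity
            have e4 : α (j + 2) / b = 1 / b * α (j + 2) := by ring
            rw [e4]
            linarith
        _ ≤ (1 + 1 / b) * ((1 + 1 / b) ^ j * (α 2 + β 2 / b)) :=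
            mul_le_mul_of_nonneg_left h3 (by linarith)
        _ = _ := by ring
    · have e5 : b / 4 ^ (j + 1) = 1 / 4 * (b / 4 ^ j) := by rw [pow_succ]; ring
      rw [e5]
      linarith

theorem one_add_pow_le (hb : 1 ≤ b) (hε1 : ε ≤ 1) (hlb : l / b ≤ ε) : (1 + 1 / b) ^ l ≤ 1 + 2 * ε := by
  have h0 : 0 ≤ l / b := by positivity
  have h1 : (1 + 1 / b) ^ l ≤ Real.exp (l / b) := by
    have h2 : 1 + 1 / b ≤ Real.exp (1 / b) := by
      have := Real.add_one_le_exp (1 / b)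
      linarith
    calc (1 + 1 / b) ^ l ≤ Real.exp (1 / b) ^ l := pow_le_pow_left₀ (by positivity) h2 l
      _ = _ := by rw [← Real.exp_nat_mul]; congr 1; ring
  refine h1.trans ((Real.exp_le_exp.2 hlb).trans ?_)
  have := Real.abs_exp_sub_one_le (x := ε) (by rw [abs_of_nonneg (h0.trans hlb)]; exact hε1)
  rw [abs_of_nonneg (h0.trans hlb)] at this
  linarith [le_abs_self (Real.exp ε - 1)]

/-- The first large layer gives `α 2 + β 2 / b ≤ 1 + 3 ε`, although `β` may be of order `b`. The
middle layers lose only `(1 + 1 / b) ^ l ≤ 1 + 2 ε` and bring `β` down to a constant. Leaving a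
large layer multiplies what is left of `β` by `Γ / B ≤ ε`. -/
theorem recursion_bound (hΓ : 0 ≤ Γ) (hb : 1 ≤ b) (hbB : b ≤ B) (hl : 1 ≤ l) (hb4 : b ≤ 4 ^ (l - 1))
    (hΓb : Γ / b ≤ 1 / 4) (hΓB : Γ / B ≤ ε) (hlb : l / b ≤ ε) (hε : ε ≤ 1 / 20)
    (hα : ∀ i, i < l + 3 → α (i + 1) = α i + Γ * β i / (N i * N (i + 1)))
    (hβ : ∀ i, i < l + 3 → β (i + 1) = α i + Γ * β i / N i)
    (hα0 : α 0 = 1) (hβ0 : β 0 = 1) (hN0 : N 0 = 1) (hN1 : N 1 = B)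
    (hNb : ∀ i, 2 ≤ i → i ≤ l + 1 → N i = b) (hN2 : N (l + 2) = B) (hN3 : N (l + 3) = B) :
    α (l + 3) ≤ 1 + 15 * ε ∧ β (l + 3) - α (l + 3) ≤ 3 * ε := by
  have hb0 : 0 < b := by linarith
  have hB0 : 0 < B := by linarith
  have hib : 1 / b ≤ ε := by
    refine le_trans ?_ hlb
    gcongr
    exact_mod_cast hl
  have hiB : 1 / B ≤ ε := (one_div_le_one_div_of_le hb0 hbB).trans hib
  have hib0 : 0 < 1 / b := by positivity
  have hiB0 : 0 < 1 / B := by positivity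
  have hε0 : 0 < ε := by linarith
  have hgB : 0 ≤ Γ / B := by positivity
  have hgb : 0 ≤ Γ / b := by positivity
  have α1 : α 1 = 1 + Γ / B := by rw [hα 0 (by omega), hα0, hβ0, hN0, hN1]; ring
  have β1 : β 1 = 1 + Γ := by rw [hβ 0 (by omega), hα0, hβ0, hN0]; ring
  have α2 : α 2 = 1 + Γ / B + Γ / B * (1 / b) + Γ / B * (Γ / b) := by
    rw [hα 1 (by omega), α1, β1, hN1, hNb 2 le_rfl (by omega)]; field_simp; ring
  have β2 : β 2 = 1 + 2 * (Γ / B) + Γ / B * Γ := by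
    rw [hβ 1 (by omega), α1, β1, hN1]; ring
  have hΓb' : Γ ≤ b / 4 := by rw [div_le_iff₀ hb0] at hΓb; linarith
  have β2b : β 2 / b = 1 / b + 2 * (Γ / B) * (1 / b) + Γ / B * (Γ / b) := by rw [β2]; field_simp
  have q1 : Γ / B * (1 / b) ≤ ε * (1 / 20) := mul_le_mul hΓB (by linarith) hib0.le hε0.le
  have q2 : Γ / B * (Γ / b) ≤ ε * (1 / 4) := mul_le_mul hΓB hΓb hgb hε0.le
  have q3 : Γ / B * Γ ≤ 1 / 20 * (b / 4) := mul_le_mul (by linarith) hΓb' hΓ (by norm_num)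
  have q0 : 0 ≤ Γ / B * Γ := by positivity
  have q1' : 0 ≤ Γ / B * (1 / b) := by positivity
  have q2' : 0 ≤ Γ / B * (Γ / b) := by positivity
  have hφ : α 2 + β 2 / b ≤ 1 + 3 * ε := by rw [α2, β2b]; linarith
  have hα2 : 1 ≤ α 2 := by rw [α2]; linarith
  have hβ2 : 0 ≤ β 2 := by rw [β2]; linarith
  have hpow := one_add_pow_le (l := l) hb (by linarith) hlb
  have hprod : (1 + 1 / b) ^ l * (α 2 + β 2 / b) ≤ 1 + 6 * ε := by
    refine (mul_le_mul hpow hφ (by positivity) (by linarith)).trans ?_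
    have : ε * ε ≤ ε * (1 / 20) := mul_le_mul_of_nonneg_left hε hε0.le
    linarith
  obtain ⟨h1, h2, h3, h4⟩ := middle_bounds (l := l) hΓ hb hΓb
    (fun i hi hi' => by rw [hα i (by omega), hNb i hi (by omega),
        hNb (i + 1) (by omega) (by omega)])
    (fun i hi hi' => by rw [hβ i (by omega), hNb i hi (by omega)])
    hα2 hβ2 (by linarith) (by rw [β2]; linarith) (l - 1) (by omega)
  rw [show l - 1 + 2 = l + 1 by omega] at h1 h2 h3 h4
  have h3' : α (l + 1) + β (l + 1) / b ≤ 1 + 6 * ε := by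
    refine h3.trans (le_trans ?_ hprod)
    exact mul_le_mul_of_nonneg_right (pow_le_pow_right₀ (by linarith) (by omega)) (by positivity)
  have hβb : 0 ≤ β (l + 1) / b := by positivity
  -- The number of small layers is chosen for this line: after `l - 1` contractions by `4` nothing
  -- is left of the initial `b`.
  have h4' : β (l + 1) ≤ 4 := by
    have : b / 4 ^ (l - 1) ≤ 1 := by rw [div_le_one (by positivity)]; exact hb4
    linarith
  have α5 : α (l + 2) = α (l + 1) + Γ / b * β (l + 1) * (1 / B) := by
    rw [hα (l + 1) (by omega), hN2, hNb (l + 1) (by omega) le_rfl]; field_simp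
  have β5 : β (l + 2) = α (l + 1) + Γ / b * β (l + 1) := by
    rw [hβ (l + 1) (by omega), hNb (l + 1) (by omega) le_rfl]; ring
  have α6 : α (l + 3) = α (l + 2) + Γ / B * β (l + 2) * (1 / B) := by
    rw [hα (l + 2) (by omega), hN2, hN3]; field_simp
  have β6 : β (l + 3) = α (l + 2) + Γ / B * β (l + 2) := by
    rw [hβ (l + 2) (by omega), hN2]; ring
  have r1 : Γ / b * β (l + 1) ≤ 1 / 4 * 4 := mul_le_mul hΓb h4' h2 (by norm_num)
  have r2 : Γ / b * β (l + 1) * (1 / B) ≤ 1 / 4 * 4 * ε := mul_le_mul r1 hiB hiB0.le (by norm_num)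
  have r3 : β (l + 2) ≤ 3 := by rw [β5]; linarith
  have r3' : 0 ≤ β (l + 2) := by rw [β5]; positivity
  have r4 : Γ / B * β (l + 2) ≤ ε * 3 := mul_le_mul hΓB r3 r3' hε0.le
  have r5 : Γ / B * β (l + 2) * (1 / B) ≤ ε * 3 * 1 := mul_le_mul r4 (by linarith) hiB0.le (by positivity)
  have r6 : 0 ≤ Γ / B * β (l + 2) * (1 / B) := by positivity
  exact ⟨by rw [α6, α5]; linarith, by rw [β6, α6]; linarith⟩

end recursion

section

/-! ### The law of an entry -/

/-- The density of a query indicator of mean `p` and an independent sign of mean `δ`. -/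
def entryDensity (p δ : ℝ) (s : Bool × ℤˣ) : ℝ :=
  (if s.1 then p else 1 - p) * ((1 + (s.2 : ℤ) * δ) / 2)

/-- The sign if the query is made, and `0` otherwise. -/
def entryValue (s : Bool × ℤˣ) : ℤ := if s.1 then s.2 else 0

variable {p δ : ℝ}

theorem sum_entry (φ : Bool × ℤˣ → ℝ) :
    ∑ s, φ s = φ (true, 1) + φ (true, -1) + (φ (false, 1) + φ (false, -1)) := by
  have hu : (Finset.univ : Finset ℤˣ) = {1, -1} := rfl
  have hs : ∀ ψ : ℤˣ → ℝ, ∑ s, ψ s = ψ 1 + ψ (-1) := fun ψ => by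
    rw [hu, Finset.sum_pair (by decide)]
  rw [Fintype.sum_prod_type, Fintype.sum_bool, hs, hs]

theorem isDensity_entryDensity (hp : 0 ≤ p) (hp1 : p ≤ 1) (hδ : 0 < δ) (hδ1 : δ < 1) :
    IsDensity (entryDensity p δ) where
  nonneg := by
    rintro ⟨g, s⟩
    unfold entryDensity
    refine mul_nonneg (by split_ifs <;> linarith) ?_
    rcases Int.units_eq_one_or s with rfl | rfl <;> simp <;> linarith
  sum_eq := by simp [sum_entry, entryDensity]; ring

theorem meanEntry_entry : meanEntry (entryDensity p δ) entryValue = p * δ := by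
  simp [meanEntry, sum_entry, entryDensity, entryValue]; ring

theorem sqEntry_entry : sqEntry (entryDensity p δ) entryValue = p := by
  simp [sqEntry, sum_entry, entryDensity, entryValue]; ring

theorem expMoment_entry (lam c : ℝ) :
    ∑ s, entryDensity p δ s * Real.exp (-(lam * (c * entryValue s))) =
      1 + p * (Real.cosh (lam * c) - 1 - δ * Real.sinh (lam * c)) := by
  simp [sum_entry, entryDensity, entryValue, Real.cosh_eq, Real.sinh_eq]; ring

/-- To second order the left side is `δ ^ 2 / 8 - δ ^ 2 / 4`. The remainder in `cosh x ≤ exp (x ^ 2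
/ 2)` costs at most `δ ^ 2 / 64`, and `7 / 64 > 1 / 10`. -/
theorem cosh_bound (hδ : 0 < δ) (hδ1 : δ < 1) :
    Real.cosh (δ / 2) - 1 - δ * Real.sinh (δ / 2) / 2 ≤ -(δ ^ 2 / 10) := by
  have h1 := Real.cosh_le_exp_half_sq (δ / 2)
  have h2 : δ / 2 ≤ Real.sinh (δ / 2) := Real.self_le_sinh_iff.2 (by linarith)
  have hd : δ ^ 2 ≤ 1 := by nlinarith
  have hx : (δ / 2) ^ 2 / 2 ≤ 1 := by nlinarith
  have h3 := Real.abs_exp_sub_one_sub_id_le (x := (δ / 2) ^ 2 / 2)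
    (by rw [abs_of_nonneg (by positivity)]; exact hx)
  have h4 := (abs_le.1 h3).2
  have h5 : δ * (δ / 2) ≤ δ * Real.sinh (δ / 2) := mul_le_mul_of_nonneg_left h2 hδ.le
  have h6 : ((δ / 2) ^ 2 / 2) ^ 2 ≤ δ ^ 2 / 64 := by nlinarith [sq_nonneg δ]
  nlinarith

variable {n : ℕ}

/-! ### Exponential moments and conditioning for the votes -/

/-- Chernoff's bound for a weighted sum of entries of a row. -/
theorem prob_rowSum_le (hp : 0 ≤ p) (hp1 : p ≤ 1) (hδ : 0 < δ) (hδ1 : δ < 1) {t : ℕ} (ht : t < n)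
    (U : Finset ℕ) (hU : ∀ w ∈ U, w < n) (y : ℕ → ℤ) (hy : ∀ w ∈ U, y w = 1 ∨ y w = -1)
    (hsum : (U.card : ℤ) ≤ 2 * ∑ w ∈ U, y w) :
    prob (entryDensity p δ) (fun ω : Sym2 (Fin n) → Bool × ℤˣ =>
      ∑ w ∈ U, randMatrix entryValue ω t w * y w ≤ 0) ≤ Real.exp (-(p * U.card * δ ^ 2 / 10)) := by
  have hr := isDensity_entryDensity hp hp1 hδ hδ1
  -- With weights of average at least `1 / 2` the exponent is about `lam ^ 2 / 2 - lam * δ / 2`,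
  -- which is least at `δ / 2`.
  set lam := δ / 2 with hlam
  let e : ℕ → Sym2 (Fin n) := fun w =>
    if h : w < n then s(⟨t, ht⟩, ⟨w, h⟩) else s(⟨t, ht⟩, ⟨t, ht⟩)
  have he : Set.InjOn e U := by
    intro w hw w' hw' h
    simp only [e, dif_pos (hU w hw), dif_pos (hU w' hw'), Sym2.congr_right, Fin.mk.injEq] at h
    exact h
  have hexp : ∀ ω : Sym2 (Fin n) → Bool × ℤˣ,
      Real.exp (-(lam * (∑ w ∈ U, randMatrix entryValue ω t w * y w : ℤ))) =
        ∏ w ∈ U, Real.exp (-(lam * (y w * entryValue (ω (e w))))) := by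
    intro ω
    rw [← Real.exp_sum]
    congr 1
    push_cast
    rw [Finset.mul_sum, ← Finset.sum_neg_distrib]
    refine Finset.sum_congr rfl fun w hw => ?_
    rw [randMatrix_of_lt ω ht (hU w hw)]
    simp only [e, dif_pos (hU w hw)]
    ring
  refine (prob_le_expect hr (f := fun ω : Sym2 (Fin n) → Bool × ℤˣ =>
    Real.exp (-(lam * (∑ w ∈ U, randMatrix entryValue ω t w * y w : ℤ))))
    (fun ω => (Real.exp_pos _).le) ?_).trans ?_
  · intro ω h
    have h' : ((∑ w ∈ U, randMatrix entryValue ω t w * y w : ℤ) : ℝ) ≤ 0 := by exact_mod_cast h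
    rw [Real.one_le_exp_iff, neg_nonneg]
    exact mul_nonpos_of_nonneg_of_nonpos (by positivity) h'
  simp only [hexp]
  rw [expect_prod hr U e he fun w s => Real.exp (-(lam * (y w * entryValue s)))]
  simp only [expMoment_entry]
  -- For `y w = ±1`, evenness of `cosh` and oddness of `sinh` make the exponent affine in `y w`, so
  -- only the sum of the weights matters.
  have hterm : ∀ w ∈ U, 1 + p * (Real.cosh (lam * y w) - 1 - δ * Real.sinh (lam * y w)) ≤
      Real.exp (p * (Real.cosh lam - 1 - δ * Real.sinh lam * y w)) := by
    intro w hw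
    have := Real.add_one_le_exp (p * (Real.cosh lam - 1 - δ * Real.sinh lam * y w))
    refine le_trans (le_of_eq ?_) this
    rcases hy w hw with h | h <;> simp [h] <;> ring
  refine (Finset.prod_le_prod (fun w hw => ?_) hterm).trans ?_
  · rw [← expMoment_entry]
    exact Finset.sum_nonneg fun s _ => mul_nonneg (hr.nonneg s) (Real.exp_pos _).le
  rw [← Real.exp_sum, Real.exp_le_exp, ← Finset.mul_sum, Finset.sum_sub_distrib, Finset.sum_const,
    nsmul_eq_mul, ← Finset.mul_sum]
  have hs : (U.card : ℝ) ≤ 2 * ∑ w ∈ U, (y w : ℝ) := by exact_mod_cast hsum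
  have hsinh : 0 ≤ δ * Real.sinh lam := mul_nonneg hδ.le (Real.sinh_nonneg_iff.2 (by positivity))
  have h1 : δ * Real.sinh lam * (U.card / 2) ≤ δ * Real.sinh lam * ∑ w ∈ U, (y w : ℝ) :=
    mul_le_mul_of_nonneg_left (by linarith) hsinh
  have h2 := mul_le_mul_of_nonneg_left (cosh_bound hδ hδ1) (Nat.cast_nonneg (α := ℝ) U.card)
  calc p * (U.card * (Real.cosh lam - 1) - δ * Real.sinh lam * ∑ w ∈ U, (y w : ℝ)) ≤
        p * (U.card * -(δ ^ 2 / 10)) := mul_le_mul_of_nonneg_left (by linarith) hp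
    _ = _ := by ring

/-- Conditioning on the coordinates in `A`: they decide `G`, and for each admissible choice of them
the resampled remaining coordinates satisfy the bound. -/
theorem prob_and_le {ι S : Type} [Fintype ι] [DecidableEq ι] [Fintype S] {r : S → ℝ}
    (hr : IsDensity r) (A : Set ι) [DecidablePred (· ∈ A)] {G : (ι → S) → Prop}
    (hG : DependsOn G A) (T : (ι → S) → Prop) {c : ℝ} (hc : 0 ≤ c)
    (h : ∀ ω, G ω → prob r (fun ω' => T (mix A ω ω')) ≤ c) : prob r (fun ω => G ω ∧ T ω) ≤ c := by
  classical
  rw [prob, expect_resample hr A]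
  refine (expect_mono hr (g := fun _ => c) fun ω => ?_).trans (expect_const hr c).le
  have hG' : ∀ ω', G (mix A ω ω') = G ω := fun ω' => hG fun e he => by
    simp only [mix]; rw [if_pos he]
  simp only [hG']
  by_cases hω : G ω
  · simpa only [hω, true_and, prob] using h ω hω
  · simp only [hω, false_and, if_false]
    rw [expect_const hr]
    exact hc

end

section

/-! ### The last layer is mostly correct -/

/-- If the second moment of a family is close to the square of its mean, then most of its members
are positive. -/
theorem card_nonpos_le (U : Finset ℕ) (x : ℕ → ℝ) {M : ℝ} (hM : 0 < M)
    (h : 4 * (∑ v ∈ U, x v - M) ^ 2 + 16 * (U.card * ∑ v ∈ U, x v ^ 2 - (∑ v ∈ U,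
        x v) ^ 2) < M ^ 2) :
    4 * ((U.filter fun v => x v ≤ 0).card : ℝ) ≤ U.card := by
  set Z := ∑ v ∈ U, x v
  set S := ∑ v ∈ U, x v ^ 2
  have hvar : ∑ v ∈ U, (U.card * x v - Z) ^ 2 = U.card * (U.card * S - Z ^ 2) := by
    have : ∀ v, (U.card * x v - Z) ^ 2 = (U.card : ℝ) ^ 2 * x v ^ 2 - 2 * U.card * Z * x v + Z ^ 2 :=
      fun v => by ring
    simp only [this, Finset.sum_add_distrib, Finset.sum_sub_distrib, ← Finset.mul_sum,
      Finset.sum_const, nsmul_eq_mul]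
    ring
  have hvar0 : 0 ≤ U.card * (U.card * S - Z ^ 2) :=
    hvar ▸ Finset.sum_nonneg fun v _ => sq_nonneg _
  rcases U.eq_empty_or_nonempty with rfl | hU
  · simp
  have hc : (0 : ℝ) < U.card := by exact_mod_cast hU.card_pos
  have hR : 0 ≤ U.card * S - Z ^ 2 := nonneg_of_mul_nonneg_right hvar0 hc
  -- The first square in `h` puts the sum within `M / 2` of `M`, so the second term can be compared
  -- with `Z ^ 2` instead of `M ^ 2`.
  have hZ : M / 2 < Z := by nlinarith
  have hZ0 : 0 < Z := by linarith
  -- Chebyshev's inequality inside the family: a nonpositive member contributes at least `Z ^ 2` to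
  -- the sum of the squared deviations.
  have hk : ((U.filter fun v => x v ≤ 0).card : ℝ) * Z ^ 2 ≤ U.card * (U.card * S - Z ^ 2) := by
    rw [← hvar, ← nsmul_eq_mul, ← Finset.sum_const]
    refine (Finset.sum_le_sum fun v hv => ?_).trans
      (Finset.sum_le_sum_of_subset_of_nonneg (Finset.filter_subset _ _) fun v _ _ => sq_nonneg _)
    have hv' := (Finset.mem_filter.1 hv).2
    have : U.card * x v ≤ 0 := mul_nonpos_of_nonneg_of_nonpos hc.le hv'
    nlinarith
  have hRZ : U.card * S - Z ^ 2 ≤ Z ^ 2 / 4 := by nlinarith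
  have h2 := mul_le_mul_of_nonneg_left hRZ hc.le
  have hZ2 : 0 < Z ^ 2 := by positivity
  by_contra hcon
  push Not at hcon
  nlinarith

section lastLayer

variable {n : ℕ} {S : Type} [Fintype S] {r : S → ℝ} {b : S → ℤ}

/-- Markov's inequality for the expression in `card_nonpos_le`, divided by `M ^ 2`. Its mean is at
most `4 * 15 ε + 16 * 3 ε = 108 ε`. -/
theorem prob_card_nonpos_le (hr : IsDensity r) {f : ℕ → ℕ} (i : ℕ)
    (hM : 0 < expect r (fun ω : Sym2 (Fin n) → S => layerSum b f i ω)) {ε : ℝ}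
    (hα : expect r (fun ω : Sym2 (Fin n) → S => layerSum b f i ω ^ 2) ≤
      (1 + 15 * ε) * expect r (fun ω : Sym2 (Fin n) → S => layerSum b f i ω) ^ 2)
    (hβ : (f (i + 1) - f i : ℕ) * expect r (fun ω : Sym2 (Fin n) → S => layerSq b f i ω) -
      expect r (fun ω : Sym2 (Fin n) → S => layerSum b f i ω ^ 2) ≤
      3 * ε * expect r (fun ω : Sym2 (Fin n) → S => layerSum b f i ω) ^ 2) :
    prob r (fun ω : Sym2 (Fin n) → S => ¬ 4 * ((Finset.Ico (f i) (f (i + 1))).filter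
      fun v => walk (randMatrix b ω) f i v ≤ 0).card ≤ f (i + 1) - f i) ≤ 108 * ε := by
  set M := expect r (fun ω : Sym2 (Fin n) → S => layerSum b f i ω) with hMdef
  set N := f (i + 1) - f i
  let F : (Sym2 (Fin n) → S) → ℝ := fun ω => (M ^ 2)⁻¹ * (4 * (layerSum b f i ω - M) ^ 2 +
    16 * (N * layerSq b f i ω - layerSum b f i ω ^ 2))
  have hcard : (Finset.Ico (f i) (f (i + 1))).card = N := Nat.card_Ico _ _
  have hF : expect r F = (M ^ 2)⁻¹ * (4 * (expect r (fun ω : Sym2 (Fin n) → S =>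
      layerSum b f i ω ^ 2) - M ^ 2) + 16 * (N * expect r (fun ω : Sym2 (Fin n) → S =>
        layerSq b f i ω) - expect r (fun ω : Sym2 (Fin n) → S => layerSum b f i ω ^ 2))) := by
    have e : F = fun ω => (M ^ 2)⁻¹ * ((-12) * layerSum b f i ω ^ 2 + ((-8 * M) * layerSum b f i ω +
        (4 * M ^ 2 + 16 * N * layerSq b f i ω))) := by
      funext ω
      simp only [F]
      ring
    rw [e]
    simp only [expect_mul_left, expect_add, expect_const hr, ← hMdef]
    ring
  refine (prob_le_expect hr (f := F) (fun ω => ?_) fun ω hω => ?_).trans ?_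
  · refine mul_nonneg (by positivity) (add_nonneg (by positivity) (mul_nonneg (by norm_num) ?_))
    have := sq_sum_le_card_mul_sum_sq (s := Finset.Ico (f i) (f (i + 1))) (f := fun v => val b f i v ω)
    rw [hcard] at this
    simpa only [layerSq, layerSum, sub_nonneg] using this
  · by_contra hcon
    push Not at hcon
    refine hω ?_
    have h1 := card_nonpos_le (Finset.Ico (f i) (f (i + 1))) (fun v => val b f i v ω) hM (by
      rw [hcard]
      simp only [F] at hcon
      rw [inv_mul_lt_iff₀ (by positivity), mul_one] at hcon
      exact hcon)
    rw [hcard] at h1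
    have h2 : ∀ v, val b f i v ω ≤ 0 ↔ walk (randMatrix b ω) f i v ≤ 0 := fun v => by
      simp only [val]
      exact_mod_cast Iff.rfl
    simp only [h2] at h1
    exact_mod_cast h1
  · rw [hF, inv_mul_le_iff₀ (by positivity)]
    linarith

/-- The moments of the layers, divided by the squares of the means. -/
theorem moments_recursion (hr : IsDensity r) (hq : 0 < meanEntry r b) {f : ℕ → ℕ} (hf : Monotone f)
    (hf0 : f 0 = 0) (hf1 : f 1 = 1) (k : ℕ) (hk : f (k + 1) ≤ n) (hN : ∀ i ≤ k, f i < f (i + 1)) :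
    ∃ α β : ℕ → ℝ, α 0 = 1 ∧ β 0 = 1 ∧
      (∀ i, i < k → α (i + 1) = α i + (sqEntry r b - meanEntry r b ^ 2) / meanEntry r b ^ 2 * β i /
        ((f (i + 1) - f i : ℕ) * (f (i + 2) - f (i + 1) : ℕ))) ∧
      (∀ i, i < k → β (i + 1) = α i + (sqEntry r b - meanEntry r b ^ 2) / meanEntry r b ^ 2 * β i /
        (f (i + 1) - f i : ℕ)) ∧
      ∀ i ≤ k, 0 < expect r (fun ω : Sym2 (Fin n) → S => layerSum b f i ω) ∧
        expect r (fun ω : Sym2 (Fin n) → S => layerSum b f i ω ^ 2) =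
          α i * expect r (fun ω : Sym2 (Fin n) → S => layerSum b f i ω) ^ 2 ∧
        (f (i + 1) - f i : ℕ) * expect r (fun ω : Sym2 (Fin n) → S => layerSq b f i ω) =
          β i * expect r (fun ω : Sym2 (Fin n) → S => layerSum b f i ω) ^ 2 := by
  set M : ℕ → ℝ := fun i => expect r (fun ω : Sym2 (Fin n) → S => layerSum b f i ω)
  set Q : ℕ → ℝ := fun i => expect r (fun ω : Sym2 (Fin n) → S => layerSum b f i ω ^ 2)
  set T : ℕ → ℝ := fun i => expect r (fun ω : Sym2 (Fin n) → S => layerSq b f i ω)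
  set q := meanEntry r b
  have hNpos : ∀ i ≤ k, (0 : ℝ) < (f (i + 1) - f i : ℕ) := fun i hi => by
    have := hN i hi
    exact_mod_cast (by omega : 0 < f (i + 1) - f i)
  have hfn : ∀ i < k, f (i + 2) ≤ n := fun i hi => (hf (by omega)).trans hk
  have hM1 : ∀ i < k, M (i + 1) = (f (i + 2) - f (i + 1) : ℕ) * q * M i := fun i hi =>
    expect_layerSum_succ hr hf i (hfn i hi)
  have hQ1 : ∀ i < k, Q (i + 1) = ((f (i + 2) - f (i + 1) : ℕ) : ℝ) ^ 2 * q ^ 2 * Q i +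
      (f (i + 2) - f (i + 1) : ℕ) * (sqEntry r b - q ^ 2) * T i := fun i hi =>
    expect_layerSum_sq_succ hr hf i (hfn i hi)
  have hT1 : ∀ i < k, T (i + 1) = (f (i + 2) - f (i + 1) : ℕ) *
      (q ^ 2 * Q i + (sqEntry r b - q ^ 2) * T i) := fun i hi =>
    expect_layerSq_succ hr hf i (hfn i hi)
  have hM0 : M 0 = 1 := by
    simp [M, layerSum, val, walk, hf0, hf1, expect_const hr]
  have hQ0 : Q 0 = 1 := by
    simp [Q, layerSum, val, walk, hf0, hf1, expect_const hr]
  have hT0 : T 0 = 1 := by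
    simp [T, layerSq, val, walk, hf0, hf1, expect_const hr]
  have hMpos : ∀ i ≤ k, 0 < M i := by
    intro i hi
    induction i with
    | zero => rw [hM0]; norm_num
    | succ i ih =>
      rw [hM1 i hi]
      have := ih (by omega)
      have := hNpos (i + 1) hi
      positivity
  refine ⟨fun i => Q i / M i ^ 2, fun i => (f (i + 1) - f i : ℕ) * T i / M i ^ 2, ?_, ?_, ?_, ?_,
      ?_⟩
  · simp [hQ0, hM0]
  · simp [hT0, hM0, hf0, hf1]
  · intro i hi
    have h1 := hMpos i hi.le
    have h2 := hNpos i hi.le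
    have h3 := hNpos (i + 1) hi
    beta_reduce
    rw [hQ1 i hi, hM1 i hi]
    clear_value Q T M q
    field_simp
  · intro i hi
    have h1 := hMpos i hi.le
    have h2 := hNpos i hi.le
    have h3 := hNpos (i + 1) hi
    beta_reduce
    rw [hT1 i hi, hM1 i hi]
    clear_value Q T M q
    field_simp
  · intro i hi
    have h1 := hMpos i hi
    exact ⟨h1, by field_simp; rfl, by field_simp; rfl⟩

end lastLayer

end

section

/-! ### The decoder and the signs of the items -/

/-- The matrix `A` with its rows and columns multiplied by the signs `s`. -/
def gauge (s : ℕ → ℤ) (A : ℕ → ℕ → ℤ) (t w : ℕ) : ℤ := s t * s w * A t w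

variable {s : ℕ → ℤ}

theorem sign_mul_self (hs : ∀ v, s v = 1 ∨ s v = -1) (v : ℕ) : s v * s v = 1 := by
  rcases hs v with h | h <;> rw [h] <;> rfl

/-- Along a path each inner item contributes its sign twice, so only the signs of the two ends
survive. -/
theorem walk_gauge (hs : ∀ v, s v = 1 ∨ s v = -1) (A : ℕ → ℕ → ℤ) (f : ℕ → ℕ) (i : ℕ) :
    walk (gauge s A) f i = fun v => s v * s 0 * walk A f i v := by
  induction i with
  | zero =>
    funext v
    simp only [walk]
    split_ifs with h
    · rw [h, sign_mul_self hs]; rfl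
    · simp
  | succ i ih =>
    funext v
    simp only [walk, push, ih, gauge]
    split_ifs
    · rw [Finset.mul_sum]
      refine Finset.sum_congr rfl fun w _ => ?_
      linear_combination (s v * s 0 * A v w * walk A f i w) * sign_mul_self hs w
    · rfl

/-- The correctness of the label of `w` that is computed from `x`. -/
def agreement (s x : ℕ → ℤ) (w : ℕ) : ℤ := s w * s 0 * sgn (s w * s 0 * x w)

theorem agreement_eq_or (hs : ∀ v, s v = 1 ∨ s v = -1) (x : ℕ → ℤ) (w : ℕ) :
    agreement s x w = 1 ∨ agreement s x w = -1 := by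
  unfold agreement sgn
  rcases hs w with h | h <;> rcases hs 0 with h' | h' <;> rw [h, h'] <;> split_ifs <;> simp

/-- `sgn` is not odd, as `sgn 0 = -1`: for `x w = 0` the agreement depends on the cluster of `w`.
Hence only positive values count as correct, and zeros are counted as errors. -/
theorem agreement_of_pos (hs : ∀ v, s v = 1 ∨ s v = -1) {x : ℕ → ℤ} {w : ℕ} (hx : 0 < x w) :
    agreement s x w = 1 := by
  unfold agreement sgn
  rcases hs w with h | h <;> rcases hs 0 with h' | h' <;> rw [h, h'] <;> split_ifs <;>
    first | rfl | omega

/-- All labels are relative to item `0`. By `h1` every label on `[h, n)` is `s t * s 0`; the second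
vote on `u` then collapses to `s u * s 0` times a plain row sum of `A`, which is positive by `h2`.
-/
theorem vote_correct (hs : ∀ v, s v = 1 ∨ s v = -1) (A : ℕ → ℕ → ℤ) (x : ℕ → ℤ) {g h n : ℕ}
    (h1 : ∀ t, h ≤ t → t < n → 0 < ∑ w ∈ Finset.Ico g h, A t w * agreement s x w)
    (h2 : ∀ u < h, 0 < ∑ t ∈ Finset.Ico h n, A u t) {v : ℕ} (hv : v < n) :
    0 < vote (gauge s A) g h n (fun v => s v * s 0 * x v) v ↔ s v = s 0 := by
  have hpos : ∀ k : ℤ, 0 < k → (0 < s v * s 0 * k ↔ s v = s 0) := fun k hk => by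
    rcases hs v with e | e <;> rcases hs 0 with e' | e' <;> rw [e, e'] <;> simp <;> omega
  have hmid : ∀ t, h ≤ t → t < n → sgnOn h n (push (gauge s A) g h h n
      (sgnOn g h fun v => s v * s 0 * x v)) t = s t * s 0 := by
    intro t ht htn
    have e : push (gauge s A) g h h n (sgnOn g h fun v => s v * s 0 * x v) t =
        s t * s 0 * ∑ w ∈ Finset.Ico g h, A t w * agreement s x w := by
      rw [push, if_pos ⟨ht, htn⟩, Finset.mul_sum]
      refine Finset.sum_congr rfl fun w hw => ?_
      rw [sgnOn, if_pos (Finset.mem_Ico.1 hw), gauge, agreement]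
      linear_combination (-(s t * s w * A t w * sgn (s w * s 0 * x w))) * sign_mul_self hs 0
    rw [sgnOn, if_pos ⟨ht, htn⟩, e, sgn]
    have := h1 t ht htn
    rcases hs t with e | e <;> rcases hs 0 with e' | e' <;> rw [e, e'] <;> simp <;> omega
  rw [vote, push]
  split_ifs with hc
  · have e : ∑ w ∈ Finset.Ico h n, gauge s A v w * sgnOn h n (push (gauge s A) g h h n
        (sgnOn g h fun v => s v * s 0 * x v)) w = s v * s 0 * ∑ t ∈ Finset.Ico h n, A v t := by
      rw [Finset.mul_sum]
      refine Finset.sum_congr rfl fun w hw => ?_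
      rw [hmid w (Finset.mem_Ico.1 hw).1 (Finset.mem_Ico.1 hw).2, gauge]
      linear_combination (s v * s 0 * A v w) * sign_mul_self hs w
    rw [e]
    exact hpos _ (h2 v hc.2)
  · rw [hmid v (by omega) hv]
    simpa using hpos 1 one_pos

/-- At most a quarter of errors leaves a surplus of at least half of the votes, which is the
hypothesis on the weights in `prob_rowSum_le`. -/
theorem card_le_two_mul_sum_agreement (hs : ∀ v, s v = 1 ∨ s v = -1) (U : Finset ℕ) (x : ℕ → ℤ)
    (h : 4 * (U.filter fun w => x w ≤ 0).card ≤ U.card) :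
    (U.card : ℤ) ≤ 2 * ∑ w ∈ U, agreement s x w := by
  have h1 : ∀ w, 1 - 2 * (if x w ≤ 0 then 1 else 0) ≤ agreement s x w := fun w => by
    split_ifs with hw
    · rcases agreement_eq_or hs x w with e | e <;> rw [e] <;> norm_num
    · rw [agreement_of_pos hs (by omega)]; norm_num
  have h2 := Finset.sum_le_sum fun w (_ : w ∈ U) => h1 w
  rw [Finset.sum_sub_distrib, ← Finset.mul_sum, Finset.sum_boole, Finset.sum_const, nsmul_eq_mul,
    mul_one] at h2
  have h3 : (4 : ℤ) * (U.filter fun w => x w ≤ 0).card ≤ U.card := by exact_mod_cast h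
  linarith

variable {n : ℕ} {p δ ε : ℝ}

/-! ### Failure probabilities of the votes and of the last layer -/

/-- Fixing the entries among items below `f (i + 1)` fixes the voters and their agreement. The row
of `t` lies outside, so the Chernoff bound applies to fresh entries. -/
theorem prob_firstVote_le (hp : 0 ≤ p) (hp1 : p ≤ 1) (hδ : 0 < δ) (hδ1 : δ < 1)
    (hs : ∀ v, s v = 1 ∨ s v = -1) {f : ℕ → ℕ} (hf : Monotone f) (i : ℕ) {t : ℕ}
    (ht : f (i + 1) ≤ t) (htn : t < n) :
    prob (entryDensity p δ) (fun ω : Sym2 (Fin n) → Bool × ℤˣ =>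
      4 * ((Finset.Ico (f i) (f (i + 1))).filter
        fun v => walk (randMatrix entryValue ω) f i v ≤ 0).card ≤ f (i + 1) - f i ∧
      ∑ w ∈ Finset.Ico (f i) (f (i + 1)), randMatrix entryValue ω t w *
        agreement s (walk (randMatrix entryValue ω) f i) w ≤ 0) ≤
      Real.exp (-(p * (f (i + 1) - f i : ℕ) * δ ^ 2 / 10)) := by
  classical
  have hcard : (Finset.Ico (f i) (f (i + 1))).card = f (i + 1) - f i := Nat.card_Ico _ _
  refine prob_and_le (isDensity_entryDensity hp hp1 hδ hδ1) (inner n (f (i + 1)))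
    (G := fun ω : Sym2 (Fin n) → Bool × ℤˣ => 4 * ((Finset.Ico (f i) (f (i + 1))).filter
        fun v => walk (randMatrix entryValue ω) f i v ≤ 0).card ≤ f (i + 1) - f i) ?_
    (fun ω => ∑ w ∈ Finset.Ico (f i) (f (i + 1)), randMatrix entryValue ω t w *
        agreement s (walk (randMatrix entryValue ω) f i) w ≤ 0)
    (Real.exp_pos _).le fun ω hω => ?_
  · intro ω ω' h
    have e : ((Finset.Ico (f i) (f (i + 1))).filter
        fun v => walk (randMatrix entryValue ω) f i v ≤ 0) = (Finset.Ico (f i) (f (i + 1))).filter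
        fun v => walk (randMatrix entryValue ω') f i v ≤ 0 := by
      refine Finset.filter_congr fun v hv => ?_
      have := walk_dependsOn (n := n) entryValue hf i v (Finset.mem_Ico.1 hv).2 h
      simp only at this
      rw [this]
    simp only [e]
  · have key := prob_rowSum_le (n := n) hp hp1 hδ hδ1 htn (Finset.Ico (f i) (f (i + 1)))
      (fun w hw => by rw [Finset.mem_Ico] at hw; omega)
      (agreement s (walk (randMatrix entryValue ω) f i)) (fun w _ => agreement_eq_or hs _ w)
      (card_le_two_mul_sum_agreement hs _ _ (by rw [hcard]; exact hω))
    rw [hcard] at key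
    refine (prob_mono (isDensity_entryDensity hp hp1 hδ hδ1) fun ω' h => ?_).trans key
    refine le_of_eq_of_le (Finset.sum_congr rfl fun w hw => ?_) h
    rw [Finset.mem_Ico] at hw
    have e1 : walk (randMatrix entryValue (mix (inner n (f (i + 1))) ω ω')) f i w =
        walk (randMatrix entryValue ω) f i w :=
      walk_dependsOn (n := n) entryValue hf i w hw.2 fun e he => by
        simp only [mix]; rw [if_pos he]
    rw [agreement, agreement, e1, randMatrix_of_lt _ htn (by omega),
        randMatrix_of_lt _ htn (by omega),
      mix, if_neg (not_mem_inner htn (by omega) ht)]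

/-- The weights are the constant `1`, not computed labels, so the row sums need not be independent
of the walk or of the first votes. -/
theorem prob_secondVote_le (hp : 0 ≤ p) (hp1 : p ≤ 1) (hδ : 0 < δ) (hδ1 : δ < 1) {h B u : ℕ}
    (hu : u < n) (hB : B + h ≤ n) :
    prob (entryDensity p δ) (fun ω : Sym2 (Fin n) → Bool × ℤˣ =>
      ∑ t ∈ Finset.Ico h n, randMatrix entryValue ω u t ≤ 0) ≤
      Real.exp (-(p * B * δ ^ 2 / 10)) := by
  have key := prob_rowSum_le (n := n) hp hp1 hδ hδ1 hu (Finset.Ico h n)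
      (fun w hw => by rw [Finset.mem_Ico] at hw; omega) (fun _ => 1) (fun w _ => Or.inl rfl)
      (by simp; omega)
  simp only [mul_one, Nat.card_Ico] at key
  refine key.trans (Real.exp_le_exp.2 ?_)
  have : (B : ℝ) ≤ (n - h : ℕ) := by exact_mod_cast (by omega : B ≤ n - h)
  have h2 := mul_le_mul_of_nonneg_left this (by positivity : 0 ≤ p * δ ^ 2 / 10)
  linarith

/-- The noise parameter of the recursion is `(p - (p * δ) ^ 2) / (p * δ) ^ 2 = 1 / (p * δ ^ 2) - 1`;
the hypotheses bound the slightly larger `1 / (p * δ ^ 2)`. -/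
theorem prob_badLayer_le (hp : 0 < p) (hp1 : p ≤ 1) (hδ : 0 < δ) (hδ1 : δ < 1) {B b l : ℕ}
    (hb : 1 ≤ b) (hbB : b ≤ B) (hl : 1 ≤ l) (hb4 : b ≤ 4 ^ (l - 1))
    (hn : layerStart B b l (l + 4) ≤ n) (hΓb : 1 / (p * δ ^ 2) / b ≤ 1 / 4)
    (hΓB : 1 / (p * δ ^ 2) / B ≤ ε) (hlb : (l : ℝ) / b ≤ ε) (hε : ε ≤ 1 / 20) :
    prob (entryDensity p δ) (fun ω : Sym2 (Fin n) → Bool × ℤˣ =>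
      ¬ 4 * ((Finset.Ico (layerStart B b l (l + 3)) (layerStart B b l (l + 4))).filter
        fun v => walk (randMatrix entryValue ω) (layerStart B b l) (l + 3) v ≤ 0).card ≤
          layerStart B b l (l + 4) - layerStart B b l (l + 3)) ≤ 108 * ε := by
  have hr := isDensity_entryDensity hp.le hp1 hδ hδ1
  have hsub : ∀ i, layerStart B b l (i + 1) - layerStart B b l i = layerSize B b l i := fun i => by
    rw [layerStart_succ]; omega
  obtain ⟨α, β, hα0, hβ0, hα, hβ, hmom⟩ := moments_recursion (n := n) hr (b := entryValue)
    (by rw [meanEntry_entry]; positivity) (layerStart_mono B b l) (by simp [layerStart])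
    (by simp [layerStart, layerSize]) (l + 3) hn fun i _ => by
      rw [layerStart_succ, layerSize]; split_ifs <;> omega
  rw [meanEntry_entry, sqEntry_entry] at hα hβ
  have hδ2 : δ ^ 2 ≤ 1 := pow_le_one₀ hδ.le hδ1.le
  have hΓ : (p - (p * δ) ^ 2) / (p * δ) ^ 2 = 1 / (p * δ ^ 2) - 1 := by field_simp
  have hΓ0 : 0 ≤ 1 / (p * δ ^ 2) - 1 := by
    rw [sub_nonneg, le_div_iff₀ (by positivity), one_mul]
    exact mul_le_one₀ hp1 (by positivity) hδ2
  have hb0 : (0 : ℝ) < b := by exact_mod_cast hb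
  have hB0 : (0 : ℝ) < B := by exact_mod_cast hb.trans hbB
  obtain ⟨e1, e2⟩ := recursion_bound (N := fun i => (layerSize B b l i : ℝ)) hΓ0
    (by exact_mod_cast hb : (1 : ℝ) ≤ b) (by exact_mod_cast hbB : (b : ℝ) ≤ B) hl
    (by exact_mod_cast hb4) ((by gcongr; linarith : _ ≤ 1 / (p * δ ^ 2) / b).trans hΓb)
    ((by gcongr; linarith : _ ≤ 1 / (p * δ ^ 2) / (B : ℝ)).trans hΓB) hlb hε
    (fun i hi => by rw [hα i hi, hΓ, hsub, hsub]) (fun i hi => by rw [hβ i hi, hΓ, hsub]) hα0 hβ0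
    (by simp [layerSize]) (by simp [layerSize])
    (fun i h2 hi => by
      rw [layerSize, if_neg (by omega), if_neg (by omega), if_pos hi])
    (by rw [layerSize, if_neg (by omega), if_neg (by omega), if_neg (by omega)])
    (by rw [layerSize, if_neg (by omega), if_neg (by omega), if_neg (by omega)])
  obtain ⟨m1, m2, m3⟩ := hmom (l + 3) le_rfl
  refine prob_card_nonpos_le hr (l + 3) m1 ?_ ?_
  · rw [m2]
    exact mul_le_mul_of_nonneg_right e1 (sq_nonneg _)
  · rw [m2, m3, ← sub_mul]
    exact mul_le_mul_of_nonneg_right e2 (sq_nonneg _)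

/-- The decoder errs with small probability. -/
theorem prob_decode_le (hp : 0 < p) (hp1 : p ≤ 1) (hδ : 0 < δ) (hδ1 : δ < 1)
    (hs : ∀ v, s v = 1 ∨ s v = -1) (hb : 1 ≤ (n - 1) / 5 / Nat.clog 2 n)
    (hl : 1 ≤ Nat.clog 2 n) (hb4 : (n - 1) / 5 / Nat.clog 2 n ≤ 4 ^ (Nat.clog 2 n - 1))
    (hΓb : 1 / (p * δ ^ 2) / ((n - 1) / 5 / Nat.clog 2 n : ℕ) ≤ 1 / 4)
    (hΓB : 1 / (p * δ ^ 2) / ((n - 1) / 5 : ℕ) ≤ ε)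
    (hlb : (Nat.clog 2 n : ℝ) / ((n - 1) / 5 / Nat.clog 2 n : ℕ) ≤ ε) (hε : ε ≤ 1 / 20) :
    prob (entryDensity p δ) (fun ω : Sym2 (Fin n) → Bool × ℤˣ =>
      ¬ ∀ v < n, 0 < decode (gauge s (randMatrix entryValue ω)) n v ↔ s v = s 0) ≤
      108 * ε + 2 * n * Real.exp (-(p * ((n - 1) / 5 : ℕ) * δ ^ 2 / 10)) := by
  have hr := isDensity_entryDensity hp.le hp1 hδ hδ1
  set B := (n - 1) / 5
  set l := Nat.clog 2 n
  set b := B / l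
  set f := layerStart B b l with hf
  have hlbB : l * b ≤ B := Nat.mul_div_le B l
  obtain ⟨hf3, hf4⟩ := layerStart_last B b l
  rw [← hf] at hf3 hf4
  have hbB : b ≤ B := Nat.div_le_self _ _
  have hB5 : 5 * B ≤ n - 1 := Nat.mul_div_le _ _
  have hfn : B + f (l + 4) ≤ n := by omega
  have hfn' : layerStart B b l (l + 4) ≤ n := by rw [← hf]; omega
  have hsub : f (l + 4) - f (l + 3) = B := by omega
  have h0 := prob_badLayer_le (n := n) hp hp1 hδ hδ1 hb hbB hl hb4 hfn' hΓb
    hΓB hlb hε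
  rw [← hf] at h0
  have h1 := prob_exists_le hr (Finset.Ico (f (l + 4)) n) fun t (ω : Sym2 (Fin n) → Bool × ℤˣ) =>
      4 * ((Finset.Ico (f (l + 3)) (f (l + 3 + 1))).filter
        fun v => walk (randMatrix entryValue ω) f (l + 3) v ≤ 0).card ≤ f (l + 3 + 1) - f (l + 3) ∧
      ∑ w ∈ Finset.Ico (f (l + 3)) (f (l + 3 + 1)), randMatrix entryValue ω t w *
        agreement s (walk (randMatrix entryValue ω) f (l + 3)) w ≤ 0
  have h2 := prob_exists_le hr (Finset.range (f (l + 4))) fun u (ω : Sym2 (Fin n) → Bool × ℤˣ) =>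
      ∑ t ∈ Finset.Ico (f (l + 4)) n, randMatrix entryValue ω u t ≤ 0
  have h1' := h1.trans (Finset.sum_le_card_nsmul _ _ (Real.exp (-(p * B * δ ^ 2 / 10)))
    fun t ht => by
      have := prob_firstVote_le hp.le hp1 hδ hδ1 hs (layerStart_mono B b l) (l + 3)
        (Finset.mem_Ico.1 ht).1 (Finset.mem_Ico.1 ht).2
      have e : ((f (l + 3 + 1) - f (l + 3) : ℕ) : ℝ) = B := by exact_mod_cast hsub
      rw [← hf, e] at this
      exact this)
  have h2' := h2.trans (Finset.sum_le_card_nsmul _ _ (Real.exp (-(p * B * δ ^ 2 / 10)))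
    fun u hu => prob_secondVote_le hp.le hp1 hδ hδ1 (by rw [Finset.mem_range] at hu; omega) hfn)
  rw [nsmul_eq_mul, Nat.card_Ico] at h1'
  rw [nsmul_eq_mul, Finset.card_range] at h2'
  have hE := (Real.exp_pos (-(p * B * δ ^ 2 / 10))).le
  have c1 : ((n - f (l + 4) : ℕ) : ℝ) ≤ n := by exact_mod_cast Nat.sub_le _ _
  have c2 : (f (l + 4) : ℝ) ≤ n := by exact_mod_cast (by omega : f (l + 4) ≤ n)
  have c1' := mul_le_mul_of_nonneg_right c1 hE
  have c2' := mul_le_mul_of_nonneg_right c2 hE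
  -- Union bound: a bad last layer, a failed first vote given a good layer, or a failed second vote.
  -- The votes are fewer than `2 * n`, up to equality, with a common error bound.
  refine (prob_mono hr fun ω hω => ?_).trans ((prob_or_le hr _ _).trans (add_le_add h0
    ((prob_or_le hr _ _).trans (add_le_add h1' h2')))) |>.trans (by linarith)
  by_contra hcon
  push Not at hcon
  obtain ⟨g0, g1, g2⟩ := hcon
  refine hω fun v hv => ?_
  have := vote_correct hs (randMatrix entryValue ω) (walk (randMatrix entryValue ω) f (l + 3))
    (g := f (l + 3)) (h := f (l + 4)) (n := n)
    (fun t h1 h2 => g1 t (Finset.mem_Ico.2 ⟨h1,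
        h2⟩) g0) (fun u hu => g2 u (Finset.mem_range.2 hu)) hv
  rw [← walk_gauge hs] at this
  exact this

end

section

/-! ### The probability of success as an expectation over independent variables -/

theorem measurableSingletonClass_intUnits : MeasurableSingletonClass ℤˣ where
  measurableSet_singleton u := ⟨{(u : ℤ)}, trivial, by ext v; simp [Units.ext_iff]⟩

theorem noiseLaw_singleton {δ : ℝ} (u : ℤˣ) :
    noiseLaw δ {u} = ENNReal.ofReal ((1 + (u : ℤ) * δ) / 2) := by
  have := measurableSingletonClass_intUnits
  rcases Int.units_eq_one_or u with rfl | rfl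
  · simp [noiseLaw]
  · simp [noiseLaw, sub_eq_add_neg]

theorem isProbabilityMeasure_noiseLaw {δ : ℝ} (hδ : 0 < δ) (hδ1 : δ < 1) :
    IsProbabilityMeasure (noiseLaw δ) := by
  constructor
  simp only [noiseLaw, Measure.coe_add, Measure.coe_smul, Pi.add_apply, Pi.smul_apply, measure_univ,
    smul_eq_mul, mul_one]
  rw [← ENNReal.ofReal_add (by linarith) (by linarith)]
  ring_nf
  exact ENNReal.ofReal_one

variable {n : ℕ}

/-- The set of the queries that are kept. -/
def keptSet (ω : Sym2 (Fin n) → Bool × ℤˣ) : Finset (Sym2 ℕ) :=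
  (Finset.univ.filter fun e : Sym2 (Fin n) => ¬ e.IsDiag ∧ (ω e).1 = true).image (Sym2.map Fin.val)

theorem map_val_injective : Function.Injective (Sym2.map (Fin.val : Fin n → ℕ)) :=
  Sym2.map.injective Fin.val_injective

theorem image_not_isDiag :
    (Finset.univ.filter fun e : Sym2 (Fin n) => ¬ e.IsDiag).image (Sym2.map Fin.val) = pairs n := by
  ext x
  induction x with | _ u v
  simp only [pairs, Finset.mem_image, Finset.mem_filter, Finset.mem_univ, true_and,
    Finset.mem_offDiag, Finset.mem_range, Prod.exists]
  constructor
  · rintro ⟨e, he, h⟩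
    induction e with | _ a b
    rw [Sym2.mk_isDiag_iff] at he
    exact ⟨a, b, ⟨a.2, b.2, fun h => he (Fin.ext h)⟩, h⟩
  · rintro ⟨a, b, ⟨ha, hb, hab⟩, h⟩
    refine ⟨s(⟨a, ha⟩, ⟨b, hb⟩), ?_, h⟩
    rw [Sym2.mk_isDiag_iff]
    exact fun h => hab (Fin.mk.inj_iff.1 h)

theorem mem_keptSet {ω : Sym2 (Fin n) → Bool × ℤˣ} {e : Sym2 (Fin n)} :
    e.map Fin.val ∈ keptSet ω ↔ ¬ e.IsDiag ∧ (ω e).1 = true := by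
  simp only [keptSet, Finset.mem_image, Finset.mem_filter, Finset.mem_univ, true_and]
  exact ⟨fun ⟨e', h, he⟩ => map_val_injective he ▸ h, fun h => ⟨e, h, rfl⟩⟩

theorem keptSet_subset (ω : Sym2 (Fin n) → Bool × ℤˣ) : keptSet ω ⊆ pairs n := by
  rw [← image_not_isDiag]
  exact Finset.image_subset_image fun e he => by
    simp only [Finset.mem_filter, Finset.mem_univ, true_and] at he ⊢
    exact he.1

theorem keptSet_eq_iff {ω : Sym2 (Fin n) → Bool × ℤˣ} {G : Finset (Sym2 ℕ)} (hG : G ⊆ pairs n) :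
    keptSet ω = G ↔ ∀ e : Sym2 (Fin n), ¬ e.IsDiag → ((ω e).1 = true ↔ e.map Fin.val ∈ G) := by
  constructor
  · rintro rfl e he
    rw [mem_keptSet]
    exact ⟨fun h => ⟨he, h⟩, fun h => h.2⟩
  · intro h
    ext x
    constructor
    · intro hx
      have hx' := keptSet_subset ω hx
      rw [← image_not_isDiag, Finset.mem_image] at hx'
      obtain ⟨e, he, rfl⟩ := hx'
      exact (h e (by simpa using he)).1 (mem_keptSet.1 hx).2
    · intro hx
      have hx' := hG hx
      rw [← image_not_isDiag, Finset.mem_image] at hx'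
      obtain ⟨e, he, rfl⟩ := hx'
      have he' : ¬ e.IsDiag := by simpa using he
      exact mem_keptSet.2 ⟨he', (h e he').2 hx⟩

variable {p δ : ℝ}

theorem prod_not_isDiag {G : Finset (Sym2 ℕ)} (hG : G ⊆ pairs n) :
    ∏ e : Sym2 (Fin n), (if e.IsDiag then 1 else if e.map Fin.val ∈ G then p else 1 - p) =
      p ^ G.card * (1 - p) ^ (n.choose 2 - G.card) := by
  have h1 : ∀ e : Sym2 (Fin n), (if e.IsDiag then 1 else if e.map Fin.val ∈ G then p else 1 - p) =
      if ¬ e.IsDiag then (if e.map Fin.val ∈ G then p else 1 - p) else 1 := fun e => by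
    split_ifs <;> rfl
  simp only [h1]
  rw [← Finset.prod_filter, ← Finset.prod_image (f := fun x => if x ∈ G then p else 1 - p)
    (g := Sym2.map Fin.val) map_val_injective.injOn, image_not_isDiag, Finset.prod_ite,
    Finset.prod_const, Finset.prod_const, Finset.filter_mem_eq_inter, Finset.inter_eq_right.2 hG,
    Finset.filter_not, Finset.filter_mem_eq_inter, Finset.inter_eq_right.2 hG,
    Finset.card_sdiff_of_subset hG, card_pairs]

/-- The event factors over the coordinates. On the diagonal the query indicator is unconstrained,
which accounts for the factor `1` there. -/
theorem prob_keptSet_eq (hr : IsDensity (entryDensity p δ)) {G : Finset (Sym2 ℕ)} (hG : G ⊆ pairs n)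
    (η : Sym2 (Fin n) → ℤˣ) :
    prob (entryDensity p δ) (fun ω : Sym2 (Fin n) → Bool × ℤˣ =>
      keptSet ω = G ∧ (fun e => (ω e).2) = η) =
      p ^ G.card * (1 - p) ^ (n.choose 2 - G.card) * ∏ e, (1 + (η e : ℤ) * δ) / 2 := by
  classical
  rw [← prod_not_isDiag hG, ← Finset.prod_mul_distrib]
  have hsum : ∀ e : Sym2 (Fin n), (if e.IsDiag then 1 else if e.map Fin.val ∈ G then p else 1 - p) *
      ((1 + (η e : ℤ) * δ) / 2) = ∑ s, entryDensity p δ s * (if s.2 = η e ∧ (¬ e.IsDiag →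
        (s.1 = true ↔ e.map Fin.val ∈ G)) then 1 else 0) := by
    intro e
    rcases Int.units_eq_one_or (η e) with h | h <;> by_cases h1 : e.IsDiag <;>
      by_cases h2 : e.map Fin.val ∈ G <;>
      simp [sum_entry, entryDensity, h, h1, h2] <;> ring
  simp only [hsum]
  rw [← expect_prod hr Finset.univ (fun e : Sym2 (Fin n) => e) (fun _ _ _ _ h => h)
    (fun e s => if s.2 = η e ∧ (¬ e.IsDiag → (s.1 = true ↔ e.map Fin.val ∈ G)) then 1 else 0), prob]
  congr 1
  funext ω
  rw [Finset.prod_boole]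
  congr 1
  simp only [keptSet_eq_iff hG, funext_iff, Finset.mem_univ, true_implies, eq_iff_iff]
  exact ⟨fun h e => ⟨h.2 e, h.1 e⟩, fun h => ⟨fun e => (h e).2, fun e => (h e).1⟩⟩

theorem prob_kept_noise (hr : IsDensity (entryDensity p δ))
    (Φ : Finset (Sym2 ℕ) → (Sym2 (Fin n) → ℤˣ) → Prop) [∀ G η, Decidable (Φ G η)] :
    prob (entryDensity p δ) (fun ω : Sym2 (Fin n) → Bool × ℤˣ => Φ (keptSet ω) fun e => (ω e).2) =
      ∑ η, ∑ G ∈ (pairs n).powerset with Φ G η,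
        p ^ G.card * (1 - p) ^ (n.choose 2 - G.card) * ∏ e, (1 + (η e : ℤ) * δ) / 2 := by
  classical
  have h1 : ∀ η, ∀ G ∈ (pairs n).powerset.filter (Φ · η),
      p ^ G.card * (1 - p) ^ (n.choose 2 - G.card) * ∏ e, (1 + (η e : ℤ) * δ) / 2 =
      prob (entryDensity p δ) fun ω : Sym2 (Fin n) → Bool × ℤˣ =>
      keptSet ω = G ∧ (fun e => (ω e).2) = η := fun η G hG =>
    (prob_keptSet_eq hr (Finset.mem_powerset.1 (Finset.mem_filter.1 hG).1) η).symm
  rw [Finset.sum_congr rfl fun η _ => Finset.sum_congr rfl (h1 η)]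
  simp only [prob]
  simp only [← expect_sum]
  congr 1
  funext ω
  rw [Finset.sum_eq_single fun e => (ω e).2]
  · simp only [and_true, Finset.sum_ite_eq, Finset.mem_filter, Finset.mem_powerset]
    simp [keptSet_subset ω]
  · intro η _ hη
    exact Finset.sum_eq_zero fun G _ => if_neg fun h => hη h.2.symm
  · simp

/-- The probability that a query is kept. -/
def keepProb (n m : ℕ) : ℝ := m / (2 * n.choose 2 - 1 + 1 : ℕ)

theorem keepProb_nonneg (n m : ℕ) : 0 ≤ keepProb n m := by unfold keepProb; positivity

theorem keepProb_le_one {n m : ℕ} (hm : m ≤ n.choose 2) : keepProb n m ≤ 1 := by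
  unfold keepProb
  rw [div_le_one (by positivity)]
  exact_mod_cast (by omega : m ≤ 2 * n.choose 2 - 1 + 1)

theorem ofReal_keepProb (n m : ℕ) :
    ENNReal.ofReal (keepProb n m) = (m : ENNReal) / (2 * n.choose 2 - 1 + 1 : ℕ) := by
  rw [keepProb, ENNReal.ofReal_div_of_pos (by positivity), ENNReal.ofReal_natCast,
    ENNReal.ofReal_natCast]

theorem ofReal_one_sub_keepProb {n m : ℕ} (hm : m ≤ n.choose 2) :
    ENNReal.ofReal (1 - keepProb n m) =
      ((2 * n.choose 2 - 1 + 1 - m : ℕ) : ENNReal) / (2 * n.choose 2 - 1 + 1 : ℕ) := by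
  have h : 1 - keepProb n m = ((2 * n.choose 2 - 1 + 1 - m : ℕ) : ℝ) / (2 * n.choose 2 - 1 + 1 : ℕ) := by
    rw [keepProb, Nat.cast_sub (by omega)]
    field_simp
  rw [h, ENNReal.ofReal_div_of_pos (by positivity), ENNReal.ofReal_natCast, ENNReal.ofReal_natCast]

/-- For fixed answers, the masses of the successful kept sets are bounded below one at a time by
`kept_lower_bound`, and then added. -/
theorem output_recovers_ge {m : ℕ} (hm : m ≤ n.choose 2) (σ : Fin n → ℤˣ) (τ : Sym2 (Fin n) → ℤˣ)
    (F : Finset (Finset (Sym2 ℕ)))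
    (hF : ∀ G ∈ F, G ⊆ pairs n ∧ G.card ≤ m ∧ Recovers σ (label τ G)) :
    ENNReal.ofReal (∑ G ∈ F, keepProb n m ^ G.card * (1 - keepProb n m) ^ (n.choose 2 - G.card)) ≤
      (algorithm.output m (timeBound.eval n) τ).toOuterMeasure {l | Recovers σ l} := by
  have hp := keepProb_nonneg n m
  have hp1 : 0 ≤ 1 - keepProb n m := sub_nonneg.2 (keepProb_le_one hm)
  rw [output_eq hm, PMF.toOuterMeasure_map_apply,
    ENNReal.ofReal_sum_of_nonneg fun G _ => by positivity]
  refine le_trans (Finset.sum_le_sum fun G hG => ?_)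
    ((PMF.toOuterMeasure_apply_finset _ F).symm.le.trans
      (OuterMeasure.mono _ fun G hG => (hF G hG).2.2))
  refine le_trans (le_of_eq ?_) (kept_lower_bound hm (hF G hG).1 (hF G hG).2.1)
  rw [ENNReal.ofReal_mul (by positivity), ENNReal.ofReal_pow hp, ENNReal.ofReal_pow hp1,
    ofReal_keepProb, ofReal_one_sub_keepProb hm]

theorem lintegral_noise (hδ : 0 < δ) (hδ1 : δ < 1) (F : (Sym2 (Fin n) → ℤˣ) → ENNReal) :
    ∫⁻ η, F η ∂(Measure.pi fun _ : Sym2 (Fin n) => noiseLaw δ) =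
      ∑ η, F η * ENNReal.ofReal (∏ e, (1 + (η e : ℤ) * δ) / 2) := by
  have := measurableSingletonClass_intUnits
  have := isProbabilityMeasure_noiseLaw hδ hδ1
  rw [lintegral_fintype]
  refine Finset.sum_congr rfl fun η _ => ?_
  rw [Measure.pi_singleton, ENNReal.ofReal_prod_of_nonneg fun e _ => ?_]
  · simp only [noiseLaw_singleton]
  · rcases Int.units_eq_one_or (η e) with h | h <;> rw [h] <;> simp <;> linarith

-- Passage to the independent model: both sides are sums over the noise, and for each noise the
-- independent weights of the successful sets with at most `m` pairs are dominated by the actual law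
-- of the kept set.
open Classical in
theorem successProb_ge {m : ℕ} (hm : m ≤ n.choose 2) (hδ : 0 < δ) (hδ1 : δ < 1) (σ : Fin n → ℤˣ) :
    ENNReal.ofReal (prob (entryDensity (keepProb n m) δ) fun ω : Sym2 (Fin n) → Bool × ℤˣ =>
      (keptSet ω).card ≤ m ∧ Recovers σ (label (noisyOracle σ fun e => (ω e).2) (keptSet ω))) ≤
      algorithm.successProb m (timeBound.eval n) δ σ := by
  have hp := keepProb_nonneg n m
  have hp1 : 0 ≤ 1 - keepProb n m := sub_nonneg.2 (keepProb_le_one hm)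
  have hr := isDensity_entryDensity hp (keepProb_le_one hm) hδ hδ1
  have hη : ∀ η : Sym2 (Fin n) → ℤˣ, 0 ≤ ∏ e, (1 + (η e : ℤ) * δ) / 2 := fun η =>
    Finset.prod_nonneg fun e _ => by
      rcases Int.units_eq_one_or (η e) with h | h <;> rw [h] <;> simp <;> linarith
  have key := prob_kept_noise (n := n) hr fun G η =>
    G.card ≤ m ∧ Recovers σ (label (noisyOracle σ η) G)
  beta_reduce at key
  rw [key, Algorithm.successProb, lintegral_noise hδ hδ1,
    ENNReal.ofReal_sum_of_nonneg fun η _ => Finset.sum_nonneg fun G _ =>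
      mul_nonneg (by positivity) (hη η)]
  refine Finset.sum_le_sum fun η _ => ?_
  rw [← Finset.sum_mul, ENNReal.ofReal_mul (Finset.sum_nonneg fun G _ => by positivity)]
  refine mul_le_mul' (output_recovers_ge hm σ _ _ fun G hG => ?_) le_rfl
  rw [Finset.mem_filter, Finset.mem_powerset] at hG
  exact hG

theorem successProb_le_one {m t : ℕ} (A : Algorithm) (hδ : 0 < δ) (hδ1 : δ < 1) (σ : Fin n → ℤˣ) :
    A.successProb m t δ σ ≤ 1 := by
  have := isProbabilityMeasure_noiseLaw hδ hδ1
  refine (lintegral_mono (g := fun _ => 1) fun η => ?_).trans (by simp)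
  refine (OuterMeasure.mono _ (Set.subset_univ _)).trans (le_of_eq ?_)
  exact (PMF.toOuterMeasure_apply_eq_one_iff _ _).2 (Set.subset_univ _)

end

section

/-! ### A lower bound for the probability of success -/

variable {n m : ℕ} {p δ ε : ℝ}

/-- The signs of the items, extended by `1`. -/
def signOf (σ : Fin n → ℤˣ) (v : ℕ) : ℤ := if h : v < n then σ ⟨v, h⟩ else 1

theorem signOf_eq_or (σ : Fin n → ℤˣ) (v : ℕ) : signOf σ v = 1 ∨ signOf σ v = -1 := by
  unfold signOf
  split_ifs with h
  · rcases Int.units_eq_one_or (σ ⟨v, h⟩) with e | e <;> simp [e]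
  · exact Or.inl rfl

/-- An answer is `σ t * σ w` times noise, so the observed matrix is the gauge transform of the
random matrix. Only `t ≠ w` is possible, because `keptSet` omits the diagonal. -/
theorem signed_keptSet (σ : Fin n → ℤˣ) (ω : Sym2 (Fin n) → Bool × ℤˣ) {t w : ℕ} (htw : t ≠ w) :
    signed (keptSet ω) (noisyOracle σ fun e => (ω e).2) t w =
      gauge (signOf σ) (randMatrix entryValue ω) t w := by
  by_cases h : t < n ∧ w < n
  · have hmem : s(t, w) ∈ keptSet ω ↔ (ω s(⟨t, h.1⟩, ⟨w, h.2⟩)).1 = true := by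
      have := mem_keptSet (ω := ω) (e := s(⟨t, h.1⟩, ⟨w, h.2⟩))
      rw [Sym2.map_mk, Sym2.mk_isDiag_iff] at this
      rw [this]
      exact and_iff_right fun e => htw (Fin.mk.inj_iff.1 e)
    rw [signed, dif_pos h, gauge, randMatrix, dif_pos h, signOf, dif_pos h.1, signOf, dif_pos h.2,
      entryValue, noisyOracle, Sym2.map_mk, Sym2.mul_mk]
    simp only [hmem]
    split_ifs <;> simp
  · rw [signed, dif_neg h, gauge, randMatrix, dif_neg h, mul_zero]

/-- A label records whether an item is in the cluster of item `0`. With at most two clusters this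
determines the partition. -/
theorem recovers_of_decode (σ : Fin n → ℤˣ) (ω : Sym2 (Fin n) → Bool × ℤˣ)
    (h : ∀ v < n, 0 < decode (gauge (signOf σ) (randMatrix entryValue ω)) n v ↔
      signOf σ v = signOf σ 0) :
    Recovers σ (label (noisyOracle σ fun e => (ω e).2) (keptSet ω)) := by
  intro u v
  have hlabel : ∀ v : Fin n, label (noisyOracle σ fun e => (ω e).2) (keptSet ω) v =
      if signOf σ v = signOf σ 0 then 1 else 0 := fun v => by
    rw [label, decode_congr (fun t w htw => signed_keptSet σ ω htw)]
    simp only [h v v.2]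
  have hσ : ∀ v : Fin n, signOf σ v = σ v := fun v => dif_pos v.2
  have huv : σ u = σ v ↔ signOf σ u = signOf σ v := by rw [hσ, hσ, Units.ext_iff]
  rw [hlabel, hlabel, huv]
  rcases signOf_eq_or σ u with e | e <;> rcases signOf_eq_or σ v with e' | e' <;>
    rcases signOf_eq_or σ 0 with e'' | e'' <;> rw [e, e', e''] <;> simp

/-- With high probability, no more than `m` queries are kept. -/
theorem prob_card_keptSet_le (hm : m ≤ n.choose 2) (hδ : 0 < δ) (hδ1 : δ < 1) :
    prob (entryDensity (keepProb n m) δ) (fun ω : Sym2 (Fin n) → Bool × ℤˣ =>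
      ¬ (keptSet ω).card ≤ m) ≤ Real.exp (-(m / 10 : ℝ)) := by
  have hp := keepProb_nonneg n m
  have hr := isDensity_entryDensity hp (keepProb_le_one hm) hδ hδ1
  -- Markov's inequality for `2 ^ (card - m)`: its mean is at most `exp (m / 2 - m * log 2)`, and
  -- `log 2 - 1 / 2 > 1 / 10`.
  refine (prob_le_expect hr (f := fun ω => (2 ^ m : ℝ)⁻¹ * 2 ^ (keptSet ω).card)
    (fun ω => by positivity) fun ω h => ?_).trans ?_
  · rw [le_inv_mul_iff₀ (by positivity), mul_one]
    exact pow_le_pow_right₀ (by norm_num) (by omega)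
  have hpow : ∀ ω : Sym2 (Fin n) → Bool × ℤˣ, (2 : ℝ) ^ (keptSet ω).card =
      ∏ e : Sym2 (Fin n), if ¬ e.IsDiag ∧ (ω e).1 = true then 2 else 1 := fun ω => by
    rw [keptSet, Finset.card_image_of_injective _ map_val_injective, ← Finset.prod_filter,
      Finset.prod_const]
  have hterm : ∀ e : Sym2 (Fin n), ∑ s, entryDensity (keepProb n m) δ s *
      (if ¬ e.IsDiag ∧ s.1 = true then 2 else 1) = if ¬ e.IsDiag then 1 + keepProb n m else 1 := by
    intro e
    by_cases h : e.IsDiag <;> simp [sum_entry, entryDensity, h] <;> ring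
  rw [expect_mul_left]
  simp only [hpow]
  rw [expect_prod hr Finset.univ (fun e : Sym2 (Fin n) => e) (fun _ _ _ _ h => h)
    (fun e s => if ¬ e.IsDiag ∧ s.1 = true then 2 else 1)]
  simp only [hterm]
  have hcard : (Finset.univ.filter fun e : Sym2 (Fin n) => ¬ e.IsDiag).card = n.choose 2 := by
    rw [← card_pairs, ← image_not_isDiag, Finset.card_image_of_injective _ map_val_injective]
  rw [← Finset.prod_filter, Finset.prod_const, hcard]
  have h1 : (1 + keepProb n m) ^ n.choose 2 ≤ Real.exp (m / 2) := by
    have h2 : 1 + keepProb n m ≤ Real.exp (keepProb n m) := by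
      linarith [Real.add_one_le_exp (keepProb n m)]
    refine (pow_le_pow_left₀ (by linarith) h2 _).trans ?_
    rw [← Real.exp_nat_mul, Real.exp_le_exp, keepProb, ← mul_div_assoc, div_le_iff₀ (by positivity)]
    have : (2 * n.choose 2 : ℝ) ≤ (2 * n.choose 2 - 1 + 1 : ℕ) := by
      exact_mod_cast (by omega : 2 * n.choose 2 ≤ 2 * n.choose 2 - 1 + 1)
    have := mul_le_mul_of_nonneg_left this (Nat.cast_nonneg (α := ℝ) m)
    linarith
  have h3 : (2 ^ m : ℝ)⁻¹ = Real.exp (-(m * Real.log 2)) := by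
    rw [Real.exp_neg, Real.exp_nat_mul, Real.exp_log (by norm_num)]
  rw [h3]
  refine (mul_le_mul_of_nonneg_left h1 (Real.exp_pos _).le).trans ?_
  rw [← Real.exp_add, Real.exp_le_exp]
  have := mul_le_mul_of_nonneg_left Real.log_two_gt_d9.le (Nat.cast_nonneg (α := ℝ) m)
  linarith

theorem successProb_ge_of_bounds (hm : m ≤ n.choose 2) (hm0 : 0 < m) (hδ : 0 < δ) (hδ1 : δ < 1)
    (σ : Fin n → ℤˣ) (hb : 1 ≤ (n - 1) / 5 / Nat.clog 2 n) (hl : 1 ≤ Nat.clog 2 n)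
    (hb4 : (n - 1) / 5 / Nat.clog 2 n ≤ 4 ^ (Nat.clog 2 n - 1))
    (hΓb : 1 / (keepProb n m * δ ^ 2) / ((n - 1) / 5 / Nat.clog 2 n : ℕ) ≤ 1 / 4)
    (hΓB : 1 / (keepProb n m * δ ^ 2) / ((n - 1) / 5 : ℕ) ≤ ε)
    (hlb : (Nat.clog 2 n : ℝ) / ((n - 1) / 5 / Nat.clog 2 n : ℕ) ≤ ε) (hε : ε ≤ 1 / 20) :
    ENNReal.ofReal (1 - (Real.exp (-(m / 10 : ℝ)) + (108 * ε + 2 * n *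
      Real.exp (-(keepProb n m * ((n - 1) / 5 : ℕ) * δ ^ 2 / 10))))) ≤
      algorithm.successProb m (timeBound.eval n) δ σ := by
  have hr := isDensity_entryDensity (keepProb_nonneg n m) (keepProb_le_one hm) hδ hδ1
  have hp0 : 0 < keepProb n m := by
    unfold keepProb
    have : (0 : ℝ) < m := by exact_mod_cast hm0
    positivity
  refine le_trans (ENNReal.ofReal_le_ofReal ?_) (successProb_ge hm hδ hδ1 σ)
  have h1 := prob_card_keptSet_le hm hδ hδ1
  have h2 := prob_decode_le hp0 (keepProb_le_one hm) hδ hδ1 (signOf_eq_or σ) hb hl hb4 hΓb hΓB hlb hε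
  refine le_trans (sub_le_sub_left (add_le_add h1 h2) 1)
    (le_trans (sub_le_sub_left (prob_or_le hr _ _) 1) ?_)
  rw [← prob_not hr]
  refine prob_mono hr fun ω h => ?_
  push Not at h
  exact ⟨h.1, recovers_of_decode σ ω h.2⟩

end

/-! ### Asymptotics -/

theorem tendsto_log_natCast : Tendsto (fun n : ℕ => Real.log n) atTop atTop :=
  Real.tendsto_log_atTop.comp tendsto_natCast_atTop_atTop

theorem eventually_log_natCast_pow_le (k : ℕ) {c : ℝ} (hc : 0 < c) :
    ∀ᶠ n : ℕ in atTop, c * Real.log n ^ k ≤ n := by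
  have h := (Real.isLittleO_pow_log_id_atTop (n := k)).comp_tendsto tendsto_natCast_atTop_atTop
  filter_upwards [h.bound (inv_pos.2 hc)] with n hn
  simp only [Function.comp, id, Real.norm_eq_abs, Nat.abs_cast] at hn
  have := (le_abs_self _).trans hn
  rwa [le_inv_mul_iff₀ hc] at this

theorem clog_le_log {n : ℕ} (hn : 1 ≤ Real.log n) : (Nat.clog 2 n : ℝ) ≤ 3 * Real.log n := by
  have hn1 : 1 < n := by
    by_contra h
    have : n = 0 ∨ n = 1 := by omega
    rcases this with rfl | rfl <;> norm_num at hn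
  have h1 := Nat.pow_pred_clog_lt_self one_lt_two hn1
  have h2 : ((2 : ℝ)) ^ (Nat.clog 2 n - 1) ≤ n := by exact_mod_cast h1.le
  have h3 := Real.log_le_log (by positivity) h2
  rw [Real.log_pow] at h3
  have h4 := Real.log_two_gt_d9
  have h5 : (Nat.clog 2 n : ℝ) ≤ (Nat.clog 2 n - 1 : ℕ) + 1 := by
    exact_mod_cast (by omega : Nat.clog 2 n ≤ Nat.clog 2 n - 1 + 1)
  have h6 : ((Nat.clog 2 n - 1 : ℕ) : ℝ) * (1 / 2) ≤ (Nat.clog 2 n - 1 : ℕ) * Real.log 2 :=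
    mul_le_mul_of_nonneg_left (by linarith) (Nat.cast_nonneg _)
  linarith

theorem le_natDiv (a b : ℕ) (hb : 0 < b) : (a : ℝ) / b - 1 ≤ (a / b : ℕ) := by
  have h := Nat.lt_div_mul_add (a := a) hb
  have h' : (a : ℝ) < (a / b : ℕ) * b + b := by exact_mod_cast h
  rw [sub_le_iff_le_add, div_le_iff₀ (by exact_mod_cast hb)]
  linarith

/-- The sizes of the layers for a large number of items. -/
theorem eventually_layer_sizes : ∀ᶠ n : ℕ in atTop, 20 ≤ Real.log n ∧ 180 * Real.log n ^ 3 ≤ n ∧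
    1 ≤ Nat.clog 2 n ∧ 1 ≤ (n - 1) / 5 / Nat.clog 2 n ∧
    (n - 1) / 5 / Nat.clog 2 n ≤ 4 ^ (Nat.clog 2 n - 1) ∧
    (n : ℝ) / 10 ≤ ((n - 1) / 5 : ℕ) ∧
        n / (60 * Real.log n) ≤ ((n - 1) / 5 / Nat.clog 2 n : ℕ) := by
  -- `20` gives `1 / log n ≤ 1 / 20`; `12` gives `(n - 1) / 5 - 1 ≥ n / 10`; and `180 = 3 * 60`
  -- turns the bounds `l ≤ 3 log n` and `b ≥ n / (60 log n)` into `l / b ≤ 1 / log n`.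
  filter_upwards [tendsto_log_natCast.eventually_ge_atTop 20, eventually_ge_atTop 12,
    eventually_log_natCast_pow_le 3 (by norm_num : (0 : ℝ) < 180)] with n h20 h10 h3
  set L := Real.log n
  have hl2 : 2 ≤ Nat.clog 2 n := by
    by_contra h
    have := (Nat.le_pow_clog one_lt_two n).trans (Nat.pow_le_pow_right two_pos (by omega : _ ≤ 1))
    omega
  have hB : (n : ℝ) / 10 ≤ ((n - 1) / 5 : ℕ) := by
    have h := le_natDiv (n - 1) 5 (by norm_num)
    rw [Nat.cast_sub (by omega)] at h
    have : (12 : ℝ) ≤ n := by exact_mod_cast h10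
    push_cast at h ⊢
    linarith
  have hlog := clog_le_log (n := n) (by linarith)
  have hl0 : (0 : ℝ) < Nat.clog 2 n := by exact_mod_cast (by omega : 0 < Nat.clog 2 n)
  have hn0 : (0 : ℝ) < n := by exact_mod_cast (by omega : 0 < n)
  have hL0 : 0 < L := by linarith
  have hL2 : 400 ≤ L ^ 2 := by nlinarith
  have hL : 60 * L ≤ n := by nlinarith
  have h1 : 1 ≤ n / (60 * L) := by rw [le_div_iff₀ (by positivity)]; linarith
  have hb : n / (60 * L) ≤ ((n - 1) / 5 / Nat.clog 2 n : ℕ) := by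
    refine le_trans ?_ (le_natDiv _ _ (by omega))
    have h2 : (n : ℝ) / 10 / (3 * L) ≤ ((n - 1) / 5 : ℕ) / (Nat.clog 2 n : ℝ) :=
      div_le_div₀ (by positivity) hB hl0 hlog
    -- Half of the quotient is at least `1` and pays for rounding down.
    have h4 : (n : ℝ) / 10 / (3 * L) = 2 * (n / (60 * L)) := by field_simp; norm_num
    linarith
  refine ⟨h20, h3, by omega, by exact_mod_cast h1.trans hb, ?_, hB, hb⟩
  calc (n - 1) / 5 / Nat.clog 2 n ≤ (n - 1) / 5 := Nat.div_le_self _ _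
    _ ≤ n := by omega
    _ ≤ 2 ^ Nat.clog 2 n := Nat.le_pow_clog one_lt_two n
    _ ≤ 2 ^ (2 * (Nat.clog 2 n - 1)) := Nat.pow_le_pow_right two_pos (by omega)
    _ = 4 ^ (Nat.clog 2 n - 1) := by rw [pow_mul]; norm_num

/-- Since `2 * n.choose 2 ≤ n ^ 2`, the keeping probability is at least `m / n ^ 2`. Of the factor
`δ⁻⁴` in `m`, `δ⁻²` cancels and the other `δ⁻²` is simply dropped. -/
theorem keepProb_mul_ge {n m : ℕ} {δ K : ℝ} (hn : 2 ≤ n) (hδ : 0 < δ) (hδ1 : δ < 1) (hK : 0 ≤ K)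
    (hm : n * (K * (1 / δ ^ 4 * Real.log n)) ≤ m) : K * Real.log n / n ≤ keepProb n m * δ ^ 2 := by
  have hN : ((2 * n.choose 2 - 1 + 1 : ℕ) : ℝ) ≤ n * n := by
    have h1 : 0 < n.choose 2 := Nat.choose_pos hn
    have h2 := Nat.triangle_succ (n - 1)
    have h3 : 2 * n.choose 2 ≤ n * (n - 1) := by
      rw [Nat.choose_two_right]
      exact Nat.mul_div_le _ _
    have h4 : n * (n - 1) ≤ n * n := Nat.mul_le_mul_left _ (by omega)
    exact_mod_cast (by omega : 2 * n.choose 2 - 1 + 1 ≤ n * n)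
  have hn0 : (0 : ℝ) < n := by exact_mod_cast (by omega : 0 < n)
  have hL : 0 ≤ Real.log n := Real.log_natCast_nonneg n
  have h5 : (m : ℝ) / (n * n) ≤ keepProb n m := by
    unfold keepProb
    exact div_le_div_of_nonneg_left (Nat.cast_nonneg m) (by positivity) hN
  have hδ2 : δ ^ 2 ≤ 1 := pow_le_one₀ hδ.le hδ1.le
  have h6 : K * Real.log n / n ≤ n * (K * (1 / δ ^ 4 * Real.log n)) / (n * n) * δ ^ 2 := by
    have e : n * (K * (1 / δ ^ 4 * Real.log n)) / (n * n) * δ ^ 2 = K * Real.log n / n * (1 / δ ^ 2) := by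
      field_simp
    rw [e]
    refine le_mul_of_one_le_right (by positivity) ?_
    rw [le_div_iff₀ (by positivity)]
    linarith
  refine h6.trans (mul_le_mul_of_nonneg_right ?_ (by positivity))
  exact (div_le_div_of_nonneg_right hm (by positivity)).trans h5

/-- For a large number of items, `1000 n log n / δ⁴` queries suffice. -/
theorem eventually_successProb_ge : ∀ᶠ n : ℕ in atTop, ∀ (m : ℕ) (δ : ℝ) (σ : Fin n → ℤˣ), 0 < δ →
    δ < 1 → m ≤ n.choose 2 → n * (1000 * (1 / δ ^ 4 * Real.log n)) ≤ m →
    ENNReal.ofReal (1 - (3 / n + 108 / Real.log n)) ≤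
      algorithm.successProb m (timeBound.eval n) δ σ := by
  filter_upwards [eventually_layer_sizes, eventually_ge_atTop 2] with n hn hn2 m δ σ hδ hδ1 hm hm1
  obtain ⟨h20, h3, hl, hb, hb4, hB, hbr⟩ := hn
  have hq := keepProb_mul_ge hn2 hδ hδ1 (by norm_num) hm1
  set L := Real.log n with hLdef
  have hL0 : 0 < L := by linarith
  have hn0 : (0 : ℝ) < n := by exact_mod_cast (by omega : 0 < n)
  set B : ℝ := (((n - 1) / 5 : ℕ) : ℝ)
  set b : ℝ := (((n - 1) / 5 / Nat.clog 2 n : ℕ) : ℝ)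
  have hB0 : 0 < B := lt_of_lt_of_le (by positivity) hB
  have hb0 : 0 < b := lt_of_lt_of_le (by positivity) hbr
  set q := keepProb n m * δ ^ 2 with hqdef
  have hq0 : 0 < q := lt_of_lt_of_le (by positivity) hq
  have hΓ : 1 / q ≤ n / (1000 * L) := by
    rw [show n / (1000 * L) = 1 / (1000 * L / n) by field_simp]
    exact one_div_le_one_div_of_le (by positivity) hq
  have hδ4 : δ ^ 4 ≤ 1 := pow_le_one₀ hδ.le hδ1.le
  have hmn : 10 * (n : ℝ) ≤ m := by
    refine le_trans ?_ hm1
    have : 1 * L ≤ 1 / δ ^ 4 * L := by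
      refine mul_le_mul_of_nonneg_right ?_ hL0.le
      rw [le_div_iff₀ (by positivity)]
      linarith
    nlinarith
  have hm0 : 0 < m := by
    have : (0 : ℝ) < m := by linarith
    exact_mod_cast this
  -- The constant `1000` gives `1 / q ≤ n / (1000 L)`. Hence `1 / (q b) ≤ 60 / 1000`, `1 / (q B) ≤ 1
  -- / (100 L)`, and a vote errs with probability at most `exp (-10 L) ≤ 1 / n ^ 2`.
  refine le_trans (ENNReal.ofReal_le_ofReal ?_) (successProb_ge_of_bounds (ε := 1 / L) hm hm0 hδ hδ1 σ
    hb hl hb4 ?_ ?_ ?_ ?_)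
  · have hexpL : Real.exp (-L) = 1 / n := by
      rw [Real.exp_neg, hLdef, Real.exp_log hn0, inv_eq_one_div]
    have e1 : Real.exp (-(m / 10 : ℝ)) ≤ 1 / n := by
      have : Real.exp (-(m / 10 : ℝ)) ≤ Real.exp (-L) := Real.exp_le_exp.2 (by
        have := Real.log_le_sub_one_of_pos hn0
        linarith)
      rwa [hexpL] at this
    have e2 : Real.exp (-(keepProb n m * B * δ ^ 2 / 10)) ≤ 1 / n * (1 / n) := by
      have hqB : 1000 * L / n * (n / 10) ≤ q * B := mul_le_mul hq hB (by positivity) hq0.le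
      have hqB' : 1000 * L / n * (n / 10) = 100 * L := by field_simp; norm_num
      have : Real.exp (-(keepProb n m * B * δ ^ 2 / 10)) ≤ Real.exp (-L + -L) := Real.exp_le_exp.2 (by
        have : keepProb n m * B * δ ^ 2 = q * B := by rw [hqdef]; ring
        rw [this]
        linarith)
      rwa [Real.exp_add, hexpL] at this
    have e3 := mul_le_mul_of_nonneg_left e2 (by positivity : (0 : ℝ) ≤ 2 * n)
    have e4 : 2 * (n : ℝ) * (1 / n * (1 / n)) = 2 / n := by field_simp
    have e5 : (3 : ℝ) / n = 1 / n + 2 / n := by ring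
    have e6 : 108 / L = 108 * (1 / L) := by ring
    rw [e5, e6]
    linarith
  · rw [div_le_iff₀ hb0]
    have : n / (1000 * L) = 60 / 1000 * (n / (60 * L)) := by field_simp
    linarith
  · rw [div_le_iff₀ hB0]
    have h1 : 1 / L * (n / 10) ≤ 1 / L * B := mul_le_mul_of_nonneg_left hB (by positivity)
    have h2 : n / (1000 * L) = 1 / 100 * (1 / L * (n / 10)) := by field_simp; norm_num
    have h4 : 0 ≤ 1 / L * (n / 10) := by positivity
    linarith
  · have hlog := clog_le_log (n := n) (by linarith)
    rw [div_le_iff₀ hb0]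
    have h1 : 1 / L * (n / (60 * L)) ≤ 1 / L * b := mul_le_mul_of_nonneg_left hbr (by positivity)
    have h2 : 3 * L ≤ 1 / L * (n / (60 * L)) := by
      rw [one_div_mul_eq_div, div_div, le_div_iff₀ (by positivity)]
      linarith
    linarith
  · exact one_div_le_one_div_of_le (by norm_num) h20

theorem tendsto_successProb {δ : ℕ → ℝ} (σ : ∀ n : ℕ, Fin n → ℤˣ) (hδ : ∀ n, 0 < δ n ∧ δ n < 1)
    (hm : ∀ᶠ n in atTop, budget 1000 (δ n) n ≤ n.choose 2) :
    Tendsto (fun n => algorithm.successProb (budget 1000 (δ n) n) (timeBound.eval n) (δ n) (σ n))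
      atTop (𝓝 1) := by
  have hlow : Tendsto (fun n : ℕ => ENNReal.ofReal (1 - (3 / n + 108 / Real.log n))) atTop (𝓝 1) := by
    have h : Tendsto (fun n : ℕ => (1 : ℝ) - (3 / n + 108 / Real.log n)) atTop (𝓝 (1 - (0 + 0))) :=
      tendsto_const_nhds.sub ((tendsto_const_div_atTop_nhds_zero_nat 3).add
        (tendsto_log_natCast.const_div_atTop 108))
    simpa using ENNReal.tendsto_ofReal h
  refine tendsto_of_tendsto_of_tendsto_of_le_of_le' hlow tendsto_const_nhds ?_
    (Eventually.of_forall fun n => successProb_le_one _ (hδ n).1 (hδ n).2 _)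
  filter_upwards [eventually_successProb_ge, hm] with n h hmn
  refine h _ _ _ (hδ n).1 (hδ n).2 hmn (le_trans ?_ (Nat.le_ceil _))
  gcongr
  -- Recovery needs only the term with `log n` of the maximum.
  exact le_max_left _ _

/-- For a fixed bias, the number of queries is admissible. -/
theorem eventually_budget_le {δ : ℝ} (hδ : 0 < δ) (hδ1 : δ < 1) {K : ℝ} (hK : 0 < K) :
    ∀ᶠ n in atTop, budget K δ n ≤ n.choose 2 := by
  set c := Real.log (1 / δ) with hc
  have hc0 : 0 < c := Real.log_pos (by rw [lt_div_iff₀ hδ]; linarith)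
  have hlog : ∀ᶠ u : ℝ in atTop, Real.log u ≤ (4 * c)⁻¹ * u := by
    filter_upwards [Real.isLittleO_log_id_atTop.bound (inv_pos.2 (by positivity : 0 < 4 * c)),
      eventually_ge_atTop 0] with u hu hu0
    simp only [id, Real.norm_eq_abs, abs_of_nonneg hu0] at hu
    exact (le_abs_self _).trans hu
  filter_upwards [eventually_log_natCast_pow_le 1 (by positivity : 0 < 4 * K * (1 / δ ^ 4)),
    tendsto_log_natCast.eventually hlog, tendsto_log_natCast.eventually_ge_atTop 3,
    tendsto_log_natCast.eventually_ge_atTop (2 * (8 * c + Real.log (4 * K))),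
    eventually_ge_atTop 2] with n h1 h2 h3 h4 hn2
  have hn0 : (0 : ℝ) < n := by exact_mod_cast (by omega : 0 < n)
  have hn2' : (2 : ℝ) ≤ n := by exact_mod_cast hn2
  set L := Real.log n with hL
  have hy : 0 < Real.log L := Real.log_pos (by linarith)
  -- The exponent is of order `√(log log n)`, so for a fixed bias the power of `1 / δ` is `n ^
  -- o(1)`; below, the crude bound `√y ≤ 1 + y` with `y = log log n` is enough.
  have hexp : 4 + (2 + 2 * eps n) / eps n = 6 + 2 * √(Real.log L) := by
    have : 0 < √(Real.log L) := Real.sqrt_pos.2 hy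
    rw [eps, ← hL]
    field_simp
    ring
  have hdeg : K * degreeBound δ n ≤ n / 4 := by
    rw [← le_div_iff₀' hK]
    refine max_le ?_ ?_
    · rw [le_div_iff₀ hK]
      linarith
    · rw [hexp, Real.rpow_def_of_pos (by positivity), ← hc, div_div, le_div_iff₀ (by positivity)]
      have hsq : √(Real.log L) ≤ 1 + Real.log L := by
        rw [Real.sqrt_le_left (by linarith)]
        nlinarith
      have h5 : c * Real.log L ≤ L / 4 := by
        have := mul_le_mul_of_nonneg_left h2 hc0.le
        have e : c * ((4 * c)⁻¹ * L) = L / 4 := by field_simp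
        linarith
      have h6 : c * (6 + 2 * √(Real.log L)) + Real.log (4 * K) ≤ L := by
        have := mul_le_mul_of_nonneg_left hsq hc0.le
        linarith
      calc Real.exp (c * (6 + 2 * √(Real.log L))) * (4 * K) =
            Real.exp (c * (6 + 2 * √(Real.log L)) + Real.log (4 * K)) := by
            rw [Real.exp_add, Real.exp_log (by positivity)]
        _ ≤ Real.exp L := Real.exp_le_exp.2 h6
        _ = n := Real.exp_log hn0
  -- What remains is `n * (n / 4) ≤ n * (n - 1) / 2`, which holds for `n ≥ 2`.
  rw [budget, Nat.ceil_le, Nat.cast_choose_two]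
  have := mul_le_mul_of_nonneg_left hdeg hn0.le
  nlinarith

end NoisyClustering

end

open NoisyClustering
theorem theorem2 :
    ∃ (A : Algorithm) (p : Polynomial ℕ),
      -- each of the two programs of `A` runs in time polynomial in `n`
      (∀ n m : ℕ, m ≤ n.choose 2 → A.RunsWithin n m (p.eval n)) ∧
      -- `A` makes `m` distinct queries, and the set of these is uniformly random
      (∀ (n m : ℕ) (h : m ≤ n.choose 2),
        ((A.samplerStart n m).run (p.eval n)).map (querySet m) =
          PMF.uniformOfFinset (Finset.powersetCard m (pairs n)) (powersetCard_pairs_nonempty h)) ∧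
      ∃ K : ℝ, 0 < K ∧
        -- for a fixed bias, the number of queries is admissible for all large `n`
        (∀ δ : ℝ, 0 < δ → δ < 1 → ∀ᶠ n in atTop, budget K δ n ≤ n.choose 2) ∧
        -- for every bias, fixed or not, `A` recovers the clustering with high probability
        (∀ (δ : ℕ → ℝ) (σ : ∀ n : ℕ, Fin n → ℤˣ), (∀ n, 0 < δ n ∧ δ n < 1) →
          (∀ᶠ n in atTop, budget K (δ n) n ≤ n.choose 2) →
          Tendsto (fun n => A.successProb (budget K (δ n) n) (p.eval n) (δ n) (σ n)) atTop
            (𝓝 1)) :=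
  ⟨algorithm, timeBound, fun _ _ hm => runsWithin hm,
      fun _ _ hm => map_querySet hm (sampler_time_le _),
    1000, by norm_num, fun _ hδ hδ1 => eventually_budget_le hδ hδ1 (by norm_num),
    fun _ σ hδ hm => tendsto_successProb σ hδ hm⟩
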